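/- Let $\Bbbk$ be a field. All spaces below are finite-dimensional $\Bbbk$-spaces, and all structure maps $\alpha$ are bijective and linear; $i,j,k,m$ denote integers. **Hom-structures.** A Hom-algebra $(A,\mu,1_A,\alpha)$ satisfies $\alpha(a)(bc)=(ab)\alpha(c)$, $\alpha(1_A)=1_A$, $1_Aa=a1_A=\alpha(a)$. A Hom-coalgebra $(C,\Delta,\varepsilon,\alpha)$ satisfies $\varepsilon\circ\alpha=\varepsilon$, $\alpha(c_1)\otimes\Delta(c_2)=\Delta(c_1)\otimes\alpha(c_2)$, $\varepsilon(c_1)c_2=c_1\varepsilon(c_2)=\alpha(c)$. A Hom-bialgebra is both, with the same $\alpha$, such that $\Delta$ and $\varepsilon$ are multiplicative and preserve units. A right module $(U,\alpha_U)$ over a Hom-algebra satisfies $(u\cdot a)\cdot\alpha(b)=\alpha_U(u)\cdot(ab)$ and $u\cdot 1=\alpha_U(u)$; a right comodule $(U,\alpha_U,\rho)$, $\rho(u)=u_{[0]}\otimes u_{[1]}$, over a Hom-coalgebra satisfies $\alpha_U(u_{[0]})\otimes\Delta(u_{[1]})=\rho(u_{[0]})\otimes\alpha(u_{[1]})$ and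 $\varepsilon(u_{[1]})u_{[0]}=\alpha_U(u)$. **Datum.** A Hom-Doi-Hopf datum $(H,A,C)$ consists of a Hom-bialgebra $H$, a Hom-algebra $A$ that is a right $H$-comodule (with structure map $\alpha_A$), $a\mapsto a_{(0)}\otimes a_{(1)}$, with $(ab)_{(0)}\otimes(ab)_{(1)}=a_{(0)}b_{(0)}\otimes a_{(1)}b_{(1)}$ and $(1_A)_{(0)}\otimes (1_A)_{(1)}=1_A\otimes1_H$, and a Hom-coalgebra $C$ that is a right $H$-module (with structure map $\alpha_C$) with $\Delta(c\cdot h)=c_1\cdot h_1\otimes c_2\cdot h_2$ and $\varepsilon(c\cdot h)=\varepsilon(c)\varepsilon(h)$. A $k$-th Doi-Hopf module is a right $A$-module and right $C$-comodule $(U,\alpha_U)$ with $\rho(u\cdot a)=u_{[0]}\cdot a_{(0)}\otimes u_{[1]}\cdot\alpha_H^k(a_{(1)})$; with $A$-linear $C$-colinear maps these form the category $\mathcal H(k)_A^C$. **Entwinings and cotwistors.** For a Hom-coalgebra $C$ and a Hom-algebra $A$, a linear map $\Phi:C\otimes A\to A\otimes C$, $\Phi(c\otimes a)=\sum a_\Phi\otimes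 c^\Phi$ (also written with $\Psi=\Phi$), commuting with the maps $\alpha$, is Hom-entwining if (E1) $\sum a_\Phi b_\Psi\otimes\alpha_C(c^{\Phi\Psi})=\sum(ab)_\Phi\otimes\alpha_C(c)^\Phi$; (E2) $\sum\alpha_A(a)_{\Psi\Phi}\otimes c_1{}^\Phi\otimes c_2{}^\Psi=\sum\alpha_A(a_\Phi)\otimes(c^\Phi)_1\otimes(c^\Phi)_2$; (E3) $\sum\varepsilon_C(c^\Phi)a_\Phi=\varepsilon_C(c)a$; (E4) $\Phi(c\otimes 1_A)=1_A\otimes c$. If $A,C$ are Hom-bialgebras, a Hom-entwining $\Phi$ is Hom-monoidal if moreover (E5) $\sum (a_1)_\Phi\otimes(a_2)_\Psi\otimes\alpha_C^2(c)^\Phi\alpha_C^2(d)^\Psi=\sum(a_\Phi)_1\otimes(a_\Phi)_2\otimes\alpha_C^2((cd)^\Phi)$; (E6) $\sum\varepsilon_A(a_\Phi)(1_C)^\Phi=\varepsilon_A(a)1_C$. For Hom-coalgebras $B,D$, a linear map $\varphi:B\otimes D\to D\otimes B$, $\varphi(b\otimes d)=\sum d^\varphi\otimes b^\varphi$ (also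 written with $\phi=\varphi$), commuting with the maps $\alpha$, is a Hom-cotwistor if (M1) $\sum\alpha_D(d)^{\varphi\phi}\otimes b_1{}^\phi\otimes b_2{}^\varphi=\sum\alpha_D(d^\varphi)\otimes(b^\varphi)_1\otimes(b^\varphi)_2$; (M2) $\sum d_1{}^\varphi\otimes d_2{}^\phi\otimes\alpha_B(b)^{\varphi\phi}=\sum(d^\varphi)_1\otimes(d^\varphi)_2\otimes\alpha_B(b^\varphi)$; (M3) $\sum\varepsilon_D(d^\varphi)b^\varphi=\varepsilon_D(d)b$; (M4) $\sum\varepsilon_B(b^\varphi)d^\varphi=\varepsilon_B(b)d$. If $B,D$ are Hom-bialgebras, it is monoidal if moreover (M5) $\varphi(a\otimes h)\,\varphi(b\otimes g)=\varphi(ab\otimes hg)$ in $D\otimes B$ and (M6) $\varphi(1_B\otimes1_D)=1_D\otimes1_B$. **The codouble.** Let $(H,A,C)$ be a Hom-Doi-Hopf datum with $A$ and $C$ Hom-bialgebras. Let $A^{*cop}$ be $A^*$ with the Hom-bialgebra structure $\alpha(f)=f\circ\alpha_A^{-1}$, $f_1(x)f_2(y)=f(\alpha_A^{-2}(yx))$,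 $\overline\varepsilon(f)=f(1_A)$, $(f*g)(y)=f(\alpha_A^{-2}(y_1))\,g(\alpha_A^{-2}(y_2))$, unit $\varepsilon_A$. For $m\in\mathbb Z$ put $$\Phi(c\otimes a)=\alpha_A^{-1}(a_{(0)})\otimes\alpha_C^{-1}(c)\cdot\alpha_H^m(a_{(1)}),\qquad \varphi(f\otimes c)=\sum_s f\big(\alpha_A^{-1}((e_s)_{(0)})\big)\,\alpha_C^{-1}(c)\cdot\alpha_H^m((e_s)_{(1)})\otimes e^s,$$ with dual bases $e_s,e^s$ of $A,A^*$. The $m$-th Doi-codouble is $A^{*cop}\otimes C$ with $\alpha_{A^{*cop}}\otimes\alpha_C$, $\widehat\Delta(f\otimes c)=\sum(f_1\otimes c_1{}^\varphi)\otimes(f_2{}^\varphi\otimes c_2)$ (with $f_1\otimes f_2$ the coproduct of $A^{*cop}$), $\widehat\varepsilon(f\otimes c)=f(1_A)\varepsilon_C(c)$. **Theorem.** For all integers $m,k,i,j$ the following are equivalent: (1) for all $c,d\in C$, $a\in A$: ${a_1}_{(0)}\otimes{a_2}_{(0)}\otimes(c\cdot{a_1}_{(1)})(d\cdot{a_2}_{(1)})={a_{(0)}}_1\otimes{a_{(0)}}_2\otimes(cd)\cdot\alpha_H^2(a_{(1)})$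 and $\varepsilon_A(a)1_C=1_C\cdot a_{(1)}\,\varepsilon_A(a_{(0)})$; (2) $\Phi$ is a Hom-monoidal entwining; (3) $\varphi:A^{*cop}\otimes C\to C\otimes A^{*cop}$ is a monoidal Hom-cotwistor; (4) the $m$-th Doi-codouble $A^{*cop}\otimes C$ is a Hom-bialgebra with the product $(f\otimes x)(f'\otimes y)=f*f'\otimes xy$ and unit $\varepsilon_A\otimes1_C$; (5) $\mathcal H(k)_A^C$ is a monoidal category with the following structure: the tensor product of $(U,\alpha_U)$ and $(V,\alpha_V)$ is $(U\otimes V,\alpha_U\otimes\alpha_V)$ with $$(u\otimes v)\cdot a=u\cdot\alpha_A^{-i-2}(a_1)\otimes v\cdot\alpha_A^{-j-2}(a_2),\qquad \rho(u\otimes v)=u_{[0]}\otimes v_{[0]}\otimes\alpha_C^i(u_{[1]})\alpha_C^j(v_{[1]});$$ the tensor product of morphisms is that of linear maps; the unit is $(\Bbbk,\mathrm{id})$ with $\lambda\cdot a=\varepsilon_A(a)\lambda$, $\rho(\lambda)=\lambda\otimes1_C$; the constraints are $(x\otimes y)\otimes z\mapsto\alpha^{i+1}(x)\otimes(y\otimes\alpha^{-j-1}(z))$,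 $\lambda\otimes x\mapsto\lambda\alpha^{j+1}(x)$, $x\otimes\lambda\mapsto\lambda\alpha^{i+1}(x)$. If these conditions hold, then, for all $m,k,i,j$, the category of right comodules of the Hom-bialgebra $X=A^{*cop}\otimes C$ (the $m$-th Doi-codouble) is a monoidal category $Corep^{i,j}(X)$ with coaction $u\otimes v\mapsto u_{\langle0\rangle}\otimes v_{\langle0\rangle}\otimes\alpha_X^i(u_{\langle1\rangle})\alpha_X^j(v_{\langle1\rangle})$ on tensor products, unit $\lambda\mapsto\lambda\otimes 1_X$ and the same constraints, and $\mathcal H(k)_A^C$ is isomorphic to it as a monoidal category. -/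

import Mathlib

open scoped TensorProduct
open CategoryTheory

universe u

noncomputable section

namespace HomDoiHopf

/-! ### Hom-algebras, Hom-coalgebras, Hom-bialgebras, modules and comodules

All structure maps `α` are bijective. Multiplications and actions are curried bilinear maps. -/

/-- A unital Hom-algebra on the space `V`. -/
structure HomAlgebra (K : Type u) [Field K] (V : Type u) [AddCommGroup V] [Module K V] where
  α : V ≃ₗ[K] V
  mul : V →ₗ[K] V →ₗ[K] V
  one : V
  mul_assoc : ∀ a b c, mul (α a) (mul b c) = mul (mul a b) (α c)
  α_one : α one = one
  one_mul : ∀ a, mul one a = α a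
  mul_one : ∀ a, mul a one = α a

/-- A counital Hom-coalgebra on the space `V`. -/
structure HomCoalgebra (K : Type u) [Field K] (V : Type u) [AddCommGroup V] [Module K V] where
  α : V ≃ₗ[K] V
  comul : V →ₗ[K] V ⊗[K] V
  counit : V →ₗ[K] K
  counit_α : ∀ c, counit (α c) = counit c
  coassoc : ∀ c, TensorProduct.map α.toLinearMap comul (comul c) =
    TensorProduct.assoc K V V V (TensorProduct.map comul α.toLinearMap (comul c))
  counit_comul : ∀ c, TensorProduct.lid K V (counit.rTensor V (comul c)) = α c
  comul_counit : ∀ c, TensorProduct.rid K V (counit.lTensor V (comul c)) = α c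

/-- A Hom-bialgebra: a Hom-algebra and a Hom-coalgebra with the same structure map `α`, such that
comultiplication and counit are multiplicative and preserve the unit. -/
structure HomBialgebra (K : Type u) [Field K] (V : Type u) [AddCommGroup V] [Module K V]
    extends HomAlgebra K V, HomCoalgebra K V where
  comul_mul : ∀ a b, comul (mul a b) = TensorProduct.map₂ mul mul (comul a) (comul b)
  comul_one : comul one = one ⊗ₜ[K] one
  counit_mul : ∀ a b, counit (mul a b) = counit a * counit b
  counit_one : counit one = 1

section Basic

variable {K : Type u} [Field K]
variable {VH VA VC U : Type u} [AddCommGroup VH] [Module K VH] [AddCommGroup VA] [Module K VA]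
  [AddCommGroup VC] [Module K VC] [AddCommGroup U] [Module K U]

/-- The right Hom-module axioms for `(U, αU)` with action `act u a = u · a`. -/
structure IsRightModule (A : HomAlgebra K VA) (αU : U ≃ₗ[K] U) (act : U →ₗ[K] VA →ₗ[K] U) :
    Prop where
  act_act : ∀ u a b, act (act u a) (A.α b) = act (αU u) (A.mul a b)
  act_one : ∀ u, act u A.one = αU u

/-- The right Hom-comodule axioms for `(U, αU)` with coaction `ρ`. -/
structure IsRightComodule (C : HomCoalgebra K VC) (αU : U ≃ₗ[K] U) (ρ : U →ₗ[K] U ⊗[K] VC) :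
    Prop where
  coact_coact : ∀ u, TensorProduct.map αU.toLinearMap C.comul (ρ u) =
    TensorProduct.assoc K U VC VC (TensorProduct.map ρ C.α.toLinearMap (ρ u))
  coact_counit : ∀ u, TensorProduct.rid K U (C.counit.lTensor U (ρ u)) = αU u

/-- A Hom-Doi-Hopf datum `(H, A, C)`: a right `H`-comodule algebra `A` (coaction `ρ`) and a right
`H`-module coalgebra `C` (action `act`). -/
structure DoiHopfDatum (H : HomBialgebra K VH) (A : HomAlgebra K VA) (C : HomCoalgebra K VC) where
  ρ : VA →ₗ[K] VA ⊗[K] VH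
  act : VC →ₗ[K] VH →ₗ[K] VC
  isRightComodule : IsRightComodule H.toHomCoalgebra A.α ρ
  coact_mul : ∀ a b, ρ (A.mul a b) = TensorProduct.map₂ A.mul H.mul (ρ a) (ρ b)
  coact_one : ρ A.one = A.one ⊗ₜ[K] H.one
  isRightModule : IsRightModule H.toHomAlgebra C.α act
  comul_act : ∀ c h, C.comul (act c h) = TensorProduct.map₂ act act (C.comul c) (H.comul h)
  counit_act : ∀ c h, C.counit (act c h) = C.counit c * H.counit h

/-! ### Hom-entwining structures and Hom-cotwistors -/

/-- `Φ : C ⊗ A → A ⊗ C`, `Φ (c ⊗ a) = ∑ a_Φ ⊗ c^Φ`, is a Hom-entwining map. -/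
structure IsEntwining (C : HomCoalgebra K VC) (A : HomAlgebra K VA)
    (Φ : VC ⊗[K] VA →ₗ[K] VA ⊗[K] VC) : Prop where
  map_α : ∀ c a, Φ (C.α c ⊗ₜ[K] A.α a) =
    TensorProduct.map A.α.toLinearMap C.α.toLinearMap (Φ (c ⊗ₜ[K] a))
  /-- `a_Φ b_Ψ ⊗ α (c^{ΦΨ}) = (ab)_Φ ⊗ α(c)^Φ` -/
  mul : ∀ c a b,
    TensorProduct.map (TensorProduct.lift A.mul) C.α.toLinearMap
      ((TensorProduct.assoc K VA VA VC).symm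
        (Φ.lTensor VA (TensorProduct.assoc K VA VC VA (Φ (c ⊗ₜ[K] a) ⊗ₜ[K] b)))) =
      Φ (C.α c ⊗ₜ[K] A.mul a b)
  /-- `α(a)_{ΨΦ} ⊗ c₁^Φ ⊗ c₂^Ψ = α (a_Φ) ⊗ (c^Φ)₁ ⊗ (c^Φ)₂` -/
  comul : ∀ c a,
    TensorProduct.assoc K VA VC VC
      (Φ.rTensor VC ((TensorProduct.assoc K VC VA VC).symm
        (Φ.lTensor VC (TensorProduct.assoc K VC VC VA (C.comul c ⊗ₜ[K] A.α a))))) =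
      TensorProduct.map A.α.toLinearMap C.comul (Φ (c ⊗ₜ[K] a))
  counit : ∀ c a, TensorProduct.rid K VA (C.counit.lTensor VA (Φ (c ⊗ₜ[K] a))) = C.counit c • a
  one : ∀ c, Φ (c ⊗ₜ[K] A.one) = A.one ⊗ₜ[K] c

/-- `(C, A, Φ)` is a Hom-monoidal entwining datum. -/
structure IsMonoidalEntwining (C : HomBialgebra K VC) (A : HomBialgebra K VA)
    (Φ : VC ⊗[K] VA →ₗ[K] VA ⊗[K] VC) : Prop
    extends IsEntwining C.toHomCoalgebra A.toHomAlgebra Φ where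
  /-- `(a₁)_Φ ⊗ (a₂)_Ψ ⊗ α²(c)^Φ α²(d)^Ψ = (a_Φ)₁ ⊗ (a_Φ)₂ ⊗ α² ((cd)^Φ)` -/
  comul_mul : ∀ c d a,
    (TensorProduct.lift C.mul).lTensor (VA ⊗[K] VA)
      (TensorProduct.tensorTensorTensorComm K VA VC VA VC
        (TensorProduct.map
          (Φ ∘ₗ TensorProduct.mk K VC VA ((C.α ^ (2 : ℤ)) c))
          (Φ ∘ₗ TensorProduct.mk K VC VA ((C.α ^ (2 : ℤ)) d)) (A.comul a))) =
      TensorProduct.map A.comul (C.α ^ (2 : ℤ)).toLinearMap (Φ (C.mul c d ⊗ₜ[K] a))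
  /-- `ε (a_Φ) 1^Φ = ε (a) 1` -/
  counit_one : ∀ a, TensorProduct.lid K VC (A.counit.rTensor VC (Φ (C.one ⊗ₜ[K] a))) =
    A.counit a • C.one

variable {VB VD : Type u} [AddCommGroup VB] [Module K VB] [AddCommGroup VD] [Module K VD]

/-- `φ : B ⊗ D → D ⊗ B`, `φ (b ⊗ d) = ∑ d^φ ⊗ b^φ`, is a Hom-cotwistor. -/
structure IsCotwistor (B : HomCoalgebra K VB) (D : HomCoalgebra K VD)
    (φ : VB ⊗[K] VD →ₗ[K] VD ⊗[K] VB) : Prop where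
  map_α : ∀ b d, φ (B.α b ⊗ₜ[K] D.α d) =
    TensorProduct.map D.α.toLinearMap B.α.toLinearMap (φ (b ⊗ₜ[K] d))
  /-- `α(d)^{φϕ} ⊗ b₁^ϕ ⊗ b₂^φ = α (d^φ) ⊗ (b^φ)₁ ⊗ (b^φ)₂` -/
  comul_left : ∀ b d,
    TensorProduct.assoc K VD VB VB
      (φ.rTensor VB ((TensorProduct.assoc K VB VD VB).symm
        (φ.lTensor VB (TensorProduct.assoc K VB VB VD (B.comul b ⊗ₜ[K] D.α d))))) =
      TensorProduct.map D.α.toLinearMap B.comul (φ (b ⊗ₜ[K] d))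
  /-- `d₁^φ ⊗ d₂^ϕ ⊗ α(b)^{φϕ} = (d^φ)₁ ⊗ (d^φ)₂ ⊗ α (b^φ)` -/
  comul_right : ∀ b d,
    (TensorProduct.assoc K VD VD VB).symm
      (φ.lTensor VD (TensorProduct.assoc K VD VB VD
        (φ.rTensor VD ((TensorProduct.assoc K VB VD VD).symm (B.α b ⊗ₜ[K] D.comul d))))) =
      TensorProduct.map D.comul B.α.toLinearMap (φ (b ⊗ₜ[K] d))
  counit_right : ∀ b d,
    TensorProduct.lid K VB (D.counit.rTensor VB (φ (b ⊗ₜ[K] d))) = D.counit d • b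
  counit_left : ∀ b d,
    TensorProduct.rid K VD (B.counit.lTensor VD (φ (b ⊗ₜ[K] d))) = B.counit b • d

/-- `φ : B ⊗ D → D ⊗ B` is a monoidal Hom-cotwistor. -/
structure IsMonoidalCotwistor (B : HomBialgebra K VB) (D : HomBialgebra K VD)
    (φ : VB ⊗[K] VD →ₗ[K] VD ⊗[K] VB) : Prop
    extends IsCotwistor B.toHomCoalgebra D.toHomCoalgebra φ where
  mul : ∀ a b h g, TensorProduct.map₂ D.mul B.mul (φ (a ⊗ₜ[K] h)) (φ (b ⊗ₜ[K] g)) =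
    φ (B.mul a b ⊗ₜ[K] D.mul h g)
  one : φ (B.one ⊗ₜ[K] D.one) = D.one ⊗ₜ[K] B.one

/-- The smash coproduct comultiplication on `B ⊗ D` attached to `φ`:
`b ⊗ d ↦ ∑ (b₁ ⊗ d₁^φ) ⊗ (b₂^φ ⊗ d₂)`. -/
def smashComul (B : HomCoalgebra K VB) (D : HomCoalgebra K VD)
    (φ : VB ⊗[K] VD →ₗ[K] VD ⊗[K] VB) :
    VB ⊗[K] VD →ₗ[K] (VB ⊗[K] VD) ⊗[K] (VB ⊗[K] VD) :=
  (TensorProduct.assoc K VB VD (VB ⊗[K] VD)).symm.toLinearMap ∘ₗ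
    ((TensorProduct.assoc K VD VB VD).toLinearMap ∘ₗ φ.rTensor VD ∘ₗ
      (TensorProduct.assoc K VB VD VD).symm.toLinearMap).lTensor VB ∘ₗ
    (TensorProduct.assoc K VB VB (VD ⊗[K] VD)).toLinearMap ∘ₗ
    TensorProduct.map B.comul D.comul

/-! ### The dual `A^{*cop}` -/

lemma HomAlgebra.α_mul (A : HomAlgebra K VA) (a b : VA) :
    A.α (A.mul a b) = A.mul (A.α a) (A.α b) := by
  have h := A.mul_assoc a b A.one
  rw [A.mul_one, A.α_one, A.mul_one] at h
  exact h.symm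

lemma HomAlgebra.α_inv_mul (A : HomAlgebra K VA) (a b : VA) :
    A.α.symm (A.mul a b) = A.mul (A.α.symm a) (A.α.symm b) := by
  rw [LinearEquiv.symm_apply_eq, A.α_mul]; simp

lemma HomCoalgebra.comul_α (C : HomCoalgebra K VC) (c : VC) :
    C.comul (C.α c) = TensorProduct.map C.α.toLinearMap C.α.toLinearMap (C.comul c) := by
  have h1 : ∀ p : VC ⊗[K] VC,
      ((TensorProduct.rid K VC).toLinearMap ∘ₗ C.counit.lTensor VC).lTensor VC
        (TensorProduct.map C.α.toLinearMap C.comul p) =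
      TensorProduct.map C.α.toLinearMap C.α.toLinearMap p := by
    intro p
    induction p using TensorProduct.induction_on with
    | zero => simp
    | tmul x y => simp [C.comul_counit]
    | add x y hx hy => simp only [map_add, hx, hy]
  have h3 : ∀ (q : VC ⊗[K] VC) (y : VC),
      ((TensorProduct.rid K VC).toLinearMap ∘ₗ C.counit.lTensor VC).lTensor VC
        (TensorProduct.assoc K VC VC VC (q ⊗ₜ[K] C.α y)) = C.counit y • q := by
    intro q y
    induction q using TensorProduct.induction_on with
    | zero => simp
    | tmul x z => simp [C.counit_α]
    | add x z hx hz => simp only [TensorProduct.add_tmul, map_add, hx, hz, smul_add]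
  have h2 : ∀ p : VC ⊗[K] VC,
      ((TensorProduct.rid K VC).toLinearMap ∘ₗ C.counit.lTensor VC).lTensor VC
        (TensorProduct.assoc K VC VC VC (TensorProduct.map C.comul C.α.toLinearMap p)) =
      C.comul (TensorProduct.rid K VC (C.counit.lTensor VC p)) := by
    intro p
    induction p using TensorProduct.induction_on with
    | zero => simp
    | tmul x y => simp [h3]
    | add x y hx hy => simp only [map_add, hx, hy]
  rw [← h1, C.coassoc, h2, C.comul_counit]

lemma zpow_neg_two_apply {V : Type u} [AddCommGroup V] [Module K V] (e : V ≃ₗ[K] V) (x : V) :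
    (e ^ (-2 : ℤ)) x = e.symm (e.symm x) := rfl

lemma HomAlgebra.α_neg_two_mul (A : HomAlgebra K VA) (a b : VA) :
    (A.α ^ (-2 : ℤ)) (A.mul a b) = A.mul ((A.α ^ (-2 : ℤ)) a) ((A.α ^ (-2 : ℤ)) b) := by
  simp only [zpow_neg_two_apply, A.α_inv_mul]

lemma HomCoalgebra.comul_α_neg_two (C : HomCoalgebra K VC) (c : VC) :
    C.comul ((C.α ^ (-2 : ℤ)) c) =
      TensorProduct.map (C.α ^ (-2 : ℤ)).toLinearMap (C.α ^ (-2 : ℤ)).toLinearMap (C.comul c) := by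
  have hs : ∀ x, C.comul (C.α.symm x) =
      TensorProduct.map C.α.symm.toLinearMap C.α.symm.toLinearMap (C.comul x) := by
    intro x
    obtain ⟨y, rfl⟩ := C.α.surjective x
    rw [LinearEquiv.symm_apply_apply, C.comul_α, ← LinearMap.comp_apply, ← TensorProduct.map_comp]
    simp
  rw [zpow_neg_two_apply, hs, hs, ← LinearMap.comp_apply, ← TensorProduct.map_comp]
  rfl

/-- The convolution product on `A*`: `(f * g)(y) = f (α⁻² y₁) g (α⁻² y₂)`. -/
def dualMul (A : HomCoalgebra K VA) :
    Module.Dual K VA →ₗ[K] Module.Dual K VA →ₗ[K] Module.Dual K VA :=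
  (TensorProduct.mk K (Module.Dual K VA) (Module.Dual K VA)).compr₂
    ((TensorProduct.map (A.α ^ (-2 : ℤ)).toLinearMap (A.α ^ (-2 : ℤ)).toLinearMap ∘ₗ
      A.comul).dualMap ∘ₗ TensorProduct.dualDistrib K VA VA)

lemma dualMul_apply (A : HomCoalgebra K VA) (f g : Module.Dual K VA) (y : VA) :
    dualMul A f g y = TensorProduct.dualDistrib K VA VA (f ⊗ₜ[K] g)
      (TensorProduct.map (A.α ^ (-2 : ℤ)).toLinearMap (A.α ^ (-2 : ℤ)).toLinearMap
        (A.comul y)) := rfl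

lemma HomCoalgebra.counit_α_neg_two (A : HomCoalgebra K VA) (y : VA) :
    A.counit ((A.α ^ (-2 : ℤ)) y) = A.counit y := by
  have hs : ∀ x, A.counit (A.α.symm x) = A.counit x := by
    intro x
    rw [← A.counit_α, LinearEquiv.apply_symm_apply]
  rw [zpow_neg_two_apply, hs, hs]

/-- The Hom-algebra `A*` of a Hom-coalgebra `A`, with unit `ε` and `α(f) = f ∘ α⁻¹`. -/
def dualAlgebra (A : HomCoalgebra K VA) : HomAlgebra K (Module.Dual K VA) where
  α := A.α.symm.dualMap
  mul := dualMul A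
  one := A.counit
  mul_assoc f g h := by
    let P : Module.Dual K (VA ⊗[K] (VA ⊗[K] VA)) :=
      TensorProduct.dualDistrib K VA (VA ⊗[K] VA)
        (f ⊗ₜ[K] TensorProduct.dualDistrib K VA VA (g ⊗ₜ[K] h))
    let s : VA →ₗ[K] VA := (A.α ^ (-2 : ℤ)).toLinearMap
    have hs : ∀ x, s (s (A.α x)) = A.α.symm (s x) := by
      intro x
      simp only [s, LinearEquiv.coe_coe, zpow_neg_two_apply, LinearEquiv.symm_apply_apply]
    let S : VA ⊗[K] (VA ⊗[K] VA) →ₗ[K] VA ⊗[K] (VA ⊗[K] VA) :=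
      TensorProduct.map (s ∘ₗ s) (TensorProduct.map (s ∘ₗ s) (s ∘ₗ s))
    have h1 : ∀ p : VA ⊗[K] VA,
        TensorProduct.dualDistrib K VA VA (A.α.symm.dualMap f ⊗ₜ[K] dualMul A g h)
          (TensorProduct.map s s p) = P (S (TensorProduct.map A.α.toLinearMap A.comul p)) := by
      intro p
      induction p using TensorProduct.induction_on with
      | zero => simp
      | tmul x y =>
        simp only [TensorProduct.map_tmul, TensorProduct.dualDistrib_apply, P, S, dualMul_apply]
        rw [show s y = (A.α ^ (-2 : ℤ)) y from rfl, A.comul_α_neg_two, TensorProduct.map_comp]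
        simp only [LinearMap.comp_apply, LinearEquiv.coe_coe, hs]
        rfl
      | add p q hp hq => simp only [map_add, hp, hq]
    have h3 : ∀ (q : VA ⊗[K] VA) (y : VA),
        P (S (TensorProduct.assoc K _ _ _ (q ⊗ₜ[K] A.α y))) =
        TensorProduct.dualDistrib K VA VA (f ⊗ₜ[K] g)
          (TensorProduct.map (s ∘ₗ s) (s ∘ₗ s) q) * h (A.α.symm (s y)) := by
      intro q y
      induction q using TensorProduct.induction_on with
      | zero => simp
      | tmul x z => simp [P, S, hs, mul_assoc]
      | add p q hp hq => simp only [TensorProduct.add_tmul, map_add, hp, hq, add_mul]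
    have h2 : ∀ p : VA ⊗[K] VA,
        TensorProduct.dualDistrib K VA VA (dualMul A f g ⊗ₜ[K] A.α.symm.dualMap h)
          (TensorProduct.map s s p) =
        P (S (TensorProduct.assoc K _ _ _ (TensorProduct.map A.comul A.α.toLinearMap p))) := by
      intro p
      induction p using TensorProduct.induction_on with
      | zero => simp
      | tmul x y =>
        simp only [TensorProduct.map_tmul, LinearEquiv.coe_coe, h3,
          TensorProduct.dualDistrib_apply, dualMul_apply]
        rw [show s x = (A.α ^ (-2 : ℤ)) x from rfl, A.comul_α_neg_two, TensorProduct.map_comp]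
        rfl
      | add p q hp hq => simp only [map_add, hp, hq]
    ext y
    rw [dualMul_apply, dualMul_apply, h1, h2, A.coassoc]
  α_one := by
    ext y
    show A.counit (A.α.symm y) = A.counit y
    rw [← A.counit_α, LinearEquiv.apply_symm_apply]
  one_mul f := by
    have h1 : ∀ p : VA ⊗[K] VA,
        TensorProduct.dualDistrib K VA VA (A.counit ⊗ₜ[K] f)
          (TensorProduct.map (A.α ^ (-2 : ℤ)).toLinearMap (A.α ^ (-2 : ℤ)).toLinearMap p) =
        f ((A.α ^ (-2 : ℤ)) (TensorProduct.lid K VA (A.counit.rTensor VA p))) := by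
      intro p
      induction p using TensorProduct.induction_on with
      | zero => simp
      | tmul x y =>
        simp only [TensorProduct.map_tmul, LinearEquiv.coe_coe, TensorProduct.dualDistrib_apply,
          A.counit_α_neg_two, LinearMap.rTensor_tmul, TensorProduct.lid_tmul, map_smul,
          smul_eq_mul]
      | add p q hp hq => simp only [map_add, hp, hq]
    ext y
    rw [dualMul_apply, h1, A.counit_comul, zpow_neg_two_apply, LinearEquiv.symm_apply_apply]
    rfl
  mul_one f := by
    have h1 : ∀ p : VA ⊗[K] VA,
        TensorProduct.dualDistrib K VA VA (f ⊗ₜ[K] A.counit)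
          (TensorProduct.map (A.α ^ (-2 : ℤ)).toLinearMap (A.α ^ (-2 : ℤ)).toLinearMap p) =
        f ((A.α ^ (-2 : ℤ)) (TensorProduct.rid K VA (A.counit.lTensor VA p))) := by
      intro p
      induction p using TensorProduct.induction_on with
      | zero => simp
      | tmul x y =>
        simp only [TensorProduct.map_tmul, LinearEquiv.coe_coe, TensorProduct.dualDistrib_apply,
          A.counit_α_neg_two, LinearMap.lTensor_tmul, TensorProduct.rid_tmul, map_smul,
          smul_eq_mul, mul_comm]
      | add p q hp hq => simp only [map_add, hp, hq]
    ext y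
    rw [dualMul_apply, h1, A.comul_counit, zpow_neg_two_apply, LinearEquiv.symm_apply_apply]
    rfl

variable [Module.Finite K VA]

lemma dualDistrib_injective : Function.Injective (TensorProduct.dualDistrib K VA VA) :=
  (TensorProduct.dualDistribEquiv K VA VA).injective

lemma dual_tensor_ext {s t : Module.Dual K VA ⊗[K] Module.Dual K VA}
    (h : ∀ x y, TensorProduct.dualDistrib K VA VA s (x ⊗ₜ[K] y) =
      TensorProduct.dualDistrib K VA VA t (x ⊗ₜ[K] y)) : s = t :=
  dualDistrib_injective (TensorProduct.ext' h)

/-- The pairing of `A* ⊗ (A* ⊗ A*)` with `A ⊗ (A ⊗ A)`. -/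
def dualPairing₃ : Module.Dual K VA ⊗[K] (Module.Dual K VA ⊗[K] Module.Dual K VA) →ₗ[K]
    Module.Dual K (VA ⊗[K] (VA ⊗[K] VA)) :=
  TensorProduct.dualDistrib K VA (VA ⊗[K] VA) ∘ₗ
    (TensorProduct.dualDistrib K VA VA).lTensor (Module.Dual K VA)

lemma dual_tensor₃_ext
    {s t : Module.Dual K VA ⊗[K] (Module.Dual K VA ⊗[K] Module.Dual K VA)}
    (h : ∀ x y z, dualPairing₃ s (x ⊗ₜ[K] (y ⊗ₜ[K] z)) =
      dualPairing₃ t (x ⊗ₜ[K] (y ⊗ₜ[K] z))) : s = t := by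
  have h1 : Function.Injective (dualPairing₃ (K := K) (VA := VA)) := by
    have : ⇑(dualPairing₃ (K := K) (VA := VA)) =
        (LinearEquiv.lTensor (Module.Dual K VA) (TensorProduct.dualDistribEquiv K VA VA) ≪≫ₗ
          TensorProduct.dualDistribEquiv K VA (VA ⊗[K] VA)) := rfl
    rw [this]
    exact LinearEquiv.injective _
  apply h1
  apply TensorProduct.ext_threefold'
  exact h

/-- The comultiplication of `A^{*cop}`: `f₁(x) f₂(y) = f (α⁻² (y x))`. -/
def dualCopComul (A : HomAlgebra K VA) :
    Module.Dual K VA →ₗ[K] Module.Dual K VA ⊗[K] Module.Dual K VA :=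
  (TensorProduct.dualDistribEquiv K VA VA).symm.toLinearMap ∘ₗ
    ((A.α ^ (-2 : ℤ)).toLinearMap ∘ₗ TensorProduct.lift A.mul.flip).dualMap

lemma dualCopComul_apply (A : HomAlgebra K VA) (f : Module.Dual K VA) (x y : VA) :
    TensorProduct.dualDistrib K VA VA (dualCopComul A f) (x ⊗ₜ[K] y) =
      f ((A.α ^ (-2 : ℤ)) (A.mul y x)) := by
  have : TensorProduct.dualDistrib K VA VA (dualCopComul A f) =
      ((A.α ^ (-2 : ℤ)).toLinearMap ∘ₗ TensorProduct.lift A.mul.flip).dualMap f :=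
    (TensorProduct.dualDistribEquiv K VA VA).apply_symm_apply _
  rw [this]
  simp

/-- The Hom-coalgebra `A^{*cop}` of a finite-dimensional Hom-algebra `A`, with `ε(f) = f(1)` and
`α(f) = f ∘ α⁻¹`. -/
def dualCopCoalgebra (A : HomAlgebra K VA) : HomCoalgebra K (Module.Dual K VA) where
  α := A.α.symm.dualMap
  comul := dualCopComul A
  counit := Module.Dual.eval K VA A.one
  counit_α f := by
    have : A.α.symm A.one = A.one := by rw [LinearEquiv.symm_apply_eq, A.α_one]
    simp [this]
  coassoc f := by
    have h1 : ∀ (p : Module.Dual K VA ⊗[K] Module.Dual K VA) (x y z : VA),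
        dualPairing₃ (TensorProduct.map A.α.symm.dualMap.toLinearMap (dualCopComul A) p)
          (x ⊗ₜ[K] (y ⊗ₜ[K] z)) =
        TensorProduct.dualDistrib K VA VA p
          (A.α.symm x ⊗ₜ[K] (A.α ^ (-2 : ℤ)) (A.mul z y)) := by
      intro p x y z
      induction p using TensorProduct.induction_on with
      | zero => simp
      | tmul f g => simp [dualPairing₃, dualCopComul_apply]
      | add p q hp hq => simp only [map_add, LinearMap.add_apply, hp, hq]
    have h3 : ∀ (q : Module.Dual K VA ⊗[K] Module.Dual K VA) (g : Module.Dual K VA) (x y z : VA),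
        dualPairing₃ (TensorProduct.assoc K _ _ _ (q ⊗ₜ[K] g)) (x ⊗ₜ[K] (y ⊗ₜ[K] z)) =
        TensorProduct.dualDistrib K VA VA q (x ⊗ₜ[K] y) * g z := by
      intro q g x y z
      induction q using TensorProduct.induction_on with
      | zero => simp
      | tmul f f' => simp [dualPairing₃, mul_assoc]
      | add p q hp hq =>
        simp only [TensorProduct.add_tmul, map_add, LinearMap.add_apply, hp, hq, add_mul]
    have h2 : ∀ (p : Module.Dual K VA ⊗[K] Module.Dual K VA) (x y z : VA),
        dualPairing₃ (TensorProduct.assoc K _ _ _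
          (TensorProduct.map (dualCopComul A) A.α.symm.dualMap.toLinearMap p))
          (x ⊗ₜ[K] (y ⊗ₜ[K] z)) =
        TensorProduct.dualDistrib K VA VA p
          ((A.α ^ (-2 : ℤ)) (A.mul y x) ⊗ₜ[K] A.α.symm z) := by
      intro p x y z
      induction p using TensorProduct.induction_on with
      | zero => simp
      | tmul f g => simp [h3, dualCopComul_apply]
      | add p q hp hq => simp only [map_add, LinearMap.add_apply, hp, hq]
    apply dual_tensor₃_ext
    intro x y z
    rw [h1, h2, dualCopComul_apply, dualCopComul_apply]
    congr 2
    have := A.mul_assoc ((A.α ^ (-2 : ℤ)) z) ((A.α ^ (-2 : ℤ)) y) ((A.α ^ (-2 : ℤ)) x)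
    simp only [A.α_neg_two_mul]
    simpa only [zpow_neg_two_apply, LinearEquiv.apply_symm_apply] using this.symm
  counit_comul f := by
    have h1 : ∀ (p : Module.Dual K VA ⊗[K] Module.Dual K VA) (y : VA),
        TensorProduct.lid K _ ((Module.Dual.eval K VA A.one).rTensor _ p) y =
        TensorProduct.dualDistrib K VA VA p (A.one ⊗ₜ[K] y) := by
      intro p y
      induction p using TensorProduct.induction_on with
      | zero => simp
      | tmul f g => simp
      | add p q hp hq => simp only [map_add, LinearMap.add_apply, hp, hq]
    ext y
    rw [h1, dualCopComul_apply, A.mul_one, zpow_neg_two_apply, LinearEquiv.symm_apply_apply]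
    rfl
  comul_counit f := by
    have h1 : ∀ (p : Module.Dual K VA ⊗[K] Module.Dual K VA) (y : VA),
        TensorProduct.rid K _ ((Module.Dual.eval K VA A.one).lTensor _ p) y =
        TensorProduct.dualDistrib K VA VA p (y ⊗ₜ[K] A.one) := by
      intro p y
      induction p using TensorProduct.induction_on with
      | zero => simp
      | tmul f g => simp [mul_comm]
      | add p q hp hq => simp only [map_add, LinearMap.add_apply, hp, hq]
    ext y
    rw [h1, dualCopComul_apply, A.one_mul, zpow_neg_two_apply, LinearEquiv.symm_apply_apply]
    rfl

/-- The Hom-bialgebra `A^{*cop}` of a finite-dimensional Hom-bialgebra `A`. -/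
def dualCopBialgebra (A : HomBialgebra K VA) : HomBialgebra K (Module.Dual K VA) where
  __ := dualAlgebra A.toHomCoalgebra
  __ := dualCopCoalgebra A.toHomAlgebra
  comul_mul f g := by
    let s : VA →ₗ[K] VA := (A.α ^ (-2 : ℤ)).toLinearMap
    let dd := TensorProduct.dualDistrib K VA VA
    have key : ∀ (p q : Module.Dual K VA ⊗[K] Module.Dual K VA) (x y : VA),
        dd (TensorProduct.map₂ (dualMul A.toHomCoalgebra) (dualMul A.toHomCoalgebra) p q)
          (x ⊗ₜ[K] y) =
        TensorProduct.dualDistrib K _ _ (dd p ⊗ₜ[K] dd q)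
          (TensorProduct.tensorTensorTensorComm K VA VA VA VA
            (TensorProduct.map s s (A.comul x) ⊗ₜ[K] TensorProduct.map s s (A.comul y))) := by
      intro p q x y
      induction p using TensorProduct.induction_on with
      | zero => simp
      | add p p' hp hp' =>
        simp only [map_add, LinearMap.add_apply, TensorProduct.add_tmul, hp, hp']
      | tmul f f' =>
      induction q using TensorProduct.induction_on with
      | zero => simp
      | add p p' hp hp' =>
        simp only [map_add, LinearMap.add_apply, TensorProduct.tmul_add, hp, hp']
      | tmul g g' =>
      simp only [TensorProduct.map₂_apply_tmul, dd]
      change TensorProduct.dualDistrib K VA VA (f ⊗ₜ[K] g) (TensorProduct.map s s _) *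
        TensorProduct.dualDistrib K VA VA (f' ⊗ₜ[K] g') (TensorProduct.map s s _) = _
      generalize TensorProduct.map s s (A.comul x) = X
      generalize TensorProduct.map s s (A.comul y) = Y
      induction X using TensorProduct.induction_on with
      | zero => simp
      | add p p' hp hp' => simp only [map_add, TensorProduct.add_tmul, add_mul, hp, hp']
      | tmul x x' =>
      induction Y using TensorProduct.induction_on with
      | zero => simp
      | add p p' hp hp' => simp only [map_add, TensorProduct.tmul_add, mul_add, hp, hp']
      | tmul y y' =>
      simp only [TensorProduct.dualDistrib_apply, TensorProduct.tensorTensorTensorComm_tmul]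
      ring
    have key2 : ∀ X Y : VA ⊗[K] VA,
        TensorProduct.dualDistrib K _ _
          (dd (dualCopComul A.toHomAlgebra f) ⊗ₜ[K] dd (dualCopComul A.toHomAlgebra g))
          (TensorProduct.tensorTensorTensorComm K VA VA VA VA (X ⊗ₜ[K] Y)) =
        dd (f ⊗ₜ[K] g) (TensorProduct.map s s (TensorProduct.map₂ A.mul A.mul Y X)) := by
      intro X Y
      induction X using TensorProduct.induction_on with
      | zero => simp
      | add p p' hp hp' => simp only [map_add, TensorProduct.add_tmul, hp, hp']
      | tmul x x' =>
      induction Y using TensorProduct.induction_on with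
      | zero => simp
      | add p p' hp hp' =>
        simp only [map_add, TensorProduct.tmul_add, LinearMap.add_apply, hp, hp']
      | tmul y y' =>
      simp only [TensorProduct.dualDistrib_apply, TensorProduct.tensorTensorTensorComm_tmul, dd,
        dualCopComul_apply, TensorProduct.map₂_apply_tmul, TensorProduct.map_tmul]
      rfl
    have key3 : ∀ X Y : VA ⊗[K] VA,
        TensorProduct.map s s (TensorProduct.map₂ A.mul A.mul Y X) =
        TensorProduct.map₂ A.mul A.mul (TensorProduct.map s s Y) (TensorProduct.map s s X) := by
      intro X Y
      induction X using TensorProduct.induction_on with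
      | zero => simp
      | add p p' hp hp' => simp only [map_add, hp, hp']
      | tmul x x' =>
      induction Y using TensorProduct.induction_on with
      | zero => simp
      | add p p' hp hp' => simp only [map_add, LinearMap.add_apply, hp, hp']
      | tmul y y' =>
      simp only [TensorProduct.map₂_apply_tmul, TensorProduct.map_tmul, s, LinearEquiv.coe_coe,
        A.α_neg_two_mul]
    apply dual_tensor_ext
    intro x y
    refine Eq.trans ?_ (key _ _ x y).symm
    refine Eq.trans ?_ (key2 _ _).symm
    refine (dualCopComul_apply A.toHomAlgebra (dualMul A.toHomCoalgebra f g) x y).trans ?_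
    rw [dualMul_apply]
    refine congrArg (dd (f ⊗ₜ[K] g)) ?_
    change TensorProduct.map s s (A.comul _) = _
    rw [← key3]
    congr 1
    refine (A.toHomCoalgebra.comul_α_neg_two (A.mul y x)).trans ?_
    change TensorProduct.map s s (A.comul _) = _
    rw [A.comul_mul]
  comul_one := by
    apply dual_tensor_ext
    intro x y
    refine (dualCopComul_apply A.toHomAlgebra A.counit x y).trans ?_
    refine (A.toHomCoalgebra.counit_α_neg_two _).trans ?_
    refine (A.counit_mul y x).trans ?_
    rw [mul_comm]
    rfl
  counit_mul f g := by
    change dualMul A.toHomCoalgebra f g A.one = f A.one * g A.one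
    have h : (A.α ^ (-2 : ℤ)) A.one = A.one := by
      have : A.α.symm A.one = A.one := by rw [LinearEquiv.symm_apply_eq, A.α_one]
      rw [zpow_neg_two_apply, this, this]
    rw [dualMul_apply]
    change TensorProduct.dualDistrib K VA VA (f ⊗ₜ[K] g) (TensorProduct.map
      (A.α ^ (-2 : ℤ)).toLinearMap (A.α ^ (-2 : ℤ)).toLinearMap (A.comul A.one)) = _
    rw [A.comul_one, TensorProduct.map_tmul, TensorProduct.dualDistrib_apply,
      LinearEquiv.coe_coe, h]
  counit_one := A.counit_one

/-- The map `φ : A^{*cop} ⊗ C → C ⊗ A^{*cop}` induced by `Φ : C ⊗ A → A ⊗ C`: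
`φ (f ⊗ c) = ∑ f((eᵢ)_Φ) c^Φ ⊗ eⁱ` for dual bases `eᵢ`, `eⁱ` of `A` and `A*`. -/
def cotwistorOf (Φ : VC ⊗[K] VA →ₗ[K] VA ⊗[K] VC) :
    Module.Dual K VA ⊗[K] VC →ₗ[K] VC ⊗[K] Module.Dual K VA :=
  TensorProduct.lift (LinearMap.mk₂ K
    (fun f c => ∑ i, TensorProduct.lid K VC
      (f.rTensor VC (Φ (c ⊗ₜ[K] Module.finBasis K VA i))) ⊗ₜ[K] (Module.finBasis K VA).coord i)
    (fun f g c => by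
      simp only [LinearMap.rTensor_add, LinearMap.add_apply, map_add, TensorProduct.add_tmul,
        Finset.sum_add_distrib])
    (fun r f c => by
      simp only [LinearMap.rTensor_smul, LinearMap.smul_apply, map_smul, TensorProduct.smul_tmul',
        Finset.smul_sum])
    (fun f c d => by
      simp only [TensorProduct.add_tmul, map_add, Finset.sum_add_distrib])
    (fun r f c => by
      have h : ∀ x : VA, (r • c) ⊗ₜ[K] x = r • (c ⊗ₜ[K] x) := fun _ => rfl
      simp only [h, map_smul, Finset.smul_sum]
      rfl))

/-! ### The maps attached to a Hom-Doi-Hopf datum -/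

section Datum

variable {H : HomBialgebra K VH}

/-- `Φ (c ⊗ a) = α⁻¹ (a₀) ⊗ α⁻¹(c) · α^m (a₁)`. -/
def DoiHopfDatum.Φ {A : HomAlgebra K VA} {C : HomCoalgebra K VC} (D : DoiHopfDatum H A C) (m : ℤ) :
    VC ⊗[K] VA →ₗ[K] VA ⊗[K] VC :=
  TensorProduct.map A.α.symm.toLinearMap
      (TensorProduct.lift (D.act.compl₁₂ C.α.symm.toLinearMap (H.α ^ m).toLinearMap)) ∘ₗ
    (TensorProduct.leftComm K VC VA VH).toLinearMap ∘ₗ D.ρ.lTensor VC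

/-- The Hom-cotwistor
`φ (f ⊗ c) = ∑ f (α⁻¹ ((eᵢ)₀)) α⁻¹(c) · α^m ((eᵢ)₁) ⊗ eⁱ`. -/
def DoiHopfDatum.φ {A : HomAlgebra K VA} {C : HomCoalgebra K VC} (D : DoiHopfDatum H A C) (m : ℤ) :
    Module.Dual K VA ⊗[K] VC →ₗ[K] VC ⊗[K] Module.Dual K VA :=
  cotwistorOf (D.Φ m)

variable {A : HomBialgebra K VA} {C : HomBialgebra K VC}

/-- The explicit compatibility identities between the datum and the bialgebra structures:
`a₁₀ ⊗ a₂₀ ⊗ (c · a₁₁)(d · a₂₁) = a₀₁ ⊗ a₀₂ ⊗ (cd) · α²(a₁)` and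
`ε(a) 1 = 1 · a₁ ε(a₀)` (the inner index of `a₁₀` comes from `Δ`, that of `a₀₁` from `ρ`). -/
structure DoiHopfDatum.Compatible (D : DoiHopfDatum H A.toHomAlgebra C.toHomCoalgebra) :
    Prop where
  mul : ∀ (c d : VC) (a : VA),
    (TensorProduct.lift (C.mul.compl₁₂ (D.act c) (D.act d))).lTensor (VA ⊗[K] VA)
      (TensorProduct.tensorTensorTensorComm K VA VH VA VH
        (TensorProduct.map D.ρ D.ρ (A.comul a))) =
      TensorProduct.map A.comul (D.act (C.mul c d) ∘ₗ (H.α ^ (2 : ℤ)).toLinearMap) (D.ρ a)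
  unit : ∀ a : VA, A.counit a • C.one =
    TensorProduct.lid K VC (TensorProduct.map A.counit (D.act C.one) (D.ρ a))

/-- The Hom-bialgebra `X` is the `m`-th Doi-codouble `A^{*cop} ⊗ C` of the datum: its structure
maps are the tensor product of the structure maps, the smash coproduct comultiplication given by
`φ`, the counit `f ⊗ c ↦ f(1) ε(c)`, and the tensor product algebra structure. -/
structure DoiHopfDatum.IsCodouble (D : DoiHopfDatum H A.toHomAlgebra C.toHomCoalgebra) (m : ℤ)
    (X : HomBialgebra K (Module.Dual K VA ⊗[K] VC)) : Prop where
  α_eq : ∀ (f : Module.Dual K VA) (c : VC), X.α (f ⊗ₜ c) = (f ∘ₗ A.α.symm.toLinearMap) ⊗ₜ C.α c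
  comul_eq : X.comul =
    smashComul (dualCopCoalgebra A.toHomAlgebra) C.toHomCoalgebra (D.φ m)
  counit_eq : ∀ (f : Module.Dual K VA) (c : VC), X.counit (f ⊗ₜ c) = f A.one * C.counit c
  mul_eq : ∀ (f g : Module.Dual K VA) (x y : VC),
    X.mul (f ⊗ₜ x) (g ⊗ₜ y) = dualMul A.toHomCoalgebra f g ⊗ₜ C.mul x y
  one_eq : X.one = A.counit ⊗ₜ C.one

end Datum

end Basic

/-! ### The category of finite-dimensional spaces with automorphism -/

/-- A finite-dimensional space with an automorphism. -/
structure HomObject (K : Type u) [Field K] where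
  carrier : Type u
  [addCommGroup : AddCommGroup carrier]
  [module : Module K carrier]
  [finite : Module.Finite K carrier]
  α : carrier ≃ₗ[K] carrier

attribute [instance] HomObject.addCommGroup HomObject.module HomObject.finite

variable {K : Type u} [Field K]

namespace HomObject

/-- `(X ⊗ Y, α ⊗ α)` -/
@[simps carrier α]
def tensor (X Y : HomObject K) : HomObject K where
  carrier := X.carrier ⊗[K] Y.carrier
  α := TensorProduct.congr X.α Y.α

/-- `(K, id)` -/
@[simps carrier α]
def unit (K : Type u) [Field K] : HomObject K where
  carrier := K
  α := LinearEquiv.refl K K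

/-- `(x ⊗ y) ⊗ z ↦ α^{i+1}(x) ⊗ (y ⊗ α^{-j-1}(z))` -/
def associator (i j : ℤ) (X Y Z : HomObject K) :
    (X.carrier ⊗[K] Y.carrier) ⊗[K] Z.carrier ≃ₗ[K] X.carrier ⊗[K] (Y.carrier ⊗[K] Z.carrier) :=
  TensorProduct.assoc K X.carrier Y.carrier Z.carrier ≪≫ₗ
    TensorProduct.congr (X.α ^ (i + 1))
      (TensorProduct.congr (LinearEquiv.refl K Y.carrier) (Z.α ^ (-j - 1)))

/-- `c ⊗ x ↦ c α^{j+1}(x)` -/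
def leftUnitor (j : ℤ) (X : HomObject K) : K ⊗[K] X.carrier ≃ₗ[K] X.carrier :=
  TensorProduct.lid K X.carrier ≪≫ₗ (X.α ^ (j + 1))

/-- `x ⊗ c ↦ c α^{i+1}(x)` -/
def rightUnitor (i : ℤ) (X : HomObject K) : X.carrier ⊗[K] K ≃ₗ[K] X.carrier :=
  TensorProduct.rid K X.carrier ≪≫ₗ (X.α ^ (i + 1))

end HomObject

/-! ### The category of right comodules of a Hom-bialgebra -/

section Corep

variable {VB : Type u} [AddCommGroup VB] [Module K VB]

/-- An object with a candidate coaction of a space `VB`, before any axiom is imposed. -/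
structure PreComodule (K : Type u) [Field K] (VB : Type u) [AddCommGroup VB] [Module K VB]
    extends HomObject K where
  coact : carrier →ₗ[K] carrier ⊗[K] VB

namespace PreComodule

/-- Colinearity. -/
def IsHom (X Y : PreComodule K VB) (f : X.carrier →ₗ[K] Y.carrier) : Prop :=
  ∀ u, Y.coact (f u) = f.rTensor VB (X.coact u)

lemma IsHom.symm {X Y : PreComodule K VB} {e : X.carrier ≃ₗ[K] Y.carrier}
    (h : IsHom X Y e.toLinearMap) : IsHom Y X e.symm.toLinearMap := by
  intro u
  obtain ⟨v, rfl⟩ := e.surjective u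
  have := h v
  simp only [LinearEquiv.coe_coe] at this
  rw [this, ← LinearMap.rTensor_comp_apply]
  simp

/-- The tensor product: `ρ(u ⊗ v) = (u₀ ⊗ v₀) ⊗ α^i(u₁) α^j(v₁)`. -/
def tensor (B : HomBialgebra K VB) (i j : ℤ) (X Y : PreComodule K VB) : PreComodule K VB where
  toHomObject := X.toHomObject.tensor Y.toHomObject
  coact := (TensorProduct.lift
      (B.mul.compl₁₂ (B.α ^ i).toLinearMap (B.α ^ j).toLinearMap)).lTensor
        (X.carrier ⊗[K] Y.carrier) ∘ₗ
    (TensorProduct.tensorTensorTensorComm K X.carrier VB Y.carrier VB).toLinearMap ∘ₗ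
    TensorProduct.map X.coact Y.coact

/-- The unit object: `ρ(c) = c ⊗ 1`. -/
def unit (B : HomBialgebra K VB) : PreComodule K VB where
  toHomObject := HomObject.unit K
  coact := (TensorProduct.mk K K VB).flip B.one

end PreComodule

/-- Right Hom-comodules over the Hom-coalgebra `B`. -/
structure Corep (B : HomCoalgebra K VB) extends PreComodule K VB where
  isRightComodule : IsRightComodule B α coact

namespace Corep

variable {B : HomCoalgebra K VB}

/-- Colinear maps. -/
@[ext]
structure Hom (X Y : Corep B) where
  map : X.carrier →ₗ[K] Y.carrier
  isHom : PreComodule.IsHom X.toPreComodule Y.toPreComodule map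

instance : Category (Corep B) where
  Hom := Hom
  id X := ⟨LinearMap.id, fun u => by simp⟩
  comp f g := ⟨g.map ∘ₗ f.map, fun u => by
    rw [LinearMap.comp_apply, g.isHom, f.isHom, LinearMap.rTensor_comp_apply]⟩

/-- The isomorphism given by a colinear linear equivalence. -/
def isoMk {X Y : Corep B} (e : X.carrier ≃ₗ[K] Y.carrier)
    (h : PreComodule.IsHom X.toPreComodule Y.toPreComodule e.toLinearMap) : X ≅ Y where
  hom := ⟨e.toLinearMap, h⟩
  inv := ⟨e.symm.toLinearMap, h.symm⟩
  hom_inv_id := Hom.ext (by ext x; exact e.symm_apply_apply x)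
  inv_hom_id := Hom.ext (by ext x; exact e.apply_symm_apply x)

end Corep

/-- The tensor product of comodules, the unit object, the tensor product of morphisms and the
constraints all live in `Corep B`. -/
structure CorepTensorData (B : HomBialgebra K VB) (i j : ℤ) : Prop where
  tensorObj : ∀ X Y : Corep B.toHomCoalgebra,
    IsRightComodule B.toHomCoalgebra (X.toPreComodule.tensor B i j Y.toPreComodule).α
      (X.toPreComodule.tensor B i j Y.toPreComodule).coact
  tensorUnit : IsRightComodule B.toHomCoalgebra (PreComodule.unit B).α (PreComodule.unit B).coact
  tensorHom : ∀ {X X' Y Y' : Corep B.toHomCoalgebra} (f : X ⟶ X') (g : Y ⟶ Y'),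
    PreComodule.IsHom (X.toPreComodule.tensor B i j Y.toPreComodule)
      (X'.toPreComodule.tensor B i j Y'.toPreComodule) (TensorProduct.map f.map g.map)
  associator : ∀ X Y Z : Corep B.toHomCoalgebra,
    PreComodule.IsHom
      ((X.toPreComodule.tensor B i j Y.toPreComodule).tensor B i j Z.toPreComodule)
      (X.toPreComodule.tensor B i j (Y.toPreComodule.tensor B i j Z.toPreComodule))
      (HomObject.associator i j X.toHomObject Y.toHomObject Z.toHomObject).toLinearMap
  leftUnitor : ∀ X : Corep B.toHomCoalgebra,
    PreComodule.IsHom ((PreComodule.unit B).tensor B i j X.toPreComodule) X.toPreComodule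
      (HomObject.leftUnitor j X.toHomObject).toLinearMap
  rightUnitor : ∀ X : Corep B.toHomCoalgebra,
    PreComodule.IsHom (X.toPreComodule.tensor B i j (PreComodule.unit B)) X.toPreComodule
      (HomObject.rightUnitor i X.toHomObject).toLinearMap

/-- The tensor structure of `Corep^{i,j}(B)`. -/
abbrev CorepTensorData.struct {B : HomBialgebra K VB} {i j : ℤ} (h : CorepTensorData B i j) :
    MonoidalCategoryStruct (Corep B.toHomCoalgebra) :=
  let T (X Y : Corep B.toHomCoalgebra) : Corep B.toHomCoalgebra := ⟨_, h.tensorObj X Y⟩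
  { tensorObj := T
    tensorUnit := ⟨_, h.tensorUnit⟩
    tensorHom := fun f g => ⟨_, h.tensorHom f g⟩
    whiskerLeft := fun X _ _ g => ⟨_, h.tensorHom (𝟙 X) g⟩
    whiskerRight := fun f Y => ⟨_, h.tensorHom f (𝟙 Y)⟩
    associator := fun X Y Z => Corep.isoMk (X := T (T X Y) Z) (Y := T X (T Y Z))
      (HomObject.associator i j X.toHomObject Y.toHomObject Z.toHomObject) (h.associator X Y Z)
    leftUnitor := fun X => Corep.isoMk (X := T ⟨_, h.tensorUnit⟩ X)
      (HomObject.leftUnitor j X.toHomObject) (h.leftUnitor X)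
    rightUnitor := fun X => Corep.isoMk (X := T X ⟨_, h.tensorUnit⟩)
      (HomObject.rightUnitor i X.toHomObject) (h.rightUnitor X) }

/-- `M` is the monoidal category `Corep^{i,j}(B)`. -/
def IsCorepMonoidal (B : HomBialgebra K VB) (i j : ℤ)
    (M : MonoidalCategory (Corep B.toHomCoalgebra)) : Prop :=
  ∃ h : CorepTensorData B i j, M.toMonoidalCategoryStruct = h.struct

end Corep

/-! ### The category of Hom-Doi-Hopf modules -/

section DoiHopf

variable {VH VA VC : Type u} [AddCommGroup VH] [Module K VH] [AddCommGroup VA] [Module K VA]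
  [AddCommGroup VC] [Module K VC]

/-- An object with a candidate action of `VA` and coaction of `VC`, before any axiom is
imposed. -/
structure PreDoiHopf (K : Type u) [Field K] (VA VC : Type u) [AddCommGroup VA] [Module K VA]
    [AddCommGroup VC] [Module K VC] extends HomObject K where
  act : carrier →ₗ[K] VA →ₗ[K] carrier
  coact : carrier →ₗ[K] carrier ⊗[K] VC

namespace PreDoiHopf

/-- `A`-linear and `C`-colinear maps. -/
structure IsHom (X Y : PreDoiHopf K VA VC) (f : X.carrier →ₗ[K] Y.carrier) : Prop where
  map_act : ∀ u a, f (X.act u a) = Y.act (f u) a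
  map_coact : ∀ u, Y.coact (f u) = f.rTensor VC (X.coact u)

lemma IsHom.symm {X Y : PreDoiHopf K VA VC} {e : X.carrier ≃ₗ[K] Y.carrier}
    (h : IsHom X Y e.toLinearMap) : IsHom Y X e.symm.toLinearMap where
  map_act u a := by
    obtain ⟨v, rfl⟩ := e.surjective u
    have := h.map_act v a
    simp only [LinearEquiv.coe_coe] at this ⊢
    rw [← this]
    simp
  map_coact u := by
    obtain ⟨v, rfl⟩ := e.surjective u
    have := h.map_coact v
    simp only [LinearEquiv.coe_coe] at this
    rw [this, ← LinearMap.rTensor_comp_apply]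
    simp

/-- The tensor product: `(u ⊗ v) · a = u · α^{-i-2}(a₁) ⊗ v · α^{-j-2}(a₂)` and
`ρ(u ⊗ v) = (u₀ ⊗ v₀) ⊗ α^i(u₁) α^j(v₁)`. -/
def tensor (A : HomBialgebra K VA) (C : HomBialgebra K VC) (i j : ℤ) (X Y : PreDoiHopf K VA VC) :
    PreDoiHopf K VA VC where
  toHomObject := X.toHomObject.tensor Y.toHomObject
  act := (TensorProduct.map₂ X.act Y.act).compl₂
    (TensorProduct.map (A.α ^ (-i - 2)).toLinearMap (A.α ^ (-j - 2)).toLinearMap ∘ₗ A.comul)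
  coact := (TensorProduct.lift
      (C.mul.compl₁₂ (C.α ^ i).toLinearMap (C.α ^ j).toLinearMap)).lTensor
        (X.carrier ⊗[K] Y.carrier) ∘ₗ
    (TensorProduct.tensorTensorTensorComm K X.carrier VC Y.carrier VC).toLinearMap ∘ₗ
    TensorProduct.map X.coact Y.coact

/-- The unit object: `c · a = c ε(a)` and `ρ(c) = c ⊗ 1`. -/
def unit (A : HomBialgebra K VA) (C : HomBialgebra K VC) : PreDoiHopf K VA VC where
  toHomObject := HomObject.unit K
  act := (LinearMap.mul K K).compl₂ A.counit
  coact := (TensorProduct.mk K K VC).flip C.one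

end PreDoiHopf

variable {H : HomBialgebra K VH}

/-- `X` is a `k`-th Doi-Hopf module: a right `A`-module and right `C`-comodule with
`ρ(u · a) = u₀ · a₀ ⊗ u₁ · α^k(a₁)`. -/
structure DoiHopfDatum.IsDoiHopfModule {A : HomAlgebra K VA} {C : HomCoalgebra K VC}
    (D : DoiHopfDatum H A C) (k : ℤ) (X : PreDoiHopf K VA VC) : Prop where
  isRightModule : IsRightModule A X.α X.act
  isRightComodule : IsRightComodule C X.α X.coact
  coact_act : ∀ u a, X.coact (X.act u a) =
    TensorProduct.map₂ X.act (D.act.compl₂ (H.α ^ k).toLinearMap) (X.coact u) (D.ρ a)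

/-- The objects of the category of `k`-th Doi-Hopf modules. -/
structure DoiHopfDatum.DoiHopfModule {A : HomAlgebra K VA} {C : HomCoalgebra K VC}
    (D : DoiHopfDatum H A C) (k : ℤ) extends PreDoiHopf K VA VC where
  isDoiHopfModule : D.IsDoiHopfModule k toPreDoiHopf

namespace DoiHopfDatum

section

variable {A : HomAlgebra K VA} {C : HomCoalgebra K VC} {D : DoiHopfDatum H A C} {k : ℤ}

/-- `A`-linear `C`-colinear maps. -/
@[ext]
structure DoiHopfModule.Hom (X Y : D.DoiHopfModule k) where
  map : X.carrier →ₗ[K] Y.carrier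
  isHom : PreDoiHopf.IsHom X.toPreDoiHopf Y.toPreDoiHopf map

instance : Category (D.DoiHopfModule k) where
  Hom := DoiHopfModule.Hom
  id X := ⟨LinearMap.id, ⟨fun u a => rfl, fun u => by simp⟩⟩
  comp f g := ⟨g.map ∘ₗ f.map,
    ⟨fun u a => by
      rw [LinearMap.comp_apply, f.isHom.map_act, g.isHom.map_act, LinearMap.comp_apply],
    fun u => by
      rw [LinearMap.comp_apply, g.isHom.map_coact, f.isHom.map_coact,
        LinearMap.rTensor_comp_apply]⟩⟩

/-- The isomorphism given by an `A`-linear `C`-colinear linear equivalence. -/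
def DoiHopfModule.isoMk {X Y : D.DoiHopfModule k} (e : X.carrier ≃ₗ[K] Y.carrier)
    (h : PreDoiHopf.IsHom X.toPreDoiHopf Y.toPreDoiHopf e.toLinearMap) : X ≅ Y where
  hom := ⟨e.toLinearMap, h⟩
  inv := ⟨e.symm.toLinearMap, h.symm⟩
  hom_inv_id := DoiHopfModule.Hom.ext (by ext x; exact e.symm_apply_apply x)
  inv_hom_id := DoiHopfModule.Hom.ext (by ext x; exact e.apply_symm_apply x)

end

variable {A : HomBialgebra K VA} {C : HomBialgebra K VC}

/-- The tensor product of `k`-th Doi-Hopf modules, the unit object, the tensor product of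
morphisms and the constraints all live in the category of `k`-th Doi-Hopf modules. -/
structure TensorData (D : DoiHopfDatum H A.toHomAlgebra C.toHomCoalgebra) (k i j : ℤ) :
    Prop where
  tensorObj : ∀ X Y : D.DoiHopfModule k,
    D.IsDoiHopfModule k (X.toPreDoiHopf.tensor A C i j Y.toPreDoiHopf)
  tensorUnit : D.IsDoiHopfModule k (PreDoiHopf.unit A C)
  tensorHom : ∀ {X X' Y Y' : D.DoiHopfModule k} (f : X ⟶ X') (g : Y ⟶ Y'),
    PreDoiHopf.IsHom (X.toPreDoiHopf.tensor A C i j Y.toPreDoiHopf)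
      (X'.toPreDoiHopf.tensor A C i j Y'.toPreDoiHopf) (TensorProduct.map f.map g.map)
  associator : ∀ X Y Z : D.DoiHopfModule k,
    PreDoiHopf.IsHom
      ((X.toPreDoiHopf.tensor A C i j Y.toPreDoiHopf).tensor A C i j Z.toPreDoiHopf)
      (X.toPreDoiHopf.tensor A C i j (Y.toPreDoiHopf.tensor A C i j Z.toPreDoiHopf))
      (HomObject.associator i j X.toHomObject Y.toHomObject Z.toHomObject).toLinearMap
  leftUnitor : ∀ X : D.DoiHopfModule k,
    PreDoiHopf.IsHom ((PreDoiHopf.unit A C).tensor A C i j X.toPreDoiHopf) X.toPreDoiHopf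
      (HomObject.leftUnitor j X.toHomObject).toLinearMap
  rightUnitor : ∀ X : D.DoiHopfModule k,
    PreDoiHopf.IsHom (X.toPreDoiHopf.tensor A C i j (PreDoiHopf.unit A C)) X.toPreDoiHopf
      (HomObject.rightUnitor i X.toHomObject).toLinearMap

/-- The tensor structure of the category of `k`-th Doi-Hopf modules. -/
abbrev TensorData.struct {D : DoiHopfDatum H A.toHomAlgebra C.toHomCoalgebra} {k i j : ℤ}
    (h : D.TensorData k i j) : MonoidalCategoryStruct (D.DoiHopfModule k) :=
  let T (X Y : D.DoiHopfModule k) : D.DoiHopfModule k := ⟨_, h.tensorObj X Y⟩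
  { tensorObj := T
    tensorUnit := ⟨_, h.tensorUnit⟩
    tensorHom := fun f g => ⟨_, h.tensorHom f g⟩
    whiskerLeft := fun X _ _ g => ⟨_, h.tensorHom (𝟙 X) g⟩
    whiskerRight := fun f Y => ⟨_, h.tensorHom f (𝟙 Y)⟩
    associator := fun X Y Z => DoiHopfModule.isoMk (X := T (T X Y) Z) (Y := T X (T Y Z))
      (HomObject.associator i j X.toHomObject Y.toHomObject Z.toHomObject) (h.associator X Y Z)
    leftUnitor := fun X => DoiHopfModule.isoMk (X := T ⟨_, h.tensorUnit⟩ X)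
      (HomObject.leftUnitor j X.toHomObject) (h.leftUnitor X)
    rightUnitor := fun X => DoiHopfModule.isoMk (X := T X ⟨_, h.tensorUnit⟩)
      (HomObject.rightUnitor i X.toHomObject) (h.rightUnitor X) }

/-- `M` is the monoidal category of `k`-th Doi-Hopf modules with the given tensor product and the
constraints depending on `i`, `j`. -/
def IsDoiHopfMonoidal (D : DoiHopfDatum H A.toHomAlgebra C.toHomCoalgebra) (k i j : ℤ)
    (M : MonoidalCategory (D.DoiHopfModule k)) : Prop :=
  ∃ h : D.TensorData k i j, M.toMonoidalCategoryStruct = h.struct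

end DoiHopfDatum

end DoiHopf

/-- Isomorphism of monoidal categories: a strong monoidal functor that has a strict inverse. -/
def MonoidallyIsomorphic {𝒞 𝒟 : Type*} [Category 𝒞] [Category 𝒟] (M : MonoidalCategory 𝒞)
    (N : MonoidalCategory 𝒟) : Prop :=
  ∃ (F : 𝒞 ⥤ 𝒟) (G : 𝒟 ⥤ 𝒞), F ⋙ G = 𝟭 𝒞 ∧ G ⋙ F = 𝟭 𝒟 ∧ Nonempty F.Monoidal

end HomDoiHopf
end

noncomputable section

namespace HomDoiHopf

/-! ### Tensor products of bilinear maps -/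

section Multilinear

variable {K : Type u} [Field K]
variable {M N P M' N' P' R S T R' S' T' Q W Z : Type u}
  [AddCommGroup M] [Module K M] [AddCommGroup N] [Module K N] [AddCommGroup P] [Module K P]
  [AddCommGroup M'] [Module K M'] [AddCommGroup N'] [Module K N'] [AddCommGroup P'] [Module K P']
  [AddCommGroup R] [Module K R] [AddCommGroup S] [Module K S] [AddCommGroup T] [Module K T]
  [AddCommGroup R'] [Module K R'] [AddCommGroup S'] [Module K S'] [AddCommGroup T'] [Module K T']
  [AddCommGroup Q] [Module K Q] [AddCommGroup W] [Module K W] [AddCommGroup Z] [Module K Z]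

/-! Every condition is compared with (3). For any datum Φ is already an entwining
(`DoiHopfDatum.isEntwining`), so by duality φ is already a cotwistor (`IsEntwining.isCotwistor`).
Only products and units remain at stake, and each condition turns out to say that φ is a morphism of
Hom-algebras.

(1) ⇔ (2) is a change of variables: the two sides of (E5) for Φ are the images of the two sides of
(1), at arguments twisted by powers of α, under one and the same bijection. (2) ⇔ (3) is
transposition: the value of φ(f ⊗ c) at a is the pairing of f with Φ(c ⊗ a) (`evalAt_cotwistorOf`),
and since A is finite-dimensional the functionals f ⊗ g detect equality in A ⊗ A ⊗ C
(`IsEntwining.isMonoidalEntwining_iff`). (3) ⇔ (4): the coproduct of the codouble is assembled from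
the coproducts of A* and C and from φ, so it is multiplicative when φ is; conversely, counits
applied to the two outer factors of the coproduct leave φ ∘ (α ⊗ α), and these projections are
multiplicative (`IsCotwistor.snd_fst_smashComul`, `IsCotwistor.isMonoidalCotwistor`).

For (5), a comodule over a smash coproduct is a pair of comodule structures exchanged by φ
(`IsPairComodule`). An A*-comodule is an A-module, and with the action twisted by α^(m-k+1) the
exchange relation becomes exactly the k-th Doi-Hopf condition
(`isPairComodule_iff_isDoiHopfModule`). This gives an isomorphism of categories that changes neither
spaces nor maps. Under (3) the codouble is a Hom-bialgebra, the comodules of any Hom-bialgebra form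
a monoidal category (`corepTensorData`), and the projections of the codouble to A* and C are algebra
maps, so the tensor products correspond strictly. The whole structure is thereby transported to
Doi-Hopf modules, with identity maps as comparison morphisms.

For (5) ⇒ (3), the codouble coalgebra, which exists without (3), is a comodule over itself and hence
a Doi-Hopf module. That its tensor square is again a Doi-Hopf module gives an exchange relation;
counits applied to the module factors reduce it to the multiplicativity of φ
(`IsCotwistor.map₂_of_tensorCoact`). The unit object gives φ(1 ⊗ 1) = 1 ⊗ 1. -/

lemma zpow_intertwine {e : M ≃ₗ[K] M} {e' : N ≃ₗ[K] N} {f : M →ₗ[K] N}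
    (h : ∀ x, f (e x) = e' (f x)) (n : ℤ) (x : M) : f ((e ^ n) x) = (e' ^ n) (f x) := by
  have hs : ∀ x, f (e⁻¹ x) = e'⁻¹ (f x) := by
    intro x
    obtain ⟨y, rfl⟩ := e.surjective x
    rw [h]
    change f (e.symm (e y)) = e'.symm (e' (f y))
    simp
  induction n generalizing x with
  | zero => simp
  | succ n ih =>
    rw [zpow_add_one, zpow_add_one, LinearEquiv.mul_apply, LinearEquiv.mul_apply, ih, h]
  | pred n ih =>
    rw [zpow_sub_one, zpow_sub_one, LinearEquiv.mul_apply, LinearEquiv.mul_apply, ih, hs]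

lemma congr_zpow_tmul (e : M ≃ₗ[K] M) (e' : N ≃ₗ[K] N) (n : ℤ) (x : M) (y : N) :
    ((TensorProduct.congr e e') ^ n) (x ⊗ₜ y) = (e ^ n) x ⊗ₜ (e' ^ n) y := by
  rw [TensorProduct.congr_zpow, TensorProduct.congr_tmul]

lemma congr_zpow_apply (e : M ≃ₗ[K] M) (e' : N ≃ₗ[K] N) (n : ℤ) (t : M ⊗[K] N) :
    ((TensorProduct.congr e e') ^ n) t =
      TensorProduct.map (e ^ n).toLinearMap (e' ^ n).toLinearMap t := by
  rw [TensorProduct.congr_zpow]; rfl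

lemma zpow_intertwine₂ {e : M ≃ₗ[K] M} {e' : N ≃ₗ[K] N} {e'' : P ≃ₗ[K] P} {f : M →ₗ[K] N →ₗ[K] P}
    (h : ∀ x y, f (e x) (e' y) = e'' (f x y)) (n : ℤ) (x : M) (y : N) :
    f ((e ^ n) x) ((e' ^ n) y) = (e'' ^ n) (f x y) := by
  have := zpow_intertwine (e := TensorProduct.congr e e') (e' := e'') (f := TensorProduct.lift f)
    (fun t => by
      induction t using TensorProduct.induction_on with
      | zero => simp
      | tmul x y => simp [h]
      | add x y hx hy => simp only [map_add, hx, hy]) n (x ⊗ₜ y)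
  simpa [congr_zpow_tmul] using this

/-- Tensor products of maps compatible with bilinear maps are compatible with their tensor
product. -/
lemma map_map₂ {a : M →ₗ[K] N →ₗ[K] P} {a' : M' →ₗ[K] N' →ₗ[K] P'}
    {b : R →ₗ[K] S →ₗ[K] T} {b' : R' →ₗ[K] S' →ₗ[K] T'}
    {f₁ : M →ₗ[K] M'} {f₂ : N →ₗ[K] N'} {f : P →ₗ[K] P'}
    {g₁ : R →ₗ[K] R'} {g₂ : S →ₗ[K] S'} {g : T →ₗ[K] T'}
    (hf : ∀ x y, f (a x y) = a' (f₁ x) (f₂ y)) (hg : ∀ x y, g (b x y) = b' (g₁ x) (g₂ y))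
    (p : M ⊗[K] R) (q : N ⊗[K] S) :
    TensorProduct.map f g (TensorProduct.map₂ a b p q) =
      TensorProduct.map₂ a' b' (TensorProduct.map f₁ g₁ p) (TensorProduct.map f₂ g₂ q) := by
  induction p using TensorProduct.induction_on with
  | zero => simp
  | add x y hx hy => simp only [map_add, LinearMap.add_apply, hx, hy]
  | tmul x y =>
  induction q using TensorProduct.induction_on with
  | zero => simp
  | add x y hx hy => simp only [map_add, hx, hy]
  | tmul z w => simp [hf, hg]

lemma assoc_map₂ (a : M →ₗ[K] N →ₗ[K] P) (b : R →ₗ[K] S →ₗ[K] T) (c : R' →ₗ[K] S' →ₗ[K] T')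
    (p : (M ⊗[K] R) ⊗[K] R') (q : (N ⊗[K] S) ⊗[K] S') :
    TensorProduct.assoc K P T T'
        (TensorProduct.map₂ (TensorProduct.map₂ a b) c p q) =
      TensorProduct.map₂ a (TensorProduct.map₂ b c) (TensorProduct.assoc K M R R' p)
        (TensorProduct.assoc K N S S' q) := by
  induction p using TensorProduct.induction_on with
  | zero => simp
  | add x y hx hy => simp only [map_add, LinearMap.add_apply, hx, hy]
  | tmul x y =>
  induction q using TensorProduct.induction_on with
  | zero => simp
  | add x y hx hy => simp only [map_add, hx, hy]
  | tmul z w =>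
  induction x using TensorProduct.induction_on with
  | zero => simp
  | add x y hx hy => simp only [TensorProduct.add_tmul, map_add, LinearMap.add_apply, hx, hy]
  | tmul x x' =>
  induction z using TensorProduct.induction_on with
  | zero => simp
  | add x y hx hy => simp only [TensorProduct.add_tmul, map_add, hx, hy]
  | tmul z z' => simp

lemma assoc_symm_map₂ (a : M →ₗ[K] N →ₗ[K] P) (b : R →ₗ[K] S →ₗ[K] T)
    (c : R' →ₗ[K] S' →ₗ[K] T')
    (p : M ⊗[K] (R ⊗[K] R')) (q : N ⊗[K] (S ⊗[K] S')) :
    (TensorProduct.assoc K P T T').symm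
        (TensorProduct.map₂ a (TensorProduct.map₂ b c) p q) =
      TensorProduct.map₂ (TensorProduct.map₂ a b) c ((TensorProduct.assoc K M R R').symm p)
        ((TensorProduct.assoc K N S S').symm q) := by
  rw [LinearEquiv.symm_apply_eq, assoc_map₂, LinearEquiv.apply_symm_apply,
    LinearEquiv.apply_symm_apply]

lemma rid_lTensor_map₂ {a : M →ₗ[K] N →ₗ[K] P} {b : R →ₗ[K] S →ₗ[K] T}
    {e₁ : R →ₗ[K] K} {e₂ : S →ₗ[K] K} {e : T →ₗ[K] K}
    (h : ∀ x y, e (b x y) = e₁ x * e₂ y) (p : M ⊗[K] R) (q : N ⊗[K] S) :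
    TensorProduct.rid K P (e.lTensor P (TensorProduct.map₂ a b p q)) =
      a (TensorProduct.rid K M (e₁.lTensor M p)) (TensorProduct.rid K N (e₂.lTensor N q)) := by
  induction p using TensorProduct.induction_on with
  | zero => simp
  | add x y hx hy => simp only [map_add, LinearMap.add_apply, hx, hy]
  | tmul x y =>
  induction q using TensorProduct.induction_on with
  | zero => simp
  | add x y hx hy => simp only [map_add, hx, hy]
  | tmul z w => simp [h, smul_smul, mul_comm]

lemma lid_rTensor_map₂ {a : M →ₗ[K] N →ₗ[K] P} {b : R →ₗ[K] S →ₗ[K] T}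
    {e₁ : R →ₗ[K] K} {e₂ : S →ₗ[K] K} {e : T →ₗ[K] K}
    (h : ∀ x y, e (b x y) = e₁ x * e₂ y) (p : R ⊗[K] M) (q : S ⊗[K] N) :
    TensorProduct.lid K P (e.rTensor P (TensorProduct.map₂ b a p q)) =
      a (TensorProduct.lid K M (e₁.rTensor M p)) (TensorProduct.lid K N (e₂.rTensor N q)) := by
  induction p using TensorProduct.induction_on with
  | zero => simp
  | add x y hx hy => simp only [map_add, LinearMap.add_apply, hx, hy]
  | tmul x y =>
  induction q using TensorProduct.induction_on with
  | zero => simp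
  | add x y hx hy => simp only [map_add, hx, hy]
  | tmul z w => simp [h, smul_smul, mul_comm]

/-- The tensor product of bilinear maps as the composite of the middle four interchange with the
tensor product of linear maps. -/
lemma map₂_eq_map_tensorTensorTensorComm (a : M →ₗ[K] N →ₗ[K] P) (b : R →ₗ[K] S →ₗ[K] T)
    (p : M ⊗[K] R) (q : N ⊗[K] S) :
    TensorProduct.map₂ a b p q = TensorProduct.map (TensorProduct.lift a) (TensorProduct.lift b)
      (TensorProduct.tensorTensorTensorComm K M R N S (p ⊗ₜ q)) := by
  induction p using TensorProduct.induction_on with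
  | zero => simp
  | add x y hx hy =>
    simp only [map_add, LinearMap.add_apply, TensorProduct.add_tmul, hx, hy]
  | tmul x y =>
  induction q using TensorProduct.induction_on with
  | zero => simp
  | add x y hx hy => simp only [map_add, TensorProduct.tmul_add, hx, hy]
  | tmul z w => simp

end Multilinear

/-! ### Compatibility of products, coproducts, actions and coactions with powers of the structure
maps. -/

section Structures

variable {K : Type u} [Field K]
variable {VH VA VC VD U : Type u} [AddCommGroup VH] [Module K VH] [AddCommGroup VA] [Module K VA]
  [AddCommGroup VC] [Module K VC] [AddCommGroup VD] [Module K VD] [AddCommGroup U] [Module K U]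

namespace HomAlgebra

variable (A : HomAlgebra K VA)

lemma α_zpow_mul (n : ℤ) (a b : VA) : (A.α ^ n) (A.mul a b) = A.mul ((A.α ^ n) a) ((A.α ^ n) b) :=
  (zpow_intertwine₂ (fun x y => (A.α_mul x y).symm) n a b).symm

lemma α_symm_one : A.α.symm A.one = A.one := by rw [LinearEquiv.symm_apply_eq, A.α_one]

/-- The unit is regarded as a linear map from `K` that intertwines the identity with `α`, so that
`zpow_intertwine` applies. -/
lemma α_zpow_one (n : ℤ) : (A.α ^ n) A.one = A.one := by
  have := zpow_intertwine (e := LinearEquiv.refl K K) (e' := A.α)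
    (f := LinearMap.toSpanSingleton K VA A.one) (fun x => by simp [A.α_one]) n 1
  have h1 : (LinearEquiv.refl K K) ^ n = 1 := one_zpow n
  rw [h1] at this
  simpa using this.symm

end HomAlgebra

namespace HomCoalgebra

variable (C : HomCoalgebra K VC)

lemma comul_α_zpow (n : ℤ) (c : VC) : C.comul ((C.α ^ n) c) =
    TensorProduct.map (C.α ^ n).toLinearMap (C.α ^ n).toLinearMap (C.comul c) := by
  rw [zpow_intertwine (e' := TensorProduct.congr C.α C.α) C.comul_α, congr_zpow_apply]

lemma comul_α_symm (c : VC) : C.comul (C.α.symm c) =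
    TensorProduct.map C.α.symm.toLinearMap C.α.symm.toLinearMap (C.comul c) := by
  obtain ⟨c, rfl⟩ := C.α.surjective c
  rw [LinearEquiv.symm_apply_apply, C.comul_α, TensorProduct.map_map]
  simp

lemma counit_α_zpow (n : ℤ) (c : VC) : C.counit ((C.α ^ n) c) = C.counit c := by
  rw [zpow_intertwine (e' := LinearEquiv.refl K K) C.counit_α]
  have h1 : (LinearEquiv.refl K K) ^ n = 1 := one_zpow n
  rw [h1]; rfl

lemma counit_α_symm (c : VC) : C.counit (C.α.symm c) = C.counit c := by
  rw [← C.counit_α, LinearEquiv.apply_symm_apply]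

end HomCoalgebra

namespace IsRightModule

variable {A : HomAlgebra K VA} {αU : U ≃ₗ[K] U} {act : U →ₗ[K] VA →ₗ[K] U}

/-- Not an axiom: it is the associativity of the action at `b = 1`. -/
lemma act_α (h : IsRightModule A αU act) (u : U) (a : VA) :
    act (αU u) (A.α a) = αU (act u a) := by
  have := h.act_act u a A.one
  rw [A.α_one, h.act_one, A.mul_one] at this
  exact this.symm

lemma act_α_zpow (h : IsRightModule A αU act) (n : ℤ) (u : U) (a : VA) :
    act ((αU ^ n) u) ((A.α ^ n) a) = (αU ^ n) (act u a) :=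
  zpow_intertwine₂ h.act_α n u a

end IsRightModule

namespace IsRightComodule

variable {C : HomCoalgebra K VC} {αU : U ≃ₗ[K] U} {ρ : U →ₗ[K] U ⊗[K] VC}

/-- Applying `p ⊗ q` to the last two factors of the coassociativity identity. -/
lemma coact_coact_map {P Q : Type u} [AddCommGroup P] [Module K P] [AddCommGroup Q] [Module K Q]
    (h : IsRightComodule C αU ρ) (p : VC →ₗ[K] P) (q : VC →ₗ[K] Q) (u : U) :
    TensorProduct.map αU.toLinearMap (TensorProduct.map p q ∘ₗ C.comul) (ρ u) =
      TensorProduct.assoc K U P Q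
        (TensorProduct.map (p.lTensor U ∘ₗ ρ) (q ∘ₗ C.α.toLinearMap) (ρ u)) := by
  have h1 := congrArg ((TensorProduct.map p q).lTensor U) (h.coact_coact u)
  have h2 : ∀ t : U ⊗[K] VC, (TensorProduct.map p q).lTensor U
      (TensorProduct.map αU.toLinearMap C.comul t) =
      TensorProduct.map αU.toLinearMap (TensorProduct.map p q ∘ₗ C.comul) t := by
    intro t
    rw [LinearMap.lTensor, ← LinearMap.comp_apply, ← TensorProduct.map_comp]
    rfl
  have h3 : ∀ t : (U ⊗[K] VC) ⊗[K] VC, (TensorProduct.map p q).lTensor U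
      (TensorProduct.assoc K U VC VC t) =
      TensorProduct.assoc K U P Q (TensorProduct.map (p.lTensor U) q t) := by
    intro t
    induction t using TensorProduct.induction_on with
    | zero => simp
    | add x y hx hy => simp only [map_add, hx, hy]
    | tmul t c =>
    induction t using TensorProduct.induction_on with
    | zero => simp
    | add x y hx hy => simp only [TensorProduct.add_tmul, map_add, hx, hy]
    | tmul x y => simp
  rw [← h2, h1, h3, ← LinearMap.comp_apply, ← TensorProduct.map_comp]

/-- Dual to `act_α`: the counit is applied to the last factor of the coassociativity identity. -/
lemma coact_α (h : IsRightComodule C αU ρ) (u : U) :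
    ρ (αU u) = TensorProduct.map αU.toLinearMap C.α.toLinearMap (ρ u) := by
  have h1 := congrArg ((TensorProduct.rid K VC).toLinearMap.lTensor U)
    (h.coact_coact_map LinearMap.id C.counit u)
  have h2 : ∀ t : U ⊗[K] VC, (TensorProduct.rid K VC).toLinearMap.lTensor U
      (TensorProduct.map αU.toLinearMap (TensorProduct.map LinearMap.id C.counit ∘ₗ C.comul) t) =
      TensorProduct.map αU.toLinearMap C.α.toLinearMap t := by
    intro t
    induction t using TensorProduct.induction_on with
    | zero => simp
    | add x y hx hy => simp only [map_add, hx, hy]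
    | tmul x y =>
      have := C.comul_counit y
      rw [LinearMap.lTensor] at this
      simp [this]
  have h3 : ∀ t : (U ⊗[K] VC) ⊗[K] K, (TensorProduct.rid K VC).toLinearMap.lTensor U
      (TensorProduct.assoc K U VC K t) = TensorProduct.rid K (U ⊗[K] VC) t := by
    intro t
    induction t using TensorProduct.induction_on with
    | zero => simp
    | add x y hx hy => simp only [map_add, hx, hy]
    | tmul t c =>
    induction t using TensorProduct.induction_on with
    | zero => simp
    | add x y hx hy => simp only [TensorProduct.add_tmul, map_add, hx, hy]
    | tmul x y => simp
  have h4 : ∀ t : U ⊗[K] VC, TensorProduct.rid K (U ⊗[K] VC)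
      (TensorProduct.map (LinearMap.lTensor U LinearMap.id ∘ₗ ρ) (C.counit ∘ₗ C.α.toLinearMap) t) =
      ρ (TensorProduct.rid K U (C.counit.lTensor U t)) := by
    intro t
    induction t using TensorProduct.induction_on with
    | zero => simp
    | add x y hx hy => simp only [map_add, hx, hy]
    | tmul x y => simp [C.counit_α]
  rw [h2, h3, h4, h.coact_counit] at h1
  exact h1.symm

lemma coact_α_zpow (h : IsRightComodule C αU ρ) (n : ℤ) (u : U) :
    ρ ((αU ^ n) u) = TensorProduct.map (αU ^ n).toLinearMap (C.α ^ n).toLinearMap (ρ u) := by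
  rw [zpow_intertwine (e' := TensorProduct.congr αU C.α) h.coact_α, congr_zpow_apply]

/-- The comodule obtained from a comodule along a morphism of Hom-coalgebras. -/
lemma map {D : HomCoalgebra K VD} (h : IsRightComodule C αU ρ) (p : VC →ₗ[K] VD)
    (hα : ∀ c, p (C.α c) = D.α (p c))
    (hΔ : ∀ c, TensorProduct.map p p (C.comul c) = D.comul (p c))
    (hε : ∀ c, D.counit (p c) = C.counit c) : IsRightComodule D αU (p.lTensor U ∘ₗ ρ) where
  coact_coact u := by
    have h1 := h.coact_coact_map p p u
    have e1 : TensorProduct.map p p ∘ₗ C.comul = D.comul ∘ₗ p := LinearMap.ext hΔ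
    have e2 : p ∘ₗ C.α.toLinearMap = D.α.toLinearMap ∘ₗ p := LinearMap.ext hα
    rw [e1, e2] at h1
    simp only [LinearMap.comp_apply, LinearMap.lTensor]
    rw [TensorProduct.map_map, TensorProduct.map_map]
    exact h1
  coact_counit u := by
    have e : D.counit ∘ₗ p = C.counit := LinearMap.ext hε
    rw [LinearMap.comp_apply, ← LinearMap.lTensor_comp_apply, e, h.coact_counit]

end IsRightComodule

end Structures

/-! ### The entwining map of a Hom-Doi-Hopf datum -/

section Entwining

variable {K : Type u} [Field K]
variable {VH VA VC : Type u} [AddCommGroup VH] [Module K VH] [AddCommGroup VA] [Module K VA]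
  [AddCommGroup VC] [Module K VC]

lemma zpow_apply_apply {V : Type u} [AddCommGroup V] [Module K V] (e : V ≃ₗ[K] V) (n : ℤ) (x : V) :
    (e ^ n) (e x) = e ((e ^ n) x) :=
  (zpow_intertwine (f := e.toLinearMap) (fun _ => rfl) n x).symm

namespace DoiHopfDatum

section

variable {H : HomBialgebra K VH} {A : HomAlgebra K VA} {C : HomCoalgebra K VC}
  (D : DoiHopfDatum H A C) (m : ℤ)

lemma Φ_tmul (c : VC) (a : VA) : D.Φ m (c ⊗ₜ a) = TensorProduct.map A.α.symm.toLinearMap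
    (D.act (C.α.symm c) ∘ₗ (H.α ^ m).toLinearMap) (D.ρ a) := by
  simp only [Φ, LinearMap.comp_apply, LinearMap.lTensor_tmul, LinearEquiv.coe_coe]
  generalize D.ρ a = t
  induction t using TensorProduct.induction_on with
  | zero => simp
  | add x y hx hy => simp only [TensorProduct.tmul_add, map_add, hx, hy]
  | tmul x h => simp

/-- No compatibility is needed. (E1) comes from the multiplicativity of the coaction and the
associativity of the action; (E2) from the coassociativity of the coaction and the multiplicativity
of the action on coproducts; (E3) and (E4) from counits and units. Monoidality is therefore a matter
of (E5) and (E6) alone. -/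
lemma isEntwining : IsEntwining C A (D.Φ m) where
  map_α c a := by
    rw [Φ_tmul, Φ_tmul, D.isRightComodule.coact_α, TensorProduct.map_map, TensorProduct.map_map]
    congr 1
    apply TensorProduct.ext'
    intro x h
    simp [zpow_apply_apply, ← D.isRightModule.act_α]
  mul c a b := by
    rw [Φ_tmul, Φ_tmul, D.coact_mul]
    generalize D.ρ a = p
    induction p using TensorProduct.induction_on with
    | zero => simp
    | add x y hx hy => simp only [TensorProduct.add_tmul, map_add, LinearMap.add_apply, hx, hy]
    | tmul a h =>
    simp only [TensorProduct.map_tmul, TensorProduct.assoc_tmul, LinearMap.lTensor_tmul, Φ_tmul]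
    generalize D.ρ b = q
    induction q using TensorProduct.induction_on with
    | zero => simp
    | add x y hx hy => simp only [TensorProduct.tmul_add, map_add, hx, hy]
    | tmul b g =>
    simp [A.α_inv_mul, H.α_zpow_mul, ← D.isRightModule.act_α, D.isRightModule.act_act]
  comul c a := by
    rw [Φ_tmul]
    -- The left side of (E2) depends on `a` only through its iterated coaction; written this way,
    -- coassociativity of `D.ρ` applies to it.
    have h1 : ∀ p : VC ⊗[K] VC,
        TensorProduct.assoc K VA VC VC
          ((D.Φ m).rTensor VC ((TensorProduct.assoc K VC VA VC).symm
            ((D.Φ m).lTensor VC (TensorProduct.assoc K VC VC VA (p ⊗ₜ[K] A.α a))))) =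
        TensorProduct.map A.α.symm.toLinearMap (TensorProduct.map₂ D.act D.act
          (TensorProduct.map C.α.symm.toLinearMap C.α.symm.toLinearMap p) ∘ₗ
            TensorProduct.map (H.α ^ m).toLinearMap (H.α ^ m).toLinearMap)
          (TensorProduct.assoc K VA VH VH
            (TensorProduct.map D.ρ H.α.toLinearMap (D.ρ a))) := by
      intro p
      induction p using TensorProduct.induction_on with
      | zero => simp
      | add x y hx hy =>
        simp only [TensorProduct.add_tmul, map_add, LinearMap.add_comp, TensorProduct.map_add_right,
          LinearMap.add_apply, hx, hy]
      | tmul c c' =>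
      simp only [TensorProduct.assoc_tmul, LinearMap.lTensor_tmul, Φ_tmul,
        D.isRightComodule.coact_α]
      generalize D.ρ a = t
      induction t using TensorProduct.induction_on with
      | zero => simp
      | add x y hx hy => simp only [TensorProduct.tmul_add, map_add, hx, hy]
      | tmul a h =>
      simp only [TensorProduct.map_tmul, TensorProduct.assoc_symm_tmul, LinearMap.rTensor_tmul,
        LinearEquiv.coe_coe, LinearEquiv.symm_apply_apply, Φ_tmul, LinearMap.comp_apply]
      generalize D.ρ a = t
      induction t using TensorProduct.induction_on with
      | zero => simp
      | add x y hx hy => simp only [TensorProduct.add_tmul, map_add, hx, hy]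
      | tmul a h => simp
    rw [h1, ← D.isRightComodule.coact_coact, TensorProduct.map_map, TensorProduct.map_map,
      ← C.comul_α_symm]
    congr 1
    apply TensorProduct.ext'
    intro x h
    simp [D.comul_act, H.comul_α_zpow]
  counit c a := by
    have e : a = A.α.symm (TensorProduct.rid K VA (H.counit.lTensor VA (D.ρ a))) := by
      rw [D.isRightComodule.coact_counit, LinearEquiv.symm_apply_apply]
    conv_rhs => rw [e]
    rw [Φ_tmul]
    generalize D.ρ a = t
    induction t using TensorProduct.induction_on with
    | zero => simp
    | add x y hx hy => simp only [map_add, smul_add, hx, hy]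
    | tmul a h => simp [D.counit_act, C.counit_α_symm, H.counit_α_zpow, smul_smul]
  one c := by
    rw [Φ_tmul, D.coact_one]
    simp [A.α_symm_one, H.α_zpow_one, D.isRightModule.act_one]

end

variable {H : HomBialgebra K VH} {A : HomBialgebra K VA} {C : HomBialgebra K VC}
  (D : DoiHopfDatum H A.toHomAlgebra C.toHomCoalgebra) (m : ℤ)

/-- With `Φ_comul_mul_right` this exhibits both sides of (E5) as images of the two sides of (1) at
α(c), α(d), α^m(a). The coaction commutes with α^m, so the twist of the `H`-leg is absorbed into
α^m(a); on each `A`-leg the α⁻¹ of Φ then becomes α^(-m-1). On `C` the α⁻¹ of Φ meets α² and leaves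
α. -/
lemma Φ_comul_mul_left (c d : VC) (a : VA) :
    (TensorProduct.lift C.mul).lTensor (VA ⊗[K] VA)
      (TensorProduct.tensorTensorTensorComm K VA VC VA VC
        (TensorProduct.map
          (D.Φ m ∘ₗ TensorProduct.mk K VC VA ((C.α ^ (2 : ℤ)) c))
          (D.Φ m ∘ₗ TensorProduct.mk K VC VA ((C.α ^ (2 : ℤ)) d)) (A.comul a))) =
    (TensorProduct.congr (A.α ^ (-m - 1)) (A.α ^ (-m - 1))).toLinearMap.rTensor VC
      ((TensorProduct.lift (C.mul.compl₁₂ (D.act (C.α c)) (D.act (C.α d)))).lTensor (VA ⊗[K] VA)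
      (TensorProduct.tensorTensorTensorComm K VA VH VA VH
        (TensorProduct.map D.ρ D.ρ (A.comul ((A.α ^ m) a))))) := by
  have hA : ∀ x : VA, (A.α ^ (-m - 1)) ((A.α ^ m) x) = A.α.symm x := by
    intro x
    rw [← LinearEquiv.mul_apply, ← zpow_add, show -m - 1 + m = (-1 : ℤ) by ring]
    rfl
  have hC : ∀ x : VC, C.α.symm ((C.α ^ (2 : ℤ)) x) = C.α x := fun x => by
    rw [LinearEquiv.symm_apply_eq]; rfl
  rw [A.comul_α_zpow, TensorProduct.map_map]
  generalize A.comul a = t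
  induction t using TensorProduct.induction_on with
  | zero => simp
  | add x y hx hy => simp only [map_add, hx, hy]
  | tmul a b =>
  simp only [TensorProduct.map_tmul, LinearMap.comp_apply, TensorProduct.mk_apply, Φ_tmul, hC,
    LinearEquiv.coe_coe, D.isRightComodule.coact_α_zpow]
  generalize D.ρ a = p
  generalize D.ρ b = q
  induction p using TensorProduct.induction_on with
  | zero => simp
  | add x y hx hy => simp only [TensorProduct.add_tmul, map_add, hx, hy]
  | tmul a h =>
  induction q using TensorProduct.induction_on with
  | zero => simp
  | add x y hx hy => simp only [TensorProduct.tmul_add, map_add, hx, hy]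
  | tmul b g => simp [hA]

lemma Φ_comul_mul_right (c d : VC) (a : VA) :
    TensorProduct.map A.comul (C.α ^ (2 : ℤ)).toLinearMap (D.Φ m (C.mul c d ⊗ₜ[K] a)) =
    (TensorProduct.congr (A.α ^ (-m - 1)) (A.α ^ (-m - 1))).toLinearMap.rTensor VC
      (TensorProduct.map A.comul (D.act (C.mul (C.α c) (C.α d)) ∘ₗ (H.α ^ (2 : ℤ)).toLinearMap)
        (D.ρ ((A.α ^ m) a))) := by
  have hA : ∀ x : VA, A.α.symm x = (A.α ^ (-m - 1)) ((A.α ^ m) x) := by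
    intro x
    rw [← LinearEquiv.mul_apply, ← zpow_add, show -m - 1 + m = (-1 : ℤ) by ring]
    rfl
  rw [Φ_tmul, D.isRightComodule.coact_α_zpow]
  generalize D.ρ a = p
  induction p using TensorProduct.induction_on with
  | zero => simp
  | add x y hx hy => simp only [map_add, hx, hy]
  | tmul a h =>
    -- Distributing α² over the action produces the α² on the `H`-leg in (1).
    have h2 : (C.α ^ (2 : ℤ)) (D.act (C.α.symm (C.mul c d)) ((H.α ^ m) h)) =
        D.act (C.mul (C.α c) (C.α d)) ((H.α ^ (2 : ℤ)) ((H.α ^ m) h)) := by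
      rw [← D.isRightModule.act_α_zpow, ← C.α_mul]
      congr 2
      exact congrArg C.α (C.α.apply_symm_apply _)
    simp only [TensorProduct.map_tmul, LinearMap.rTensor_tmul, LinearEquiv.coe_coe,
      LinearMap.comp_apply, h2]
    rw [hA, A.comul_α_zpow]
    rfl

/-- The compatibility identities of the datum say that the entwining map is monoidal. -/
lemma compatible_iff_isMonoidalEntwining : D.Compatible ↔ IsMonoidalEntwining C A (D.Φ m) := by
  have hinj : Function.Injective
      ((TensorProduct.congr (A.α ^ (-m - 1)) (A.α ^ (-m - 1))).toLinearMap.rTensor VC) :=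
    (LinearEquiv.rTensor VC (TensorProduct.congr (A.α ^ (-m - 1)) (A.α ^ (-m - 1)))).injective
  have hu : ∀ a, TensorProduct.lid K VC (A.counit.rTensor VC (D.Φ m (C.one ⊗ₜ[K] a))) =
      TensorProduct.lid K VC (TensorProduct.map A.counit (D.act C.one) (D.ρ ((A.α ^ m) a))) := by
    intro a
    rw [Φ_tmul, D.isRightComodule.coact_α_zpow, TensorProduct.map_map, LinearMap.rTensor,
      TensorProduct.map_map]
    congr 2
    apply TensorProduct.ext'
    intro x h
    have h1 := A.toHomCoalgebra.counit_α_symm x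
    simp [C.α_symm_one, A.counit_α_zpow, h1]
  constructor
  · intro h
    refine ⟨D.isEntwining m, fun c d a => ?_, fun a => ?_⟩
    · rw [Φ_comul_mul_left, Φ_comul_mul_right, h.mul]
    · rw [hu, ← h.unit, A.counit_α_zpow]
  · intro h
    have hm : ∀ a, (A.α ^ m) ((A.α ^ (-m)) a) = a := fun a => by
      rw [← LinearEquiv.mul_apply, ← zpow_add]; simp
    refine ⟨fun c d a => hinj ?_, fun a => ?_⟩
    -- Since the structure maps are bijective, (E5) can be used at arguments whose twists are
    -- exactly `c`, `d`, `a`.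
    · have h1 := h.comul_mul (C.α.symm c) (C.α.symm d) ((A.α ^ (-m)) a)
      rw [Φ_comul_mul_left, Φ_comul_mul_right, hm, LinearEquiv.apply_symm_apply,
        LinearEquiv.apply_symm_apply] at h1
      exact h1
    · have h1 := h.counit_one ((A.α ^ (-m)) a)
      rw [hu, hm, A.counit_α_zpow] at h1
      exact h1.symm

end DoiHopfDatum

end Entwining

/-! ### The smash coproduct of Hom-coalgebras -/

section Smash

variable {K : Type u} [Field K]
variable {VB VD : Type u} [AddCommGroup VB] [Module K VB] [AddCommGroup VD] [Module K VD]

/-- `(b ⊗ b') ⊗ (d ⊗ d') ↦ (b ⊗ d^φ) ⊗ (b'^φ ⊗ d')` -/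
def smashTwist (φ : VB ⊗[K] VD →ₗ[K] VD ⊗[K] VB) :
    (VB ⊗[K] VB) ⊗[K] (VD ⊗[K] VD) →ₗ[K] (VB ⊗[K] VD) ⊗[K] (VB ⊗[K] VD) :=
  (TensorProduct.assoc K VB VD (VB ⊗[K] VD)).symm.toLinearMap ∘ₗ
    ((TensorProduct.assoc K VD VB VD).toLinearMap ∘ₗ φ.rTensor VD ∘ₗ
      (TensorProduct.assoc K VB VD VD).symm.toLinearMap).lTensor VB ∘ₗ
    (TensorProduct.assoc K VB VB (VD ⊗[K] VD)).toLinearMap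

lemma smashTwist_tmul (φ : VB ⊗[K] VD →ₗ[K] VD ⊗[K] VB) (b b' : VB) (d d' : VD) :
    smashTwist φ ((b ⊗ₜ b') ⊗ₜ (d ⊗ₜ d')) =
      (TensorProduct.assoc K VB VD (VB ⊗[K] VD)).symm
        (b ⊗ₜ TensorProduct.assoc K VD VB VD (φ (b' ⊗ₜ d) ⊗ₜ d')) := by
  simp [smashTwist]

lemma smashComul_tmul (B : HomCoalgebra K VB) (D : HomCoalgebra K VD)
    (φ : VB ⊗[K] VD →ₗ[K] VD ⊗[K] VB) (b : VB) (d : VD) :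
    smashComul B D φ (b ⊗ₜ d) = smashTwist φ (B.comul b ⊗ₜ D.comul d) := rfl

/-- `b ⊗ d ↦ ε(d) b` -/
def smashFst (D : HomCoalgebra K VD) : VB ⊗[K] VD →ₗ[K] VB :=
  (TensorProduct.rid K VB).toLinearMap ∘ₗ D.counit.lTensor VB

/-- `b ⊗ d ↦ ε(b) d` -/
def smashSnd (B : HomCoalgebra K VB) : VB ⊗[K] VD →ₗ[K] VD :=
  (TensorProduct.lid K VD).toLinearMap ∘ₗ B.counit.rTensor VD

@[simp]
lemma smashFst_tmul (D : HomCoalgebra K VD) (b : VB) (d : VD) :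
    smashFst D (b ⊗ₜ d) = D.counit d • b := by simp [smashFst]

@[simp]
lemma smashSnd_tmul (B : HomCoalgebra K VB) (b : VB) (d : VD) :
    smashSnd B (b ⊗ₜ d) = B.counit b • d := by simp [smashSnd]

variable {B : HomCoalgebra K VB} {D : HomCoalgebra K VD} {φ : VB ⊗[K] VD →ₗ[K] VD ⊗[K] VB}

namespace IsCotwistor

lemma map_α_apply (hφ : IsCotwistor B D φ) (x : VB ⊗[K] VD) :
    φ (TensorProduct.map B.α.toLinearMap D.α.toLinearMap x) =
      TensorProduct.map D.α.toLinearMap B.α.toLinearMap (φ x) := by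
  induction x using TensorProduct.induction_on with
  | zero => simp
  | add x y hx hy => simp only [map_add, hx, hy]
  | tmul b d => exact hφ.map_α b d

/-- The counit of `D` meets the `D`-output of φ, and (M3) makes φ disappear; `snd_smashComul` is the
mirror image with (M4). -/
lemma fst_smashComul (hφ : IsCotwistor B D φ) (b : VB) (d : VD) :
    (smashFst D).rTensor (VB ⊗[K] VD) (smashComul B D φ (b ⊗ₜ d)) =
      TensorProduct.assoc K VB VB VD (B.comul b ⊗ₜ D.α d) := by
  rw [smashComul_tmul, ← D.counit_comul d]
  generalize B.comul b = p
  generalize D.comul d = q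
  induction p using TensorProduct.induction_on with
  | zero => simp
  | add x y hx hy => simp only [TensorProduct.add_tmul, map_add, hx, hy]
  | tmul b b' =>
  induction q using TensorProduct.induction_on with
  | zero => simp
  | add x y hx hy => simp only [TensorProduct.tmul_add, map_add, hx, hy]
  | tmul d d' =>
  have h : ∀ t : VD ⊗[K] VB, (smashFst D).rTensor (VB ⊗[K] VD)
      ((TensorProduct.assoc K VB VD (VB ⊗[K] VD)).symm
        (b ⊗ₜ TensorProduct.assoc K VD VB VD (t ⊗ₜ d'))) =
      b ⊗ₜ (TensorProduct.lid K VB (D.counit.rTensor VB t) ⊗ₜ d') := by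
    intro t
    induction t using TensorProduct.induction_on with
    | zero => simp
    | add x y hx hy =>
      simp only [TensorProduct.add_tmul, TensorProduct.tmul_add, map_add, hx, hy]
    | tmul x y => simp [← TensorProduct.smul_tmul', TensorProduct.tmul_smul]
  rw [smashTwist_tmul, h, hφ.counit_right]
  simp [← TensorProduct.smul_tmul', TensorProduct.tmul_smul]

lemma snd_smashComul (hφ : IsCotwistor B D φ) (b : VB) (d : VD) :
    (smashSnd B).lTensor (VB ⊗[K] VD) (smashComul B D φ (b ⊗ₜ d)) =
      (TensorProduct.assoc K VB VD VD).symm (B.α b ⊗ₜ D.comul d) := by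
  rw [smashComul_tmul, ← B.comul_counit b]
  generalize B.comul b = p
  generalize D.comul d = q
  induction p using TensorProduct.induction_on with
  | zero => simp
  | add x y hx hy => simp only [TensorProduct.add_tmul, map_add, hx, hy]
  | tmul b b' =>
  induction q using TensorProduct.induction_on with
  | zero => simp
  | add x y hx hy => simp only [TensorProduct.tmul_add, map_add, hx, hy]
  | tmul d d' =>
  have h : ∀ t : VD ⊗[K] VB, (smashSnd B).lTensor (VB ⊗[K] VD)
      ((TensorProduct.assoc K VB VD (VB ⊗[K] VD)).symm
        (b ⊗ₜ TensorProduct.assoc K VD VB VD (t ⊗ₜ d'))) =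
      (b ⊗ₜ (TensorProduct.rid K VD (B.counit.lTensor VD t))) ⊗ₜ d' := by
    intro t
    induction t using TensorProduct.induction_on with
    | zero => simp
    | add x y hx hy =>
      simp only [TensorProduct.add_tmul, TensorProduct.tmul_add, map_add, hx, hy]
    | tmul x y => simp [← TensorProduct.smul_tmul', TensorProduct.tmul_smul]
  rw [smashTwist_tmul, h, hφ.counit_left]
  simp [← TensorProduct.smul_tmul', TensorProduct.tmul_smul]

/-- The counits remove the outer factors and keep the middle ones, where φ sits. Thus φ can be read
off from the smash coproduct; no axiom on φ enters. -/
lemma snd_fst_smashComul (b : VB) (d : VD) :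
    TensorProduct.map (smashSnd B) (smashFst D) (smashComul B D φ (b ⊗ₜ d)) =
      φ (B.α b ⊗ₜ D.α d) := by
  rw [smashComul_tmul, ← D.comul_counit d, ← B.counit_comul b]
  generalize B.comul b = p
  generalize D.comul d = q
  induction p using TensorProduct.induction_on with
  | zero => simp
  | add x y hx hy => simp only [TensorProduct.add_tmul, map_add, hx, hy]
  | tmul b b' =>
  induction q using TensorProduct.induction_on with
  | zero => simp
  | add x y hx hy => simp only [TensorProduct.tmul_add, map_add, hx, hy]
  | tmul d d' =>
  have h : ∀ t : VD ⊗[K] VB, TensorProduct.map (smashSnd B) (smashFst D)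
      ((TensorProduct.assoc K VB VD (VB ⊗[K] VD)).symm
        (b ⊗ₜ TensorProduct.assoc K VD VB VD (t ⊗ₜ d'))) =
      (B.counit b * D.counit d') • t := by
    intro t
    induction t using TensorProduct.induction_on with
    | zero => simp
    | add x y hx hy =>
      simp only [TensorProduct.add_tmul, TensorProduct.tmul_add, map_add, hx, hy, smul_add]
    | tmul x y => simp [← TensorProduct.smul_tmul', TensorProduct.tmul_smul, smul_smul, mul_comm]
  rw [smashTwist_tmul, h]
  simp [← TensorProduct.smul_tmul', TensorProduct.tmul_smul, smul_smul, mul_comm]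

/-- Here the outer factors survive and the middle ones, including φ, are removed by the counits.
This identity makes a smash comodule recoverable from its two restrictions. -/
lemma fst_snd_smashComul (hφ : IsCotwistor B D φ) (x : VB ⊗[K] VD) :
    TensorProduct.map (smashFst D) (smashSnd B) (smashComul B D φ x) =
      TensorProduct.map B.α.toLinearMap D.α.toLinearMap x := by
  induction x using TensorProduct.induction_on with
  | zero => simp
  | add x y hx hy => simp only [map_add, hx, hy]
  | tmul b d =>
  have h := congrArg ((smashSnd B).lTensor VB) (hφ.fst_smashComul b d)
  rw [← LinearMap.comp_apply, LinearMap.lTensor_comp_rTensor] at h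
  rw [h, TensorProduct.map_tmul, LinearEquiv.coe_coe, LinearEquiv.coe_coe, ← B.comul_counit b]
  generalize B.comul b = p
  induction p using TensorProduct.induction_on with
  | zero => simp
  | add x y hx hy => simp only [TensorProduct.add_tmul, map_add, hx, hy]
  | tmul b b' => simp [← TensorProduct.smul_tmul', TensorProduct.tmul_smul]

lemma fst_fst_smashComul (hφ : IsCotwistor B D φ) (x : VB ⊗[K] VD) :
    TensorProduct.map (smashFst D) (smashFst D) (smashComul B D φ x) =
      B.comul (smashFst D x) := by
  induction x using TensorProduct.induction_on with
  | zero => simp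
  | add x y hx hy => simp only [map_add, hx, hy]
  | tmul b d =>
  have h := congrArg ((smashFst D).lTensor VB) (hφ.fst_smashComul b d)
  rw [← LinearMap.comp_apply, LinearMap.lTensor_comp_rTensor] at h
  rw [h, smashFst_tmul, map_smul]
  generalize B.comul b = p
  induction p using TensorProduct.induction_on with
  | zero => simp
  | add x y hx hy => simp only [TensorProduct.add_tmul, map_add, smul_add, hx, hy]
  | tmul b b' => simp [D.counit_α]

lemma snd_snd_smashComul (hφ : IsCotwistor B D φ) (x : VB ⊗[K] VD) :
    TensorProduct.map (smashSnd B) (smashSnd B) (smashComul B D φ x) =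
      D.comul (smashSnd B x) := by
  induction x using TensorProduct.induction_on with
  | zero => simp
  | add x y hx hy => simp only [map_add, hx, hy]
  | tmul b d =>
  have h := congrArg ((smashSnd B).rTensor VD) (hφ.snd_smashComul b d)
  rw [← LinearMap.comp_apply, LinearMap.rTensor_comp_lTensor] at h
  rw [h, smashSnd_tmul, map_smul]
  generalize D.comul d = p
  induction p using TensorProduct.induction_on with
  | zero => simp
  | add x y hx hy => simp only [TensorProduct.tmul_add, map_add, smul_add, hx, hy]
  | tmul b b' => simp [B.counit_α, TensorProduct.smul_tmul']

/-- `((b ⊗ b') ⊗ d) ↦ d^{φϕ} ⊗ b^ϕ ⊗ b'^φ` -/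
abbrev twistLeft (φ : VB ⊗[K] VD →ₗ[K] VD ⊗[K] VB) :
    (VB ⊗[K] VB) ⊗[K] VD →ₗ[K] VD ⊗[K] (VB ⊗[K] VB) :=
  (TensorProduct.assoc K VD VB VB).toLinearMap ∘ₗ φ.rTensor VB ∘ₗ
    (TensorProduct.assoc K VB VD VB).symm.toLinearMap ∘ₗ φ.lTensor VB ∘ₗ
      (TensorProduct.assoc K VB VB VD).toLinearMap

/-- The threefold analogue of `smashTwist`. -/
abbrev smashTwist₃ (φ : VB ⊗[K] VD →ₗ[K] VD ⊗[K] VB) :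
    (VB ⊗[K] (VB ⊗[K] VB)) ⊗[K] (VD ⊗[K] (VD ⊗[K] VD)) →ₗ[K]
      (VB ⊗[K] VD) ⊗[K] ((VB ⊗[K] VD) ⊗[K] (VB ⊗[K] VD)) :=
  (TensorProduct.assoc K VB VD _).symm.toLinearMap ∘ₗ
    ((smashTwist φ).lTensor VD ∘ₗ
      (TensorProduct.assoc K VD (VB ⊗[K] VB) (VD ⊗[K] VD)).toLinearMap ∘ₗ
      (twistLeft φ).rTensor (VD ⊗[K] VD) ∘ₗ
      (TensorProduct.assoc K (VB ⊗[K] VB) VD (VD ⊗[K] VD)).symm.toLinearMap).lTensor VB ∘ₗ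
    (TensorProduct.assoc K VB (VB ⊗[K] VB) (VD ⊗[K] (VD ⊗[K] VD))).toLinearMap

/-- Coassociativity of the smash coproduct is split in two: both bracketings are brought to
`smashTwist₃` applied to iterated coproducts of `B` and of `D`, whose coassociativity then finishes.
This half uses (M1) to pass the coproduct of `B` through φ. -/
lemma map_comul_smashTwist (hφ : IsCotwistor B D φ) (p : VB ⊗[K] VB) (q : VD ⊗[K] VD) :
    TensorProduct.map (TensorProduct.map B.α.toLinearMap D.α.toLinearMap) (smashComul B D φ)
      (smashTwist φ (p ⊗ₜ q)) =
    smashTwist₃ φ (TensorProduct.map B.α.toLinearMap B.comul p ⊗ₜ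
      TensorProduct.map D.α.toLinearMap D.comul q) := by
  induction p using TensorProduct.induction_on with
  | zero => simp
  | add x y hx hy => simp only [TensorProduct.add_tmul, map_add, hx, hy]
  | tmul b b' =>
  induction q using TensorProduct.induction_on with
  | zero => simp
  | add x y hx hy => simp only [TensorProduct.tmul_add, map_add, hx, hy]
  | tmul d d' =>
  have h := hφ.comul_left b' d
  have h1 : smashTwist₃ φ (TensorProduct.map B.α.toLinearMap B.comul (b ⊗ₜ b') ⊗ₜ
      TensorProduct.map D.α.toLinearMap D.comul (d ⊗ₜ d')) =
    (TensorProduct.assoc K VB VD _).symm (B.α b ⊗ₜ (smashTwist φ).lTensor VD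
      (TensorProduct.assoc K VD (VB ⊗[K] VB) (VD ⊗[K] VD)
        (TensorProduct.map D.α.toLinearMap B.comul (φ (b' ⊗ₜ d)) ⊗ₜ D.comul d'))) := by
    rw [← h]
    simp
  rw [h1, smashTwist_tmul]
  generalize φ (b' ⊗ₜ d) = t
  induction t using TensorProduct.induction_on with
  | zero => simp
  | add x y hx hy =>
    simp only [TensorProduct.add_tmul, TensorProduct.tmul_add, map_add, hx, hy]
  | tmul x y => simp [smashComul_tmul]

/-- The other bracketing, with (M2) passing the coproduct of `D` through φ. -/
lemma map_smashTwist_comul (hφ : IsCotwistor B D φ) (p : VB ⊗[K] VB) (q : VD ⊗[K] VD) :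
    TensorProduct.assoc K _ _ _ (TensorProduct.map (smashComul B D φ)
      (TensorProduct.map B.α.toLinearMap D.α.toLinearMap) (smashTwist φ (p ⊗ₜ q))) =
    smashTwist₃ φ (TensorProduct.assoc K _ _ _ (TensorProduct.map B.comul B.α.toLinearMap p) ⊗ₜ
      TensorProduct.assoc K _ _ _ (TensorProduct.map D.comul D.α.toLinearMap q)) := by
  induction p using TensorProduct.induction_on with
  | zero => simp
  | add x y hx hy => simp only [TensorProduct.add_tmul, map_add, hx, hy]
  | tmul b b' =>
  induction q using TensorProduct.induction_on with
  | zero => simp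
  | add x y hx hy => simp only [TensorProduct.tmul_add, map_add, hx, hy]
  | tmul d d' =>
  have h := hφ.comul_right b' d
  have h1 : TensorProduct.assoc K _ _ _ (TensorProduct.map (smashComul B D φ)
      (TensorProduct.map B.α.toLinearMap D.α.toLinearMap)
        (smashTwist φ ((b ⊗ₜ b') ⊗ₜ (d ⊗ₜ d')))) =
    TensorProduct.assoc K _ _ _
      ((smashTwist φ ∘ₗ TensorProduct.mk K _ _ (B.comul b)).rTensor _
        (TensorProduct.assoc K (VD ⊗[K] VD) VB VD
        (TensorProduct.map D.comul B.α.toLinearMap (φ (b' ⊗ₜ d)) ⊗ₜ D.α d'))) := by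
    rw [smashTwist_tmul]
    generalize φ (b' ⊗ₜ d) = t
    induction t using TensorProduct.induction_on with
    | zero => simp
    | add x y hx hy =>
      simp only [TensorProduct.add_tmul, TensorProduct.tmul_add, map_add, hx, hy]
    | tmul x y => simp [smashComul_tmul]
  rw [h1, ← h, TensorProduct.map_tmul, TensorProduct.map_tmul, LinearEquiv.coe_coe,
    LinearEquiv.coe_coe]
  generalize B.comul b = p
  generalize D.comul d = q
  generalize B.α b' = b₃
  generalize D.α d' = d₃
  clear h h1
  induction p using TensorProduct.induction_on with
  | zero => simp
  | add x y hx hy =>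
    simp only [TensorProduct.add_tmul, map_add, LinearMap.comp_add, LinearMap.rTensor_add,
      LinearMap.add_apply, hx, hy]
  | tmul b₁ b₂ =>
  induction q using TensorProduct.induction_on with
  | zero => simp
  | add x y hx hy => simp only [TensorProduct.tmul_add, TensorProduct.add_tmul, map_add, hx, hy]
  | tmul d₁ d₂ =>
  simp only [TensorProduct.assoc_tmul, TensorProduct.assoc_symm_tmul, LinearMap.rTensor_tmul,
    LinearMap.comp_apply, LinearEquiv.coe_coe, LinearMap.lTensor_tmul]
  generalize φ (b₃ ⊗ₜ d₁) = t
  induction t using TensorProduct.induction_on with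
  | zero => simp
  | add x y hx hy =>
    simp only [TensorProduct.add_tmul, TensorProduct.tmul_add, map_add, hx, hy]
  | tmul x y =>
  simp only [TensorProduct.assoc_tmul, TensorProduct.assoc_symm_tmul, LinearMap.rTensor_tmul,
    LinearMap.lTensor_tmul]
  -- The two remaining uses of φ, on `b₂ ⊗ x` and on `y ⊗ d₂`, concern disjoint factors, so their
  -- order is immaterial.
  have h2 : ∀ s : VD ⊗[K] VB, (smashTwist φ).lTensor VD (TensorProduct.assoc K _ _ _
      (TensorProduct.assoc K _ _ _ (s ⊗ₜ y) ⊗ₜ (d₂ ⊗ₜ d₃))) =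
      (TensorProduct.assoc K VB VD (VB ⊗[K] VD)).symm.toLinearMap.lTensor VD
        (TensorProduct.assoc K _ _ _
          (s ⊗ₜ (TensorProduct.assoc K _ _ _ (φ (y ⊗ₜ d₂) ⊗ₜ d₃)))) := by
    intro s
    induction s using TensorProduct.induction_on with
    | zero => simp
    | add x y hx hy => simp only [TensorProduct.add_tmul, map_add, hx, hy]
    | tmul x y => simp [smashTwist_tmul]
  rw [h2]
  generalize φ (y ⊗ₜ d₂) = t
  induction t using TensorProduct.induction_on with
  | zero => simp
  | add x y hx hy =>
    simp only [TensorProduct.add_tmul, TensorProduct.tmul_add, map_add, hx, hy]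
  | tmul z w =>
  simp only [TensorProduct.assoc_tmul, TensorProduct.assoc_symm_tmul, LinearMap.rTensor_tmul,
    LinearMap.comp_apply, TensorProduct.mk_apply, smashTwist_tmul]
  generalize φ (b₂ ⊗ₜ x) = s
  induction s using TensorProduct.induction_on with
  | zero => simp
  | add x y hx hy =>
    simp only [TensorProduct.add_tmul, TensorProduct.tmul_add, map_add, hx, hy]
  | tmul g h => simp

end IsCotwistor

/-- The smash coproduct Hom-coalgebra of a Hom-cotwistor. -/
def smashCoalgebra (hφ : IsCotwistor B D φ) : HomCoalgebra K (VB ⊗[K] VD) where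
  α := TensorProduct.congr B.α D.α
  comul := smashComul B D φ
  counit := B.counit ∘ₗ smashFst D
  counit_α x := by
    induction x using TensorProduct.induction_on with
    | zero => simp
    | add x y hx hy => simp only [map_add, hx, hy]
    | tmul b d => simp [B.counit_α, D.counit_α]
  coassoc x := by
    induction x using TensorProduct.induction_on with
    | zero => simp
    | add x y hx hy => simp only [map_add, hx, hy]
    | tmul b d =>
      refine (hφ.map_comul_smashTwist _ _).trans (Eq.trans ?_ (hφ.map_smashTwist_comul _ _).symm)
      rw [B.coassoc, D.coassoc]
  counit_comul x := by
    induction x using TensorProduct.induction_on with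
    | zero => simp
    | add x y hx hy => simp only [map_add, hx, hy]
    | tmul b d =>
      rw [LinearMap.rTensor_comp_apply, hφ.fst_smashComul, TensorProduct.congr_tmul,
        ← B.counit_comul b]
      generalize B.comul b = p
      induction p using TensorProduct.induction_on with
      | zero => simp
      | add x y hx hy => simp only [TensorProduct.add_tmul, map_add, hx, hy]
      | tmul b b' => simp [← TensorProduct.smul_tmul']
  comul_counit x := by
    induction x using TensorProduct.induction_on with
    | zero => simp
    | add x y hx hy => simp only [map_add, hx, hy]
    | tmul b d =>
      have e : B.counit ∘ₗ smashFst D = D.counit ∘ₗ smashSnd B := by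
        ext b d; simp [mul_comm]
      rw [e, LinearMap.lTensor_comp_apply, hφ.snd_smashComul, TensorProduct.congr_tmul,
        ← D.comul_counit d]
      generalize D.comul d = p
      induction p using TensorProduct.induction_on with
      | zero => simp
      | add x y hx hy => simp only [TensorProduct.tmul_add, map_add, hx, hy]
      | tmul b b' => simp

end Smash

/-! ### Smash coproduct Hom-bialgebras and multiplicativity of the cotwistor. -/

section SmashBialgebra

variable {K : Type u} [Field K]
variable {VB VD : Type u} [AddCommGroup VB] [Module K VB] [AddCommGroup VD] [Module K VD]

/-- The tensor product of Hom-algebras. -/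
def tensorAlgebra (B : HomAlgebra K VB) (D : HomAlgebra K VD) : HomAlgebra K (VB ⊗[K] VD) where
  α := TensorProduct.congr B.α D.α
  mul := TensorProduct.map₂ B.mul D.mul
  one := B.one ⊗ₜ D.one
  mul_assoc x y z := by
    induction x using TensorProduct.induction_on with
    | zero => simp
    | add x y hx hy => simp only [map_add, LinearMap.add_apply, hx, hy]
    | tmul b d =>
    induction y using TensorProduct.induction_on with
    | zero => simp
    | add x y hx hy => simp only [map_add, LinearMap.add_apply, hx, hy]
    | tmul b' d' =>
    induction z using TensorProduct.induction_on with
    | zero => simp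
    | add x y hx hy => simp only [map_add, hx, hy]
    | tmul b'' d'' => simp [B.mul_assoc, D.mul_assoc]
  α_one := by simp [B.α_one, D.α_one]
  one_mul x := by
    induction x using TensorProduct.induction_on with
    | zero => simp
    | add x y hx hy => simp only [map_add, hx, hy]
    | tmul b d => simp [B.one_mul, D.one_mul]
  mul_one x := by
    induction x using TensorProduct.induction_on with
    | zero => simp
    | add x y hx hy => simp only [map_add, LinearMap.add_apply, hx, hy]
    | tmul b d => simp [B.mul_one, D.mul_one]

variable {B : HomBialgebra K VB} {D : HomBialgebra K VD}

lemma smashFst_mul (x y : VB ⊗[K] VD) :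
    smashFst D.toHomCoalgebra (TensorProduct.map₂ B.mul D.mul x y) =
      B.mul (smashFst D.toHomCoalgebra x) (smashFst D.toHomCoalgebra y) :=
  rid_lTensor_map₂ D.counit_mul x y

lemma smashSnd_mul (x y : VB ⊗[K] VD) :
    smashSnd B.toHomCoalgebra (TensorProduct.map₂ B.mul D.mul x y) =
      D.mul (smashSnd B.toHomCoalgebra x) (smashSnd B.toHomCoalgebra y) :=
  lid_rTensor_map₂ B.counit_mul x y

variable {φ : VB ⊗[K] VD →ₗ[K] VD ⊗[K] VB}

/-- The twist is composed of associators, which respect componentwise products, and of one copy of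
φ, which does so by hypothesis. -/
lemma smashTwist_map₂
    (hφ : ∀ x y, φ (TensorProduct.map₂ B.mul D.mul x y) =
      TensorProduct.map₂ D.mul B.mul (φ x) (φ y))
    (P Q : (VB ⊗[K] VB) ⊗[K] (VD ⊗[K] VD)) :
    smashTwist φ (TensorProduct.map₂ (TensorProduct.map₂ B.mul B.mul)
      (TensorProduct.map₂ D.mul D.mul) P Q) =
    TensorProduct.map₂ (TensorProduct.map₂ B.mul D.mul) (TensorProduct.map₂ B.mul D.mul)
      (smashTwist φ P) (smashTwist φ Q) := by
  simp only [smashTwist, LinearMap.comp_apply, LinearEquiv.coe_coe]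
  have h : ∀ p q : VB ⊗[K] (VD ⊗[K] VD),
      TensorProduct.assoc K VD VB VD (φ.rTensor VD ((TensorProduct.assoc K VB VD VD).symm
        (TensorProduct.map₂ B.mul (TensorProduct.map₂ D.mul D.mul) p q))) =
      TensorProduct.map₂ D.mul (TensorProduct.map₂ B.mul D.mul)
        (TensorProduct.assoc K VD VB VD (φ.rTensor VD ((TensorProduct.assoc K VB VD VD).symm p)))
        (TensorProduct.assoc K VD VB VD
          (φ.rTensor VD ((TensorProduct.assoc K VB VD VD).symm q))) := by
    intro p q
    rw [assoc_symm_map₂, LinearMap.rTensor, map_map₂ (f₁ := φ) (f₂ := φ) (g₁ := LinearMap.id)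
      (g₂ := LinearMap.id) hφ (fun _ _ => rfl), assoc_map₂]
  let E := (TensorProduct.assoc K VD VB VD).toLinearMap ∘ₗ φ.rTensor VD ∘ₗ
    (TensorProduct.assoc K VB VD VD).symm.toLinearMap
  rw [assoc_map₂, LinearMap.lTensor, map_map₂ (f₁ := LinearMap.id) (f₂ := LinearMap.id)
    (a' := B.mul) (b' := TensorProduct.map₂ D.mul (TensorProduct.map₂ B.mul D.mul))
    (g₁ := E) (g₂ := E) (fun _ _ => rfl) h, assoc_symm_map₂]

namespace IsMonoidalCotwistor

lemma map_mul (hφ : IsMonoidalCotwistor B D φ) (x y : VB ⊗[K] VD) :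
    φ (TensorProduct.map₂ B.mul D.mul x y) = TensorProduct.map₂ D.mul B.mul (φ x) (φ y) := by
  induction x using TensorProduct.induction_on with
  | zero => simp
  | add x y hx hy => simp only [_root_.map_add, LinearMap.add_apply, hx, hy]
  | tmul b d =>
  induction y using TensorProduct.induction_on with
  | zero => simp
  | add x y hx hy => simp only [_root_.map_add, hx, hy]
  | tmul b' d' => rw [hφ.mul, TensorProduct.map₂_apply_tmul, TensorProduct.map_tmul]

lemma smashComul_mul (hφ : IsMonoidalCotwistor B D φ) (x y : VB ⊗[K] VD) :
    smashComul B.toHomCoalgebra D.toHomCoalgebra φ (TensorProduct.map₂ B.mul D.mul x y) =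
      TensorProduct.map₂ (TensorProduct.map₂ B.mul D.mul) (TensorProduct.map₂ B.mul D.mul)
        (smashComul B.toHomCoalgebra D.toHomCoalgebra φ x)
        (smashComul B.toHomCoalgebra D.toHomCoalgebra φ y) := by
  have h : ∀ z, smashComul B.toHomCoalgebra D.toHomCoalgebra φ z =
    smashTwist φ (TensorProduct.map B.comul D.comul z) := fun _ => rfl
  rw [h, h, h, map_map₂ B.comul_mul D.comul_mul, smashTwist_map₂ hφ.map_mul]

/-- The smash coproduct Hom-bialgebra of a monoidal Hom-cotwistor. -/
def smashBialgebra (hφ : IsMonoidalCotwistor B D φ) : HomBialgebra K (VB ⊗[K] VD) where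
  __ := tensorAlgebra B.toHomAlgebra D.toHomAlgebra
  __ := smashCoalgebra hφ.toIsCotwistor
  comul_mul := hφ.smashComul_mul
  comul_one := by
    change smashComul B.toHomCoalgebra D.toHomCoalgebra φ (B.one ⊗ₜ D.one) =
      (B.one ⊗ₜ D.one) ⊗ₜ (B.one ⊗ₜ D.one)
    rw [smashComul_tmul, B.comul_one, D.comul_one, smashTwist_tmul, hφ.one]
    simp
  counit_mul x y := by
    change B.counit (smashFst _ (TensorProduct.map₂ B.mul D.mul x y)) = _
    rw [smashFst_mul, B.counit_mul]
    rfl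
  counit_one := by
    change B.counit (smashFst _ (B.one ⊗ₜ D.one)) = 1
    simp [B.counit_one, D.counit_one]

end IsMonoidalCotwistor

lemma snd_fst_smashComul_apply (x : VB ⊗[K] VD) :
    TensorProduct.map (smashSnd B.toHomCoalgebra) (smashFst D.toHomCoalgebra)
      (smashComul B.toHomCoalgebra D.toHomCoalgebra φ x) =
      φ (TensorProduct.congr B.α D.α x) := by
  induction x using TensorProduct.induction_on with
  | zero => simp
  | add x y hx hy => simp only [map_add, hx, hy]
  | tmul b d => exact IsCotwistor.snd_fst_smashComul b d

/-- A Hom-cotwistor whose smash coproduct is multiplicative is monoidal. -/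
lemma IsCotwistor.isMonoidalCotwistor
    (hφ : IsCotwistor B.toHomCoalgebra D.toHomCoalgebra φ)
    (hmul : ∀ x y, smashComul B.toHomCoalgebra D.toHomCoalgebra φ
      (TensorProduct.map₂ B.mul D.mul x y) =
      TensorProduct.map₂ (TensorProduct.map₂ B.mul D.mul) (TensorProduct.map₂ B.mul D.mul)
        (smashComul B.toHomCoalgebra D.toHomCoalgebra φ x)
        (smashComul B.toHomCoalgebra D.toHomCoalgebra φ y))
    (hone : smashComul B.toHomCoalgebra D.toHomCoalgebra φ (B.one ⊗ₜ D.one) =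
      (B.one ⊗ₜ D.one) ⊗ₜ (B.one ⊗ₜ D.one)) : IsMonoidalCotwistor B D φ where
  toIsCotwistor := hφ
  mul a b h g := by
    -- The two projections are multiplicative, so applying them to `hmul` keeps it an identity of
    -- products while turning the coproduct into φ ∘ (α ⊗ α); the factor α ⊗ α is then removed by
    -- evaluating at preimages.
    have e := fun x y => congrArg (TensorProduct.map (smashSnd B.toHomCoalgebra)
      (smashFst D.toHomCoalgebra)) (hmul x y)
    simp only [map_map₂ smashSnd_mul smashFst_mul, snd_fst_smashComul_apply] at e
    have e1 := e (B.α.symm a ⊗ₜ D.α.symm h) (B.α.symm b ⊗ₜ D.α.symm g)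
    simpa [B.α_mul, D.α_mul] using e1.symm
  one := by
    have e := congrArg (TensorProduct.map (smashSnd B.toHomCoalgebra)
      (smashFst D.toHomCoalgebra)) hone
    rw [snd_fst_smashComul_apply] at e
    simpa [B.α_one, D.α_one, B.counit_one, D.counit_one] using e

end SmashBialgebra

/-! ### Comodules over the smash coproduct -/

section PairComodule

variable {K : Type u} [Field K]
variable {VB VD U : Type u} [AddCommGroup VB] [Module K VB] [AddCommGroup VD] [Module K VD]
  [AddCommGroup U] [Module K U]

/-- `u ↦ u₍₀₎[0] ⊗ u₍₀₎[1] ⊗ α(u₍₁₎)`, where `ρB(u) = u[0] ⊗ u[1]` and `ρD(u) = u₍₀₎ ⊗ u₍₁₎`. -/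
def iterCoact (ρB : U →ₗ[K] U ⊗[K] VB) (ρD : U →ₗ[K] U ⊗[K] VD) (αD : VD ≃ₗ[K] VD) :
    U →ₗ[K] U ⊗[K] (VB ⊗[K] VD) :=
  (TensorProduct.assoc K U VB VD).toLinearMap ∘ₗ TensorProduct.map ρB αD.toLinearMap ∘ₗ ρD

lemma iterCoact_apply (ρB : U →ₗ[K] U ⊗[K] VB) (ρD : U →ₗ[K] U ⊗[K] VD) (αD : VD ≃ₗ[K] VD)
    (u : U) : iterCoact ρB ρD αD u =
      TensorProduct.assoc K U VB VD (TensorProduct.map ρB αD.toLinearMap (ρD u)) := rfl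

/-- A pair of a `B`-comodule structure and a `D`-comodule structure intertwined by `φ`. -/
structure IsPairComodule (B : HomCoalgebra K VB) (D : HomCoalgebra K VD)
    (φ : VB ⊗[K] VD →ₗ[K] VD ⊗[K] VB) (αU : U ≃ₗ[K] U) (ρB : U →ₗ[K] U ⊗[K] VB)
    (ρD : U →ₗ[K] U ⊗[K] VD) : Prop where
  left : IsRightComodule B αU ρB
  right : IsRightComodule D αU ρD
  compat : ∀ u, φ.lTensor U (iterCoact ρB ρD D.α u) = iterCoact ρD ρB B.α u

variable {B : HomCoalgebra K VB} {D : HomCoalgebra K VD} {φ : VB ⊗[K] VD →ₗ[K] VD ⊗[K] VB}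
  {αU : U ≃ₗ[K] U}

section OfSmash

variable {ρ : U →ₗ[K] U ⊗[K] (VB ⊗[K] VD)} {hφ : IsCotwistor B D φ}

/-- Coassociativity is projected by `smashFst ⊗ smashSnd`, which turns the coproduct into α ⊗ α. The
two restrictions thus determine ρ up to α, which is why α⁻¹ appears in the inverse construction. -/
lemma iterCoact_fst_snd (h : IsRightComodule (smashCoalgebra hφ) αU ρ) (u : U) :
    iterCoact ((smashFst D).lTensor U ∘ₗ ρ) ((smashSnd B).lTensor U ∘ₗ ρ) D.α u = ρ (αU u) := by
  have h1 := h.coact_coact_map (smashFst D) (smashSnd B) u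
  have e1 : TensorProduct.map (smashFst D) (smashSnd B) ∘ₗ (smashCoalgebra hφ).comul =
      (smashCoalgebra hφ).α.toLinearMap := LinearMap.ext hφ.fst_snd_smashComul
  have e2 : smashSnd B ∘ₗ (smashCoalgebra hφ).α.toLinearMap = D.α.toLinearMap ∘ₗ smashSnd B := by
    ext b d; simp [smashCoalgebra, B.counit_α]
  rw [e1, ← h.coact_α, e2] at h1
  rw [h1, iterCoact_apply, LinearMap.comp_apply, LinearMap.map_lTensor]

/-- The two projections are morphisms of Hom-coalgebras, which gives the two restrictions. The
exchange relation is coassociativity projected in the opposite order, by `smashSnd ⊗ smashFst`,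
under which the coproduct becomes φ ∘ (α ⊗ α). -/
lemma IsRightComodule.isPairComodule (h : IsRightComodule (smashCoalgebra hφ) αU ρ) :
    IsPairComodule B D φ αU ((smashFst D).lTensor U ∘ₗ ρ) ((smashSnd B).lTensor U ∘ₗ ρ) where
  left := h.map _ (LinearMap.congr_fun (by ext b d; simp [smashCoalgebra, D.counit_α] :
      smashFst D ∘ₗ (smashCoalgebra hφ).α.toLinearMap = B.α.toLinearMap ∘ₗ smashFst D))
    hφ.fst_fst_smashComul (fun _ => rfl)
  right := h.map _ (LinearMap.congr_fun (by ext b d; simp [smashCoalgebra, B.counit_α] :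
      smashSnd B ∘ₗ (smashCoalgebra hφ).α.toLinearMap = D.α.toLinearMap ∘ₗ smashSnd B))
    hφ.snd_snd_smashComul (LinearMap.congr_fun (by
      ext b d; simp [smashCoalgebra, mul_comm] :
      D.counit ∘ₗ smashSnd B = (smashCoalgebra hφ).counit))
  compat u := by
    rw [iterCoact_fst_snd h]
    have h1 := h.coact_coact_map (smashSnd B) (smashFst D) u
    have e1 : TensorProduct.map (smashSnd B) (smashFst D) ∘ₗ (smashCoalgebra hφ).comul =
        φ ∘ₗ (smashCoalgebra hφ).α.toLinearMap := by
      ext b d; exact IsCotwistor.snd_fst_smashComul b d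
    have e2 : smashFst D ∘ₗ (smashCoalgebra hφ).α.toLinearMap =
        B.α.toLinearMap ∘ₗ smashFst D := by
      ext b d; simp [smashCoalgebra, D.counit_α]
    rw [e1, e2] at h1
    rw [iterCoact_apply, h.coact_α, LinearMap.lTensor, TensorProduct.map_map, LinearMap.id_comp, h1,
      LinearMap.comp_apply, LinearMap.map_lTensor]

end OfSmash

namespace IsPairComodule

variable {ρB : U →ₗ[K] U ⊗[K] VB} {ρD : U →ₗ[K] U ⊗[K] VD}

/-- The counit of `D` on the last leg collapses the inner coaction to α. Together with
`snd_iterCoact` this shows that a pair is recovered from the smash comodule built from it. -/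
lemma fst_iterCoact (h : IsPairComodule B D φ αU ρB ρD) (u : U) :
    (smashFst D).lTensor U (iterCoact ρB ρD D.α u) = ρB (αU u) := by
  rw [← h.right.coact_counit, iterCoact_apply]
  generalize ρD u = t
  induction t using TensorProduct.induction_on with
  | zero => simp
  | add x y hx hy => simp only [map_add, hx, hy]
  | tmul w d =>
  simp only [TensorProduct.map_tmul, LinearMap.lTensor_tmul, TensorProduct.rid_tmul, map_smul,
    LinearEquiv.coe_coe]
  generalize ρB w = s
  induction s using TensorProduct.induction_on with
  | zero => simp
  | add x y hx hy => simp only [TensorProduct.add_tmul, map_add, smul_add, hx, hy]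
  | tmul x b => simp [D.counit_α]

lemma snd_iterCoact (h : IsPairComodule B D φ αU ρB ρD) (u : U) :
    (smashSnd B).lTensor U (iterCoact ρB ρD D.α u) = ρD (αU u) := by
  rw [h.right.coact_α, iterCoact_apply]
  generalize ρD u = t
  induction t using TensorProduct.induction_on with
  | zero => simp
  | add x y hx hy => simp only [map_add, hx, hy]
  | tmul w d =>
  simp only [TensorProduct.map_tmul, LinearEquiv.coe_coe]
  rw [← h.left.coact_counit]
  generalize ρB w = s
  induction s using TensorProduct.induction_on with
  | zero => simp
  | add x y hx hy => simp only [TensorProduct.add_tmul, map_add, hx, hy]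
  | tmul x b => simp [← TensorProduct.smul_tmul']

/-- `(y ⊗ b) ⊗ (d ⊗ b') ⊗ d' ↦ y ⊗ ((b ⊗ d) ⊗ (b' ⊗ d'))` -/
abbrev regroup : ((U ⊗[K] VB) ⊗[K] (VD ⊗[K] VB)) ⊗[K] VD →ₗ[K]
    U ⊗[K] ((VB ⊗[K] VD) ⊗[K] (VB ⊗[K] VD)) :=
  (TensorProduct.assoc K VB VD (VB ⊗[K] VD)).symm.toLinearMap.lTensor U ∘ₗ
    (TensorProduct.assoc K U VB (VD ⊗[K] (VB ⊗[K] VD))).toLinearMap ∘ₗ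
    (TensorProduct.assoc K VD VB VD).toLinearMap.lTensor (U ⊗[K] VB) ∘ₗ
    (TensorProduct.assoc K (U ⊗[K] VB) (VD ⊗[K] VB) VD).toLinearMap

/-- Both sides of coassociativity for the combined coaction are reduced to one normal form, in which
`ρB` is iterated and the `D`-leg is split by its coproduct. On this side only the coassociativity of
`ρB` is used. -/
lemma map_comul_iterCoact (h : IsPairComodule B D φ αU ρB ρD) (u : U) :
    TensorProduct.map αU.toLinearMap (smashComul B D φ) (iterCoact ρB ρD D.α u) =
      regroup (TensorProduct.map (TensorProduct.map ρB φ ∘ₗ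
        (TensorProduct.assoc K U VB VD).toLinearMap ∘ₗ
          TensorProduct.map (TensorProduct.map LinearMap.id B.α.toLinearMap) D.α.toLinearMap)
            D.α.toLinearMap
        ((TensorProduct.assoc K (U ⊗[K] VB) VD VD).symm
          (TensorProduct.map ρB D.comul (ρD u)))) := by
  rw [iterCoact_apply]
  generalize ρD u = t
  induction t using TensorProduct.induction_on with
  | zero => simp
  | add x y hx hy => simp only [map_add, hx, hy]
  | tmul w d =>
  have h1 : ∀ s : U ⊗[K] VB, TensorProduct.map αU.toLinearMap (smashComul B D φ)
      (TensorProduct.assoc K U VB VD (s ⊗ₜ D.α d)) =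
      (smashTwist φ).lTensor U (TensorProduct.assoc K U (VB ⊗[K] VB) (VD ⊗[K] VD)
        (TensorProduct.map αU.toLinearMap B.comul s ⊗ₜ D.comul (D.α d))) := by
    intro s
    induction s using TensorProduct.induction_on with
    | zero => simp
    | add x y hx hy => simp only [TensorProduct.add_tmul, map_add, hx, hy]
    | tmul x b => simp [smashComul_tmul]
  rw [TensorProduct.map_tmul, LinearEquiv.coe_coe, h1, h.left.coact_coact, D.comul_α,
    TensorProduct.map_tmul]
  generalize D.comul d = q
  induction q using TensorProduct.induction_on with
  | zero => simp
  | add x y hx hy => simp only [TensorProduct.tmul_add, map_add, hx, hy]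
  | tmul d₁ d₂ =>
  generalize ρB w = s
  induction s using TensorProduct.induction_on with
  | zero => simp
  | add x y hx hy => simp only [TensorProduct.add_tmul, map_add, hx, hy]
  | tmul x b =>
  simp only [TensorProduct.map_tmul, LinearEquiv.coe_coe, LinearMap.comp_apply,
    TensorProduct.assoc_symm_tmul, TensorProduct.assoc_tmul, LinearMap.id_apply]
  generalize ρB x = r
  induction r using TensorProduct.induction_on with
  | zero => simp
  | add x y hx hy => simp only [TensorProduct.add_tmul, map_add, hx, hy]
  | tmul y b' =>
  simp only [TensorProduct.assoc_tmul, LinearMap.lTensor_tmul, smashTwist_tmul, LinearEquiv.coe_coe]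

/-- On this side a `ρD` stands inside a `ρB`; the exchange relation puts them in the order of the
normal form at the cost of one φ, after which the coassociativity of `ρD` applies. -/
lemma map_iterCoact (h : IsPairComodule B D φ αU ρB ρD) (u : U) :
    TensorProduct.assoc K _ _ _ (TensorProduct.map (iterCoact ρB ρD D.α ∘ₗ αU.symm.toLinearMap)
      (TensorProduct.map B.α.toLinearMap D.α.toLinearMap) (iterCoact ρB ρD D.α u)) =
      regroup (TensorProduct.map (TensorProduct.map ρB φ ∘ₗ
        (TensorProduct.assoc K U VB VD).toLinearMap ∘ₗ
          TensorProduct.map (TensorProduct.map LinearMap.id B.α.toLinearMap) D.α.toLinearMap)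
            D.α.toLinearMap
        ((TensorProduct.assoc K (U ⊗[K] VB) VD VD).symm
          (TensorProduct.map ρB D.comul (ρD u)))) := by
  -- As `ρD` commutes with the structure maps, α⁻¹ cancels the α on the `D`-leg and remains only
  -- inside `ρB`.
  have hs : ∀ x, iterCoact ρB ρD D.α (αU.symm x) =
      TensorProduct.assoc K U VB VD ((ρB ∘ₗ αU.symm.toLinearMap).rTensor VD (ρD x)) := by
    intro x
    obtain ⟨x, rfl⟩ := αU.surjective x
    rw [LinearEquiv.symm_apply_apply, h.right.coact_α, iterCoact_apply, LinearMap.rTensor,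
      TensorProduct.map_map]
    congr 2
    ext y; simp
  have h1 : ∀ (s : U ⊗[K] VB) (d : VD),
      TensorProduct.assoc K _ _ _ (TensorProduct.map (iterCoact ρB ρD D.α ∘ₗ αU.symm.toLinearMap)
        (TensorProduct.map B.α.toLinearMap D.α.toLinearMap)
          (TensorProduct.assoc K U VB VD (s ⊗ₜ d))) =
      regroup ((TensorProduct.map (ρB ∘ₗ αU.symm.toLinearMap) LinearMap.id)
        (TensorProduct.assoc K U VD VB (TensorProduct.map ρD B.α.toLinearMap s)) ⊗ₜ D.α d) := by
    intro s d
    induction s using TensorProduct.induction_on with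
    | zero => simp
    | add x y hx hy => simp only [TensorProduct.add_tmul, map_add, hx, hy]
    | tmul x b =>
    simp only [TensorProduct.assoc_tmul, TensorProduct.map_tmul, LinearMap.comp_apply,
      LinearEquiv.coe_coe, hs]
    generalize ρD x = t
    induction t using TensorProduct.induction_on with
    | zero => simp
    | add x y hx hy => simp only [TensorProduct.add_tmul, map_add, hx, hy]
    | tmul y d' =>
    simp only [LinearMap.rTensor_tmul, TensorProduct.assoc_tmul, TensorProduct.map_tmul,
      LinearMap.comp_apply, LinearEquiv.coe_coe, LinearMap.id_apply]
    generalize ρB (αU.symm y) = t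
    induction t using TensorProduct.induction_on with
    | zero => simp
    | add x y hx hy => simp only [TensorProduct.add_tmul, map_add, hx, hy]
    | tmul y b' => simp
  -- This is where the exchange relation enters, for the inner element `w`.
  have h2 : ∀ t : U ⊗[K] VD,
      TensorProduct.assoc K _ _ _ (TensorProduct.map (iterCoact ρB ρD D.α ∘ₗ αU.symm.toLinearMap)
        (TensorProduct.map B.α.toLinearMap D.α.toLinearMap)
          (TensorProduct.assoc K U VB VD (TensorProduct.map ρB D.α.toLinearMap t))) =
      regroup (TensorProduct.map (TensorProduct.map (ρB ∘ₗ αU.symm.toLinearMap) φ ∘ₗ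
        (TensorProduct.assoc K U VB VD).toLinearMap ∘ₗ
          TensorProduct.map ρB D.α.toLinearMap) D.α.toLinearMap
        (TensorProduct.map ρD D.α.toLinearMap t)) := by
    intro t
    induction t using TensorProduct.induction_on with
    | zero => simp
    | add x y hx hy => simp only [map_add, hx, hy]
    | tmul w d =>
      have hc := h.compat w
      rw [iterCoact_apply, iterCoact_apply] at hc
      rw [TensorProduct.map_tmul, h1, ← hc, LinearMap.lTensor, TensorProduct.map_map]
      simp
  have h3 := h.right.coact_coact u
  rw [← LinearEquiv.symm_apply_eq] at h3
  rw [iterCoact_apply, h2, ← h3]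
  generalize ρD u = t
  clear h3
  induction t using TensorProduct.induction_on with
  | zero => simp
  | add x y hx hy => simp only [map_add, hx, hy]
  | tmul w d =>
  simp only [TensorProduct.map_tmul]
  generalize D.comul d = q
  induction q using TensorProduct.induction_on with
  | zero => simp
  | add x y hx hy => simp only [TensorProduct.tmul_add, map_add, hx, hy]
  | tmul d₁ d₂ =>
  simp only [TensorProduct.assoc_symm_tmul, TensorProduct.map_tmul, LinearMap.comp_apply,
    LinearEquiv.coe_coe, h.left.coact_α]
  generalize ρB w = s
  induction s using TensorProduct.induction_on with
  | zero => simp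
  | add x y hx hy => simp only [TensorProduct.add_tmul, map_add, hx, hy]
  | tmul x b => simp

/-- The comodule over the smash coproduct given by a pair of comodule structures. -/
lemma isRightComodule (h : IsPairComodule B D φ αU ρB ρD) (hφ : IsCotwistor B D φ) :
    IsRightComodule (smashCoalgebra hφ) αU (iterCoact ρB ρD D.α ∘ₗ αU.symm.toLinearMap) where
  coact_coact u := by
    obtain ⟨u, rfl⟩ := αU.surjective u
    rw [LinearMap.comp_apply, LinearEquiv.coe_coe, LinearEquiv.symm_apply_apply]
    exact (h.map_comul_iterCoact u).trans (h.map_iterCoact u).symm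
  coact_counit u := by
    change TensorProduct.rid K U ((B.counit ∘ₗ smashFst D).lTensor U _) = _
    rw [LinearMap.lTensor_comp_apply, LinearMap.comp_apply, h.fst_iterCoact, LinearEquiv.coe_coe,
      LinearEquiv.apply_symm_apply, h.left.coact_counit]

end IsPairComodule

end PairComodule

/-! ### Tensor products of comodules -/

section TensorCoact

variable {K : Type u} [Field K]
variable {VB U V W : Type u} [AddCommGroup VB] [Module K VB]
  [AddCommGroup U] [Module K U] [AddCommGroup V] [Module K V] [AddCommGroup W] [Module K W]

/-- `x ⊗ y ↦ α^i(x) α^j(y)` -/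
abbrev HomAlgebra.twistMul (B : HomAlgebra K VB) (i j : ℤ) : VB →ₗ[K] VB →ₗ[K] VB :=
  B.mul.compl₁₂ (B.α ^ i).toLinearMap (B.α ^ j).toLinearMap

/-- `u ⊗ v ↦ u₀ ⊗ v₀ ⊗ α^i(u₁) α^j(v₁)` -/
def tensorCoact (B : HomAlgebra K VB) (i j : ℤ) (ρU : U →ₗ[K] U ⊗[K] VB)
    (ρV : V →ₗ[K] V ⊗[K] VB) : U ⊗[K] V →ₗ[K] (U ⊗[K] V) ⊗[K] VB :=
  (TensorProduct.lift (B.twistMul i j)).lTensor (U ⊗[K] V) ∘ₗ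
    (TensorProduct.tensorTensorTensorComm K U VB V VB).toLinearMap ∘ₗ TensorProduct.map ρU ρV

lemma tensorCoact_tmul (B : HomAlgebra K VB) (i j : ℤ) (ρU : U →ₗ[K] U ⊗[K] VB)
    (ρV : V →ₗ[K] V ⊗[K] VB) (u : U) (v : V) : tensorCoact B i j ρU ρV (u ⊗ₜ v) =
      TensorProduct.map₂ (TensorProduct.mk K U V) (B.twistMul i j) (ρU u) (ρV v) := by
  rw [map₂_eq_map_tensorTensorTensorComm, TensorProduct.lift_mk]
  rfl

lemma HomAlgebra.α_twistMul (B : HomAlgebra K VB) (i j : ℤ) (x y : VB) :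
    B.α (B.twistMul i j x y) = B.twistMul i j (B.α x) (B.α y) := by
  have h : ∀ n : ℤ, (B.α ^ n) (B.α x) = B.α ((B.α ^ n) x) := fun n =>
    (zpow_intertwine (f := B.α.toLinearMap) (fun _ => rfl) n x).symm
  have h' : ∀ n : ℤ, (B.α ^ n) (B.α y) = B.α ((B.α ^ n) y) := fun n =>
    (zpow_intertwine (f := B.α.toLinearMap) (fun _ => rfl) n y).symm
  simp [B.α_mul, h, h']

lemma HomBialgebra.comul_twistMul (B : HomBialgebra K VB) (i j : ℤ) (x y : VB) :
    B.comul (B.twistMul i j x y) =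
      TensorProduct.map₂ (B.twistMul i j) (B.twistMul i j) (B.comul x) (B.comul y) := by
  simp only [LinearMap.compl₁₂_apply, LinearEquiv.coe_coe, B.comul_mul, B.comul_α_zpow]
  have h := map_map₂ (K := K) (a := B.twistMul i j) (a' := B.mul) (b := B.twistMul i j)
    (b' := B.mul) (f := LinearMap.id) (g := LinearMap.id) (fun _ _ => rfl) (fun _ _ => rfl)
    (B.comul x) (B.comul y)
  rw [TensorProduct.map_id] at h
  exact h.symm

lemma HomBialgebra.counit_twistMul (B : HomBialgebra K VB) (i j : ℤ) (x y : VB) :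
    B.counit (B.twistMul i j x y) = B.counit x * B.counit y := by
  simp [B.counit_mul, B.counit_α_zpow]

/-- The source of the exponents i+1 and -j-1 in the associativity constraint: both sides become
(α^(2i)(x) α^(i+j)(y)) α^j(z), the left one after Hom-associativity moves an α from the first factor
to the last. -/
lemma HomAlgebra.twistMul_assoc (B : HomAlgebra K VB) (i j : ℤ) (x y z : VB) :
    B.twistMul i j ((B.α ^ (i + 1)) x) (B.twistMul i j y ((B.α ^ (-j - 1)) z)) =
      B.twistMul i j (B.twistMul i j x y) z := by
  have e1 : (B.α ^ j) z = B.α ((B.α ^ (j - 1)) z) := by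
    rw [← LinearEquiv.mul_apply, ← zpow_one_add, add_sub_cancel]
  simp only [LinearMap.compl₁₂_apply, LinearEquiv.coe_coe, B.α_zpow_mul, ← LinearEquiv.mul_apply,
    ← zpow_add]
  rw [e1, ← B.mul_assoc, ← LinearEquiv.mul_apply, ← zpow_one_add]
  rw [show 1 + (i + i) = i + (i + 1) by ring, show j + (j + (-j - 1)) = j - 1 by ring, add_comm j i]

variable {B : HomBialgebra K VB} {αU : U ≃ₗ[K] U} {αV : V ≃ₗ[K] V} {ρU : U →ₗ[K] U ⊗[K] VB}
  {ρV : V →ₗ[K] V ⊗[K] VB}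

/-- The twisted product commutes with α, with the coproducts and with the counits, so it carries the
axioms of the two factors to their tensor product. -/
lemma IsRightComodule.tensor (hU : IsRightComodule B.toHomCoalgebra αU ρU)
    (hV : IsRightComodule B.toHomCoalgebra αV ρV) (i j : ℤ) :
    IsRightComodule B.toHomCoalgebra (TensorProduct.congr αU αV)
      (tensorCoact B.toHomAlgebra i j ρU ρV) where
  coact_coact t := by
    induction t using TensorProduct.induction_on with
    | zero => simp
    | add x y hx hy => simp only [map_add, hx, hy]
    | tmul u v =>
    rw [tensorCoact_tmul, map_map₂ (a' := TensorProduct.mk K U V)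
      (f₁ := αU.toLinearMap) (f₂ := αV.toLinearMap) (fun x y => by simp) (B.comul_twistMul i j),
      map_map₂ (f₁ := ρU) (f₂ := ρV) (fun x y => tensorCoact_tmul _ i j ρU ρV x y)
      (B.α_twistMul i j), assoc_map₂, hU.coact_coact, hV.coact_coact]
  coact_counit t := by
    induction t using TensorProduct.induction_on with
    | zero => simp
    | add x y hx hy => simp only [map_add, hx, hy]
    | tmul u v =>
    rw [tensorCoact_tmul, rid_lTensor_map₂ (B.counit_twistMul i j), hU.coact_counit,
      hV.coact_counit]
    rfl

lemma isRightComodule_unit (B : HomBialgebra K VB) : IsRightComodule B.toHomCoalgebra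
    (LinearEquiv.refl K K) ((TensorProduct.mk K K VB).flip B.one) where
  coact_coact u := by simp [B.comul_one, B.α_one]
  coact_counit u := by simp [B.counit_one]

end TensorCoact

/-! ### The monoidal category of spaces with automorphism -/

namespace HomObject

variable {K : Type u} [Field K] (i j : ℤ)

lemma associator_tmul (X Y Z : HomObject K) (x : X.carrier) (y : Y.carrier) (z : Z.carrier) :
    associator i j X Y Z ((x ⊗ₜ y) ⊗ₜ z) =
      (X.α ^ (i + 1)) x ⊗ₜ (y ⊗ₜ (Z.α ^ (-j - 1)) z) := by
  simp [associator]

lemma leftUnitor_tmul (X : HomObject K) (c : K) (x : X.carrier) :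
    leftUnitor j X (c ⊗ₜ x) = c • (X.α ^ (j + 1)) x := by simp [leftUnitor]

lemma rightUnitor_tmul (X : HomObject K) (c : K) (x : X.carrier) :
    rightUnitor i X (x ⊗ₜ c) = c • (X.α ^ (i + 1)) x := by simp [rightUnitor]

variable {X Y Z X' Y' Z' : HomObject K}

/-- The constraint leaves the middle factor alone, so only the outer two maps have to commute with
α. -/
lemma associator_naturality {f : X.carrier →ₗ[K] X'.carrier} {g : Y.carrier →ₗ[K] Y'.carrier}
    {h : Z.carrier →ₗ[K] Z'.carrier} (hf : ∀ x, f (X.α x) = X'.α (f x))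
    (hh : ∀ z, h (Z.α z) = Z'.α (h z)) :
    (associator i j X' Y' Z').toLinearMap ∘ₗ TensorProduct.map (TensorProduct.map f g) h =
      TensorProduct.map f (TensorProduct.map g h) ∘ₗ (associator i j X Y Z).toLinearMap := by
  apply TensorProduct.ext_threefold
  intro x y z
  simp [associator_tmul, zpow_intertwine hf, zpow_intertwine hh]

lemma leftUnitor_naturality {f : X.carrier →ₗ[K] X'.carrier} (hf : ∀ x, f (X.α x) = X'.α (f x)) :
    (leftUnitor j X').toLinearMap ∘ₗ TensorProduct.map LinearMap.id f =
      f ∘ₗ (leftUnitor j X).toLinearMap := by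
  apply TensorProduct.ext'
  intro c x
  simp [leftUnitor_tmul, zpow_intertwine hf]

lemma rightUnitor_naturality {f : X.carrier →ₗ[K] X'.carrier}
    (hf : ∀ x, f (X.α x) = X'.α (f x)) :
    (rightUnitor i X').toLinearMap ∘ₗ TensorProduct.map f LinearMap.id =
      f ∘ₗ (rightUnitor i X).toLinearMap := by
  apply TensorProduct.ext'
  intro x c
  simp [rightUnitor_tmul, zpow_intertwine hf]

/-- Each route applies `a` twice, `b` and `c` once, and `d` twice, so the automorphisms may be
arbitrary. The pentagon follows because powers of α ⊗ α are computed factorwise. -/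
lemma pentagon_aux {W X Y Z : Type u} [AddCommGroup W] [Module K W] [AddCommGroup X] [Module K X]
    [AddCommGroup Y] [Module K Y] [AddCommGroup Z] [Module K Z]
    (a : W ≃ₗ[K] W) (b : X ≃ₗ[K] X) (c : Y ≃ₗ[K] Y) (d : Z ≃ₗ[K] Z) :
    TensorProduct.map LinearMap.id (TensorProduct.assoc K X Y Z ≪≫ₗ
        TensorProduct.congr b (TensorProduct.congr (LinearEquiv.refl K Y) d)).toLinearMap ∘ₗ
      (TensorProduct.assoc K W (X ⊗[K] Y) Z ≪≫ₗ
        TensorProduct.congr a (TensorProduct.congr (LinearEquiv.refl K _) d)).toLinearMap ∘ₗ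
      TensorProduct.map (TensorProduct.assoc K W X Y ≪≫ₗ
        TensorProduct.congr a (TensorProduct.congr (LinearEquiv.refl K X) c)).toLinearMap
          LinearMap.id =
    (TensorProduct.assoc K W X (Y ⊗[K] Z) ≪≫ₗ TensorProduct.congr a
        (TensorProduct.congr (LinearEquiv.refl K X) (TensorProduct.congr c d))).toLinearMap ∘ₗ
      (TensorProduct.assoc K (W ⊗[K] X) Y Z ≪≫ₗ TensorProduct.congr (TensorProduct.congr a b)
        (TensorProduct.congr (LinearEquiv.refl K Y) d)).toLinearMap := by
  apply TensorProduct.ext_fourfold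
  intro w x y z
  simp

lemma pentagon (W X Y Z : HomObject K) :
    TensorProduct.map LinearMap.id (associator i j X Y Z).toLinearMap ∘ₗ
      (associator i j W (X.tensor Y) Z).toLinearMap ∘ₗ
        TensorProduct.map (associator i j W X Y).toLinearMap LinearMap.id =
    (associator i j W X (Y.tensor Z)).toLinearMap ∘ₗ
      (associator i j (W.tensor X) Y Z).toLinearMap := by
  have h := pentagon_aux (W.α ^ (i + 1)) (X.α ^ (i + 1)) (Y.α ^ (-j - 1)) (Z.α ^ (-j - 1))
  rw [← TensorProduct.congr_zpow, ← TensorProduct.congr_zpow] at h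
  exact h

/-- The hypothesis on `d` and `e` reflects the cancellation of the exponent -j-1 of the associator
with j+1 of the left unitor. -/
lemma triangle_aux {X Y : Type u} [AddCommGroup X] [Module K X]
    [AddCommGroup Y] [Module K Y] (a : X ≃ₗ[K] X) {d e : Y ≃ₗ[K] Y} (h : d.trans e = .refl K Y) :
    TensorProduct.map LinearMap.id (TensorProduct.lid K Y ≪≫ₗ e).toLinearMap ∘ₗ
      (TensorProduct.assoc K X K Y ≪≫ₗ
        TensorProduct.congr a (TensorProduct.congr (LinearEquiv.refl K K) d)).toLinearMap =
    TensorProduct.map (TensorProduct.rid K X ≪≫ₗ a).toLinearMap LinearMap.id := by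
  apply TensorProduct.ext_threefold
  intro x c y
  have := LinearEquiv.congr_fun h y
  simp only [LinearEquiv.trans_apply, LinearEquiv.refl_apply] at this
  simp [this, TensorProduct.smul_tmul]

lemma triangle (X Y : HomObject K) :
    TensorProduct.map LinearMap.id (leftUnitor j Y).toLinearMap ∘ₗ
      (associator i j X (unit K) Y).toLinearMap =
    TensorProduct.map (rightUnitor i X).toLinearMap LinearMap.id := by
  refine triangle_aux (X.α ^ (i + 1)) (LinearEquiv.ext fun y => ?_)
  rw [LinearEquiv.trans_apply, ← LinearEquiv.mul_apply, ← zpow_add]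
  simp

end HomObject

/-! ### Colinearity of tensor products of maps and of the constraints. -/

section TensorCoact

variable {K : Type u} [Field K]
variable {VB U V W U' V' : Type u} [AddCommGroup VB] [Module K VB]
  [AddCommGroup U] [Module K U] [AddCommGroup V] [Module K V] [AddCommGroup W] [Module K W]
  [AddCommGroup U'] [Module K U'] [AddCommGroup V'] [Module K V']
  {ρU : U →ₗ[K] U ⊗[K] VB} {ρV : V →ₗ[K] V ⊗[K] VB} {ρW : W →ₗ[K] W ⊗[K] VB}

lemma tensorCoact_map (B : HomAlgebra K VB) (i j : ℤ) {ρU' : U' →ₗ[K] U' ⊗[K] VB}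
    {ρV' : V' →ₗ[K] V' ⊗[K] VB} {f : U →ₗ[K] U'} {g : V →ₗ[K] V'}
    (hf : ∀ u, ρU' (f u) = f.rTensor VB (ρU u)) (hg : ∀ v, ρV' (g v) = g.rTensor VB (ρV v))
    (t : U ⊗[K] V) : tensorCoact B i j ρU' ρV' (TensorProduct.map f g t) =
      (TensorProduct.map f g).rTensor VB (tensorCoact B i j ρU ρV t) := by
  induction t using TensorProduct.induction_on with
  | zero => simp
  | add x y hx hy => simp only [map_add, hx, hy]
  | tmul x y =>
    rw [TensorProduct.map_tmul, tensorCoact_tmul, tensorCoact_tmul, hf, hg]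
    exact (map_map₂ (a' := TensorProduct.mk K U' V') (b' := B.twistMul i j) (f₁ := f) (f₂ := g)
      (f := TensorProduct.map f g) (g := LinearMap.id) (g₁ := LinearMap.id) (g₂ := LinearMap.id)
      (fun _ _ => rfl) (fun _ _ => rfl) (ρU x) (ρV y)).symm

lemma tensorCoact_assoc {B : HomBialgebra K VB} (i j : ℤ) {αU : U ≃ₗ[K] U} {αW : W ≃ₗ[K] W}
    (hU : IsRightComodule B.toHomCoalgebra αU ρU) (hW : IsRightComodule B.toHomCoalgebra αW ρW)
    (ρV : V →ₗ[K] V ⊗[K] VB) :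
    let e := TensorProduct.assoc K U V W ≪≫ₗ TensorProduct.congr (αU ^ (i + 1))
      (TensorProduct.congr (LinearEquiv.refl K V) (αW ^ (-j - 1)))
    ∀ t, tensorCoact B.toHomAlgebra i j ρU (tensorCoact B.toHomAlgebra i j ρV ρW) (e t) =
      e.toLinearMap.rTensor VB
        (tensorCoact B.toHomAlgebra i j (tensorCoact B.toHomAlgebra i j ρU ρV) ρW t) := by
  intro e
  have he : ∀ x y z, e ((x ⊗ₜ y) ⊗ₜ z) = (αU ^ (i + 1)) x ⊗ₜ (y ⊗ₜ (αW ^ (-j - 1)) z) := by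
    simp [e]
  have key : ∀ (p : U ⊗[K] VB) (q : V ⊗[K] VB) (r : W ⊗[K] VB),
      TensorProduct.map₂ (TensorProduct.mk K U (V ⊗[K] W)) (B.twistMul i j)
        (TensorProduct.map (αU ^ (i + 1)).toLinearMap (B.α ^ (i + 1)).toLinearMap p)
        (TensorProduct.map₂ (TensorProduct.mk K V W) (B.twistMul i j) q
          (TensorProduct.map (αW ^ (-j - 1)).toLinearMap (B.α ^ (-j - 1)).toLinearMap r)) =
      e.toLinearMap.rTensor VB
        (TensorProduct.map₂ (TensorProduct.mk K (U ⊗[K] V) W)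
          (B.twistMul i j) (TensorProduct.map₂ (TensorProduct.mk K U V)
            (B.twistMul i j) p q) r) := by
    intro p q r
    induction p using TensorProduct.induction_on with
    | zero => simp
    | add x y hx hy => simp only [map_add, LinearMap.add_apply, hx, hy]
    | tmul x a =>
    induction q using TensorProduct.induction_on with
    | zero => simp
    | add x y hx hy => simp only [map_add, LinearMap.add_apply, hx, hy]
    | tmul y b =>
    induction r using TensorProduct.induction_on with
    | zero => simp
    | add x y hx hy => simp only [map_add, hx, hy]
    | tmul z c =>
    simp only [TensorProduct.map_tmul, TensorProduct.map₂_apply_tmul, LinearMap.rTensor_tmul,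
      LinearEquiv.coe_coe, TensorProduct.mk_apply, he]
    rw [B.twistMul_assoc]
  apply LinearMap.congr_fun (f := tensorCoact B.toHomAlgebra i j ρU
    (tensorCoact B.toHomAlgebra i j ρV ρW) ∘ₗ e.toLinearMap) (g := e.toLinearMap.rTensor VB ∘ₗ
      tensorCoact B.toHomAlgebra i j (tensorCoact B.toHomAlgebra i j ρU ρV) ρW)
  apply TensorProduct.ext_threefold
  intro x y z
  simp only [LinearMap.comp_apply, LinearEquiv.coe_coe, he, tensorCoact_tmul, hU.coact_α_zpow,
    hW.coact_α_zpow, key]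

/-- Multiplication by 1 is α, so 1 · α^j(b) = α^(j+1)(b), which dictates the exponent of the unitor;
`tensorCoact_rid` likewise dictates i+1. -/
lemma tensorCoact_lid {B : HomBialgebra K VB} (i j : ℤ) {αU : U ≃ₗ[K] U}
    (hU : IsRightComodule B.toHomCoalgebra αU ρU) (t : K ⊗[K] U) :
    ρU ((TensorProduct.lid K U ≪≫ₗ (αU ^ (j + 1))) t) =
      (TensorProduct.lid K U ≪≫ₗ (αU ^ (j + 1))).toLinearMap.rTensor VB
        (tensorCoact B.toHomAlgebra i j ((TensorProduct.mk K K VB).flip B.one) ρU t) := by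
  induction t using TensorProduct.induction_on with
  | zero => simp
  | add x y hx hy => simp only [map_add, hx, hy]
  | tmul c x =>
  rw [tensorCoact_tmul, LinearEquiv.trans_apply, TensorProduct.lid_tmul, map_smul, map_smul,
    hU.coact_α_zpow]
  generalize ρU x = p
  induction p using TensorProduct.induction_on with
  | zero => simp
  | add x y hx hy => simp only [map_add, smul_add, hx, hy]
  | tmul x b =>
    have e : (B.α ^ (j + 1)) b = B.α ((B.α ^ j) b) := by
      rw [← LinearEquiv.mul_apply, ← zpow_one_add, add_comm]
    simp [B.α_zpow_one, B.one_mul, e, TensorProduct.smul_tmul']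

lemma tensorCoact_rid {B : HomBialgebra K VB} (i j : ℤ) {αU : U ≃ₗ[K] U}
    (hU : IsRightComodule B.toHomCoalgebra αU ρU) (t : U ⊗[K] K) :
    ρU ((TensorProduct.rid K U ≪≫ₗ (αU ^ (i + 1))) t) =
      (TensorProduct.rid K U ≪≫ₗ (αU ^ (i + 1))).toLinearMap.rTensor VB
        (tensorCoact B.toHomAlgebra i j ρU ((TensorProduct.mk K K VB).flip B.one) t) := by
  induction t using TensorProduct.induction_on with
  | zero => simp
  | add x y hx hy => simp only [map_add, hx, hy]
  | tmul x c =>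
  rw [tensorCoact_tmul, LinearEquiv.trans_apply, TensorProduct.rid_tmul, map_smul, map_smul,
    hU.coact_α_zpow]
  generalize ρU x = p
  induction p using TensorProduct.induction_on with
  | zero => simp
  | add x y hx hy => simp only [map_add, LinearMap.add_apply, smul_add, hx, hy]
  | tmul x b =>
    have e : (B.α ^ (i + 1)) b = B.α ((B.α ^ i) b) := by
      rw [← LinearEquiv.mul_apply, ← zpow_one_add, add_comm]
    simp [B.α_zpow_one, B.mul_one, e, TensorProduct.smul_tmul']

end TensorCoact

/-! ### The monoidal category of comodules over an arbitrary Hom-bialgebra. -/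

section Corep

variable {K : Type u} [Field K]
variable {VB : Type u} [AddCommGroup VB] [Module K VB]

lemma corepTensorData (B : HomBialgebra K VB) (i j : ℤ) : CorepTensorData B i j where
  tensorObj X Y := X.isRightComodule.tensor Y.isRightComodule i j
  tensorUnit := isRightComodule_unit B
  tensorHom f g := tensorCoact_map B.toHomAlgebra i j f.isHom g.isHom
  associator X Y Z := tensorCoact_assoc i j X.isRightComodule Z.isRightComodule Y.coact
  leftUnitor X := tensorCoact_lid (K := K) i j X.isRightComodule
  rightUnitor X := tensorCoact_rid (K := K) i j X.isRightComodule

/-- Colinear maps commute with the structure maps. -/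
lemma IsRightComodule.map_α {C : HomCoalgebra K VB} {U V : Type u} [AddCommGroup U] [Module K U]
    [AddCommGroup V] [Module K V] {αU : U ≃ₗ[K] U} {αV : V ≃ₗ[K] V} {ρU : U →ₗ[K] U ⊗[K] VB}
    {ρV : V →ₗ[K] V ⊗[K] VB} (hU : IsRightComodule C αU ρU) (hV : IsRightComodule C αV ρV)
    {f : U →ₗ[K] V} (hf : ∀ u, ρV (f u) = f.rTensor VB (ρU u)) (u : U) :
    f (αU u) = αV (f u) := by
  rw [← hU.coact_counit, ← hV.coact_counit, hf]
  generalize ρU u = t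
  induction t using TensorProduct.induction_on with
  | zero => simp
  | add x y hx hy => simp only [map_add, hx, hy]
  | tmul x b => simp

namespace Corep

/-- The monoidal category `Corep^{i,j}(B)`. -/
abbrev monoidalCategory {B : HomBialgebra K VB} {i j : ℤ} (h : CorepTensorData B i j) :
    MonoidalCategory (Corep B.toHomCoalgebra) :=
  { toMonoidalCategoryStruct := h.struct
    tensorHom_def := fun _ _ => Hom.ext (TensorProduct.ext' fun _ _ => rfl)
    id_tensorHom_id := fun _ _ => Hom.ext (TensorProduct.ext' fun _ _ => rfl)
    tensorHom_comp_tensorHom := fun _ _ _ _ => Hom.ext (TensorProduct.ext' fun _ _ => rfl)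
    whiskerLeft_id := fun _ _ => Hom.ext (TensorProduct.ext' fun _ _ => rfl)
    id_whiskerRight := fun _ _ => Hom.ext (TensorProduct.ext' fun _ _ => rfl)
    associator_naturality := fun {X₁ _ X₃ Y₁ _ Y₃} f _ h => Hom.ext
      (HomObject.associator_naturality i j
        (X₁.isRightComodule.map_α Y₁.isRightComodule f.isHom)
        (X₃.isRightComodule.map_α Y₃.isRightComodule h.isHom))
    leftUnitor_naturality := fun {X Y} f => Hom.ext (HomObject.leftUnitor_naturality j
      (X.isRightComodule.map_α Y.isRightComodule f.isHom))
    rightUnitor_naturality := fun {X Y} f => Hom.ext (HomObject.rightUnitor_naturality i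
      (X.isRightComodule.map_α Y.isRightComodule f.isHom))
    pentagon := fun W X Y Z => Hom.ext (HomObject.pentagon i j W.toHomObject X.toHomObject
      Y.toHomObject Z.toHomObject)
    triangle := fun X Y => Hom.ext (HomObject.triangle i j X.toHomObject Y.toHomObject) }

end Corep

end Corep

/-! ### Entwining maps and cotwistors -/

section Pairing

variable {K : Type u} [Field K]
variable {VA V W W' : Type u} [AddCommGroup VA] [Module K VA] [AddCommGroup V] [Module K V]
  [AddCommMonoid W] [Module K W] [AddCommMonoid W'] [Module K W']

/-- `w ⊗ f ↦ f(a) w` -/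
def evalAt (a : VA) : W ⊗[K] Module.Dual K VA →ₗ[K] W :=
  (TensorProduct.rid K W).toLinearMap ∘ₗ (Module.Dual.eval K VA a).lTensor W

/-- `v ⊗ w ↦ f(v) w` -/
def pairLeft (f : Module.Dual K V) : V ⊗[K] W →ₗ[K] W :=
  (TensorProduct.lid K W).toLinearMap ∘ₗ f.rTensor W

@[simp]
lemma evalAt_tmul (a : VA) (w : W) (f : Module.Dual K VA) : evalAt a (w ⊗ₜ[K] f) = f a • w := by
  simp [evalAt]

@[simp]
lemma pairLeft_tmul (f : Module.Dual K V) (v : V) (w : W) :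
    pairLeft f (v ⊗ₜ[K] w) = f v • w := by
  simp [pairLeft]

lemma evalAt_eq_dualTensorHom (a : VA) (s : W ⊗[K] Module.Dual K VA) :
    evalAt a s = dualTensorHom K VA W (TensorProduct.comm K _ _ s) a := by
  induction s using TensorProduct.induction_on with
  | zero => simp
  | add x y hx hy => simp only [map_add, LinearMap.add_apply, hx, hy]
  | tmul w f => simp

/-- `evalAt` as a linear map in the point of evaluation. -/
def evalHom (s : W ⊗[K] Module.Dual K VA) : VA →ₗ[K] W :=
  dualTensorHom K VA W (TensorProduct.comm K _ _ s)

lemma evalHom_apply (s : W ⊗[K] Module.Dual K VA) (a : VA) : evalHom s a = evalAt a s :=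
  (evalAt_eq_dualTensorHom a s).symm

lemma tensor_dual_ext [Module.Finite K VA] {s t : W ⊗[K] Module.Dual K VA}
    (h : ∀ a, evalAt a s = evalAt a t) : s = t := by
  apply (TensorProduct.comm K _ _).injective
  apply (dualTensorHomEquiv K VA W).injective
  refine LinearMap.ext fun a => ?_
  have h1 := h a
  rw [evalAt_eq_dualTensorHom, evalAt_eq_dualTensorHom] at h1
  exact h1

/-- Coordinate functionals of a basis of `V` suffice, so `V` may have any dimension. -/
lemma pairLeft_ext {s t : V ⊗[K] W} (h : ∀ f, pairLeft f s = pairLeft f t) : s = t := by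
  classical
  let b := Module.Basis.ofVectorSpace K V
  apply (TensorProduct.equivFinsuppOfBasisLeft b).injective
  ext i
  rw [TensorProduct.equivFinsuppOfBasisLeft_apply, TensorProduct.equivFinsuppOfBasisLeft_apply]
  exact h (b.coord i)

/-- In finite dimension every functional on the tensor square is a sum of functionals f ⊗ g. -/
lemma pairLeft_dualDistrib_ext [Module.Finite K VA] {s t : (VA ⊗[K] VA) ⊗[K] W}
    (h : ∀ f g, pairLeft (TensorProduct.dualDistrib K VA VA (f ⊗ₜ g)) s =
      pairLeft (TensorProduct.dualDistrib K VA VA (f ⊗ₜ g)) t) : s = t := by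
  refine pairLeft_ext fun f => ?_
  obtain ⟨p, rfl⟩ := (TensorProduct.dualDistribEquiv K VA VA).surjective f
  change pairLeft (TensorProduct.dualDistrib K VA VA p) s =
    pairLeft (TensorProduct.dualDistrib K VA VA p) t
  induction p using TensorProduct.induction_on with
  | zero => simp [pairLeft]
  | add x y hx hy =>
    simp only [pairLeft, map_add, LinearMap.rTensor_add, LinearMap.comp_add,
      LinearMap.add_apply] at hx hy ⊢
    rw [hx, hy]
  | tmul f g => exact h f g

lemma evalAt_map (a : VA) (g : W →ₗ[K] W') (h : VA →ₗ[K] VA) (s : W ⊗[K] Module.Dual K VA) :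
    evalAt a (TensorProduct.map g h.dualMap s) = g (evalAt (h a) s) := by
  induction s using TensorProduct.induction_on with
  | zero => simp
  | add x y hx hy => simp only [map_add, hx, hy]
  | tmul w f => simp

lemma evalAt_rTensor (a : VA) (g : W →ₗ[K] W') (s : W ⊗[K] Module.Dual K VA) :
    evalAt a (g.rTensor (Module.Dual K VA) s) = g (evalAt a s) := by
  induction s using TensorProduct.induction_on with
  | zero => simp
  | add x y hx hy => simp only [map_add, hx, hy]
  | tmul w f => simp

lemma pairLeft_map {V' : Type u} [AddCommGroup V'] [Module K V'] (f : Module.Dual K V')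
    (g : V →ₗ[K] V') (h : W →ₗ[K] W') (t : V ⊗[K] W) :
    pairLeft f (TensorProduct.map g h t) = h (pairLeft (f ∘ₗ g) t) := by
  induction t using TensorProduct.induction_on with
  | zero => simp
  | add x y hx hy => simp only [map_add, hx, hy]
  | tmul w f => simp

end Pairing

/-! ### Transposition of entwinings into cotwistors. -/

section Cotwistor

variable {K : Type u} [Field K]
variable {VA VC : Type u} [AddCommGroup VA] [Module K VA] [AddCommGroup VC] [Module K VC]
  {Φ : VC ⊗[K] VA →ₗ[K] VA ⊗[K] VC}

lemma evalAt_map₂ {A : HomBialgebra K VA} {C : HomBialgebra K VC} (a : VA)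
    (s t : VC ⊗[K] Module.Dual K VA) :
    evalAt a (TensorProduct.map₂ C.mul (dualMul A.toHomCoalgebra) s t) =
      TensorProduct.lift C.mul (TensorProduct.map (evalHom s) (evalHom t)
        (TensorProduct.map (A.α ^ (-2 : ℤ)).toLinearMap (A.α ^ (-2 : ℤ)).toLinearMap
          (A.comul a))) := by
  induction s using TensorProduct.induction_on with
  | zero => simp [evalHom]
  | add x y hx hy =>
    have : evalHom (x + y) = evalHom x + evalHom y := by simp [evalHom]
    simp only [map_add, LinearMap.add_apply, hx, hy, this, TensorProduct.map_add_left]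
  | tmul c f =>
  induction t using TensorProduct.induction_on with
  | zero => simp [evalHom]
  | add x y hx hy =>
    have : evalHom (x + y) = evalHom x + evalHom y := by simp [evalHom]
    simp only [map_add, LinearMap.add_apply, hx, hy, this, TensorProduct.map_add_right]
  | tmul d g =>
  rw [TensorProduct.map₂_apply_tmul, TensorProduct.map_tmul, evalAt_tmul, dualMul_apply]
  generalize TensorProduct.map (A.α ^ (-2 : ℤ)).toLinearMap (A.α ^ (-2 : ℤ)).toLinearMap
          (A.comul a) = p
  induction p using TensorProduct.induction_on with
  | zero => simp
  | add x y hx hy => simp only [map_add, add_smul, hx, hy]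
  | tmul x y => simp [evalHom, smul_smul, mul_comm]

namespace IsEntwining

variable {A : HomAlgebra K VA} {C : HomCoalgebra K VC}

lemma map_α_apply (h : IsEntwining C A Φ) (x : VC ⊗[K] VA) :
    Φ (TensorProduct.map C.α.toLinearMap A.α.toLinearMap x) =
      TensorProduct.map A.α.toLinearMap C.α.toLinearMap (Φ x) := by
  induction x using TensorProduct.induction_on with
  | zero => simp
  | add x y hx hy => simp only [map_add, hx, hy]
  | tmul b d => exact h.map_α b d

lemma map_α_zpow (h : IsEntwining C A Φ) (n : ℤ) (c : VC) (a : VA) :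
    Φ ((C.α ^ n) c ⊗ₜ (A.α ^ n) a) =
      TensorProduct.map (A.α ^ n).toLinearMap (C.α ^ n).toLinearMap (Φ (c ⊗ₜ a)) := by
  rw [← congr_zpow_tmul, zpow_intertwine (e' := TensorProduct.congr A.α C.α) h.map_α_apply,
    congr_zpow_apply]

end IsEntwining

variable [Module.Finite K VA]

/-- The basis-free description of φ as the transpose of Φ. Every later statement about φ is obtained
by evaluating at points of `A` and using this. -/
lemma evalAt_cotwistorOf (Φ : VC ⊗[K] VA →ₗ[K] VA ⊗[K] VC) (f : Module.Dual K VA) (c : VC)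
    (a : VA) : evalAt a (cotwistorOf Φ (f ⊗ₜ c)) = pairLeft f (Φ (c ⊗ₜ a)) := by
  change _ = (pairLeft f ∘ₗ Φ ∘ₗ TensorProduct.mk K VC VA c) a
  conv_rhs => rw [← (Module.finBasis K VA).sum_repr a, map_sum]
  simp [cotwistorOf, pairLeft]

namespace IsEntwining

section

variable {A : HomAlgebra K VA} {C : HomCoalgebra K VC}

/-- The second functional of `p` meets Φ first, so `y` passes through Φ before `x`. The flip on the
right records this reversal, which the opposite coproduct of A* undoes. -/
lemma evalAt_comul_left (Φ : VC ⊗[K] VA →ₗ[K] VA ⊗[K] VC)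
    (p : Module.Dual K VA ⊗[K] Module.Dual K VA) (c : VC) (x y : VA) :
    evalAt x (evalAt y ((TensorProduct.assoc K VC _ _).symm (TensorProduct.assoc K VC _ _
      ((cotwistorOf Φ).rTensor (Module.Dual K VA)
        ((TensorProduct.assoc K _ _ _).symm
        ((cotwistorOf Φ).lTensor (Module.Dual K VA)
          (TensorProduct.assoc K _ _ _ (p ⊗ₜ[K] c)))))))) =
      pairLeft (TensorProduct.dualDistrib K VA VA p ∘ₗ (TensorProduct.comm K VA VA).toLinearMap)
        ((TensorProduct.assoc K VA VA VC).symm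
          (Φ.lTensor VA (TensorProduct.assoc K VA VC VA (Φ (c ⊗ₜ[K] y) ⊗ₜ[K] x)))) := by
  rw [LinearEquiv.symm_apply_apply, evalAt_rTensor]
  induction p using TensorProduct.induction_on with
  | zero => simp [pairLeft]
  | add p q hp hq =>
    simp only [TensorProduct.add_tmul, map_add, hp, hq, pairLeft, LinearMap.add_comp,
      LinearMap.comp_add, LinearMap.rTensor_add, LinearMap.add_apply]
  | tmul f g =>
  have h1 : ∀ s : VC ⊗[K] Module.Dual K VA,
      evalAt y ((TensorProduct.assoc K _ _ _).symm (f ⊗ₜ[K] s)) = f ⊗ₜ[K] evalAt y s := by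
    intro s
    induction s using TensorProduct.induction_on with
    | zero => simp
    | add p q hp hq => simp only [TensorProduct.tmul_add, map_add, hp, hq]
    | tmul w f => simp
  rw [TensorProduct.assoc_tmul, LinearMap.lTensor_tmul, h1, evalAt_cotwistorOf,
    evalAt_cotwistorOf]
  generalize Φ (c ⊗ₜ y) = t
  induction t using TensorProduct.induction_on with
  | zero => simp
  | add p q hp hq => simp only [TensorProduct.add_tmul, map_add, hp, hq]
  | tmul y d =>
  rw [pairLeft_tmul, ← TensorProduct.smul_tmul', map_smul, map_smul, TensorProduct.assoc_tmul,
    LinearMap.lTensor_tmul]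
  generalize Φ (d ⊗ₜ x) = t
  induction t using TensorProduct.induction_on with
  | zero => simp
  | add p q hp hq => simp only [TensorProduct.tmul_add, map_add, smul_add, hp, hq]
  | tmul x d => simp [smul_smul, mul_comm]

lemma evalAt_comul_right (Φ : VC ⊗[K] VA →ₗ[K] VA ⊗[K] VC)
    (f : Module.Dual K VA) (q : VC ⊗[K] VC) (a : VA) :
    evalAt a ((TensorProduct.assoc K VC VC (Module.Dual K VA)).symm
      ((cotwistorOf Φ).lTensor VC (TensorProduct.assoc K VC _ VC
        ((cotwistorOf Φ).rTensor VC ((TensorProduct.assoc K _ VC VC).symm (f ⊗ₜ[K] q)))))) =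
      pairLeft f (TensorProduct.assoc K VA VC VC
        (Φ.rTensor VC ((TensorProduct.assoc K VC VA VC).symm
          (Φ.lTensor VC (TensorProduct.assoc K VC VC VA (q ⊗ₜ[K] a)))))) := by
  induction q using TensorProduct.induction_on with
  | zero => simp
  | add p q hp hq =>
    simp only [TensorProduct.add_tmul, TensorProduct.tmul_add, map_add, hp, hq]
  | tmul c d =>
  have h1 : ∀ s : VC ⊗[K] Module.Dual K VA,
      evalAt a ((TensorProduct.assoc K VC VC (Module.Dual K VA)).symm
        ((cotwistorOf Φ).lTensor VC (TensorProduct.assoc K VC _ VC (s ⊗ₜ d)))) =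
      (evalHom s).rTensor VC (Φ (d ⊗ₜ a)) := by
    intro s
    induction s using TensorProduct.induction_on with
    | zero => simp [evalHom]
    | add p q hp hq =>
      have : evalHom (p + q) = evalHom p + evalHom q := by simp [evalHom]
      simp only [TensorProduct.add_tmul, map_add, hp, hq, this, LinearMap.rTensor_add,
        LinearMap.add_apply]
    | tmul x g =>
    have h2 : ∀ t : VC ⊗[K] Module.Dual K VA,
        evalAt a ((TensorProduct.assoc K VC VC (Module.Dual K VA)).symm (x ⊗ₜ t)) =
        x ⊗ₜ evalAt a t := by
      intro s
      induction s using TensorProduct.induction_on with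
      | zero => simp
      | add p q hp hq => simp only [TensorProduct.tmul_add, map_add, hp, hq]
      | tmul w f => simp
    rw [TensorProduct.assoc_tmul, LinearMap.lTensor_tmul, h2, evalAt_cotwistorOf]
    generalize Φ (d ⊗ₜ a) = t
    induction t using TensorProduct.induction_on with
    | zero => simp
    | add p q hp hq => simp only [TensorProduct.tmul_add, map_add, hp, hq]
    | tmul w f => simp [evalHom, TensorProduct.smul_tmul]
  rw [TensorProduct.assoc_symm_tmul, LinearMap.rTensor_tmul, h1, TensorProduct.assoc_tmul,
    LinearMap.lTensor_tmul]
  generalize Φ (d ⊗ₜ a) = t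
  induction t using TensorProduct.induction_on with
  | zero => simp
  | add p q hp hq => simp only [TensorProduct.tmul_add, map_add, hp, hq]
  | tmul a d =>
  rw [LinearMap.rTensor_tmul, evalHom_apply, evalAt_cotwistorOf, TensorProduct.assoc_symm_tmul,
    LinearMap.rTensor_tmul]
  generalize Φ (c ⊗ₜ a) = t
  induction t using TensorProduct.induction_on with
  | zero => simp
  | add p q hp hq => simp only [TensorProduct.add_tmul, map_add, hp, hq]
  | tmul a c => simp [TensorProduct.smul_tmul']

/-- The axioms transpose one by one: (M1) is (E1), (M2) is (E2), (M3) is (E3) and (M4) is (E4). -/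
lemma isCotwistor (h : IsEntwining C A Φ) :
    IsCotwistor (dualCopCoalgebra A) C (cotwistorOf Φ) where
  map_α f c := by
    apply tensor_dual_ext
    intro a
    obtain ⟨a, rfl⟩ := A.α.surjective a
    rw [evalAt_cotwistorOf, h.map_α, pairLeft_map]
    refine Eq.trans ?_ (evalAt_map (A.α a) C.α.toLinearMap A.α.symm.toLinearMap _).symm
    rw [LinearEquiv.coe_coe, LinearEquiv.coe_coe, LinearEquiv.symm_apply_apply, evalAt_cotwistorOf]
    congr 2
    ext x
    simp [dualCopCoalgebra]
  comul_left f c := by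
    apply (TensorProduct.assoc K VC (Module.Dual K VA) (Module.Dual K VA)).symm.injective
    apply tensor_dual_ext
    intro y
    apply tensor_dual_ext
    intro x
    -- The extra α on the `C`-leg is the one in (E1).
    apply C.α.injective
    rw [evalAt_comul_left]
    have h1 : ∀ s : VC ⊗[K] Module.Dual K VA,
        evalAt x (evalAt y ((TensorProduct.assoc K VC _ _).symm
          (TensorProduct.map C.α.toLinearMap (dualCopComul A) s))) =
          C.α (evalAt ((A.α ^ (-2 : ℤ)) (A.mul y x)) s) := by
      intro s
      induction s using TensorProduct.induction_on with
      | zero => simp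
      | add p q hp hq => simp only [map_add, hp, hq]
      | tmul c g =>
        rw [evalAt_tmul, ← dualCopComul_apply, TensorProduct.map_tmul]
        generalize dualCopComul A g = p
        induction p using TensorProduct.induction_on with
        | zero => simp
        | add p q hp hq =>
          simp only [TensorProduct.tmul_add, map_add, LinearMap.add_apply, add_smul, hp, hq]
        | tmul f g => simp [smul_smul, mul_comm]
    have h2 : TensorProduct.dualDistrib K VA VA (dualCopComul A f) ∘ₗ
        (TensorProduct.comm K VA VA).toLinearMap =
        (f ∘ₗ (A.α ^ (-2 : ℤ)).toLinearMap) ∘ₗ TensorProduct.lift A.mul := by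
      apply TensorProduct.ext'
      intro x y
      simp [dualCopComul_apply]
    -- (E1) at α(c) produces Φ(α²(c) ⊗ yx). Extracting α² from both arguments leaves α⁻²(yx), in
    -- agreement with the α⁻² in the coproduct of A*.
    have h3 := h.mul (C.α c) y x
    have h4 := h.map_α_zpow 2 c ((A.α ^ (-2 : ℤ)) (A.mul y x))
    have e1 : (A.α ^ (2 : ℤ)) ((A.α ^ (-2 : ℤ)) (A.mul y x)) = A.mul y x := by
      rw [← LinearEquiv.mul_apply, ← zpow_add]; simp
    rw [e1] at h4
    refine Eq.trans (congrArg (fun z => C.α (pairLeft z _)) h2) ?_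
    refine (pairLeft_map (f ∘ₗ (A.α ^ (-2 : ℤ)).toLinearMap) (TensorProduct.lift A.mul)
      C.α.toLinearMap _).symm.trans ?_
    rw [h3]
    refine (congrArg (pairLeft _) h4).trans ?_
    rw [pairLeft_map]
    refine Eq.trans ?_ (congrArg C.α (h1 _)).symm
    rw [evalAt_cotwistorOf]
    refine congrArg (fun g => C.α (C.α (pairLeft g _))) ?_
    ext x
    simp
  comul_right f c := by
    apply tensor_dual_ext
    intro a
    obtain ⟨a, rfl⟩ := A.α.surjective a
    rw [evalAt_comul_right, h.comul, pairLeft_map]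
    refine Eq.trans ?_ (evalAt_map (A.α a) C.comul A.α.symm.toLinearMap _).symm
    rw [LinearEquiv.coe_coe, LinearEquiv.symm_apply_apply, evalAt_cotwistorOf]
    congr 2
    ext x
    simp [dualCopCoalgebra]
  counit_right f c := by
    ext a
    have h1 : ∀ s : VC ⊗[K] Module.Dual K VA,
        TensorProduct.lid K _ (C.counit.rTensor _ s) a = C.counit (evalAt a s) := by
      intro s
      induction s using TensorProduct.induction_on with
      | zero => simp
      | add p q hp hq => simp only [map_add, LinearMap.add_apply, hp, hq]
      | tmul x g => simp [mul_comm]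
    have h2 : ∀ t : VA ⊗[K] VC, C.counit (pairLeft f t) =
        f (TensorProduct.rid K VA (C.counit.lTensor VA t)) := by
      intro t
      induction t using TensorProduct.induction_on with
      | zero => simp
      | add p q hp hq => simp only [map_add, hp, hq]
      | tmul x g => simp [mul_comm]
    rw [h1, evalAt_cotwistorOf, h2, h.counit]
    simp
  counit_left f c := by
    refine (evalAt_cotwistorOf Φ f c A.one).trans ?_
    rw [h.one, pairLeft_tmul]
    rfl

end

variable {A : HomBialgebra K VA} {C : HomBialgebra K VC}

lemma lift_map_pairLeft (f g : Module.Dual K VA) (c d : VC) (p : VA ⊗[K] VA) :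
    TensorProduct.lift C.mul (TensorProduct.map (evalHom (cotwistorOf Φ (f ⊗ₜ c)))
      (evalHom (cotwistorOf Φ (g ⊗ₜ d))) p) =
    pairLeft (TensorProduct.dualDistrib K VA VA (f ⊗ₜ g))
      ((TensorProduct.lift C.mul).lTensor (VA ⊗[K] VA)
        (TensorProduct.tensorTensorTensorComm K VA VC VA VC
          (TensorProduct.map (Φ ∘ₗ TensorProduct.mk K VC VA c)
            (Φ ∘ₗ TensorProduct.mk K VC VA d) p))) := by
  induction p using TensorProduct.induction_on with
  | zero => simp
  | add x y hx hy => simp only [map_add, hx, hy]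
  | tmul a b =>
  simp only [TensorProduct.map_tmul, LinearMap.comp_apply, TensorProduct.mk_apply, evalHom_apply,
    evalAt_cotwistorOf]
  generalize Φ (c ⊗ₜ a) = s
  generalize Φ (d ⊗ₜ b) = t
  induction s using TensorProduct.induction_on with
  | zero => simp
  | add x y hx hy => simp only [map_add, TensorProduct.add_tmul, hx, hy]
  | tmul x c =>
  induction t using TensorProduct.induction_on with
  | zero => simp
  | add x y hx hy => simp only [map_add, TensorProduct.tmul_add, hx, hy]
  | tmul y d => simp [smul_smul, mul_comm]

/-- (E5) paired with f ⊗ g is (M5) for f, g, α²(c), α²(d) evaluated at α²(a); as α² is bijective,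
nothing is lost. (E6) is (M6) evaluated at a. -/
lemma isMonoidalEntwining_iff (h : IsEntwining C.toHomCoalgebra A.toHomAlgebra Φ) :
    IsMonoidalEntwining C A Φ ↔
      IsMonoidalCotwistor (dualCopBialgebra A) C (cotwistorOf Φ) := by
  have e1 : ∀ x : VA, (A.α ^ (-2 : ℤ)) ((A.α ^ (2 : ℤ)) x) = x := fun x => by
    rw [← LinearEquiv.mul_apply, ← zpow_add]; simp
  have e2 : ∀ x : VA, (A.α ^ (2 : ℤ)) ((A.α ^ (-2 : ℤ)) x) = x := fun x => by
    rw [← LinearEquiv.mul_apply, ← zpow_add]; simp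
  have e3 : ∀ x : VC, (C.α ^ (2 : ℤ)) ((C.α ^ (-2 : ℤ)) x) = x := fun x => by
    rw [← LinearEquiv.mul_apply, ← zpow_add]; simp
  have e4 : ∀ p : VA ⊗[K] VA,
      TensorProduct.map (A.α ^ (-2 : ℤ)).toLinearMap (A.α ^ (-2 : ℤ)).toLinearMap
        (TensorProduct.map (A.α ^ (2 : ℤ)).toLinearMap (A.α ^ (2 : ℤ)).toLinearMap p) = p := by
    intro p
    rw [TensorProduct.map_map]
    have : (A.α ^ (-2 : ℤ)).toLinearMap ∘ₗ (A.α ^ (2 : ℤ)).toLinearMap = LinearMap.id :=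
      LinearMap.ext e1
    rw [this, TensorProduct.map_id, LinearMap.id_apply]
  -- Evaluation at α²(a) cancels the α⁻² in the convolution product of A*.
  have hL : ∀ (f g : Module.Dual K VA) (c d : VC) (a : VA),
      evalAt ((A.α ^ (2 : ℤ)) a) (TensorProduct.map₂ C.mul (dualMul A.toHomCoalgebra)
        (cotwistorOf Φ (f ⊗ₜ (C.α ^ (2 : ℤ)) c)) (cotwistorOf Φ (g ⊗ₜ (C.α ^ (2 : ℤ)) d))) =
      pairLeft (TensorProduct.dualDistrib K VA VA (f ⊗ₜ g))
        ((TensorProduct.lift C.mul).lTensor (VA ⊗[K] VA)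
          (TensorProduct.tensorTensorTensorComm K VA VC VA VC
            (TensorProduct.map (Φ ∘ₗ TensorProduct.mk K VC VA ((C.α ^ (2 : ℤ)) c))
              (Φ ∘ₗ TensorProduct.mk K VC VA ((C.α ^ (2 : ℤ)) d)) (A.comul a)))) := by
    intro f g c d a
    rw [evalAt_map₂, A.comul_α_zpow, e4, lift_map_pairLeft]
  have hR : ∀ (f g : Module.Dual K VA) (c d : VC) (a : VA),
      evalAt ((A.α ^ (2 : ℤ)) a) (cotwistorOf Φ (dualMul A.toHomCoalgebra f g ⊗ₜ
        C.mul ((C.α ^ (2 : ℤ)) c) ((C.α ^ (2 : ℤ)) d))) =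
      pairLeft (TensorProduct.dualDistrib K VA VA (f ⊗ₜ g))
        (TensorProduct.map A.comul (C.α ^ (2 : ℤ)).toLinearMap (Φ (C.mul c d ⊗ₜ[K] a))) := by
    intro f g c d a
    rw [evalAt_cotwistorOf, ← C.α_zpow_mul, h.map_α_zpow, pairLeft_map, pairLeft_map]
    refine congrArg (fun z : Module.Dual K VA => (C.α ^ (2 : ℤ)).toLinearMap
      (pairLeft z (Φ (C.mul c d ⊗ₜ[K] a)))) (LinearMap.ext fun x => ?_)
    rw [LinearMap.comp_apply, LinearEquiv.coe_coe, dualMul_apply, A.comul_α_zpow, e4]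
    rfl
  constructor
  · intro hm
    refine ⟨h.isCotwistor, fun f g c d => ?_, ?_⟩
    · apply tensor_dual_ext
      intro a
      have h1 := congrArg (pairLeft (TensorProduct.dualDistrib K VA VA (f ⊗ₜ g)))
        (hm.comul_mul ((C.α ^ (-2 : ℤ)) c) ((C.α ^ (-2 : ℤ)) d) ((A.α ^ (-2 : ℤ)) a))
      rw [← hL, ← hR, e2, e3, e3] at h1
      exact h1
    · apply tensor_dual_ext
      intro a
      rw [evalAt_cotwistorOf, evalAt_tmul]
      exact hm.counit_one a
  · intro hm
    refine ⟨h, fun c d a => ?_, fun a => ?_⟩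
    · apply pairLeft_dualDistrib_ext
      intro f g
      rw [← hL, ← hR]
      exact congrArg (evalAt _) (hm.mul f g ((C.α ^ (2 : ℤ)) c) ((C.α ^ (2 : ℤ)) d))
    · have h1 := congrArg (evalAt a) hm.one
      rw [evalAt_cotwistorOf, evalAt_tmul] at h1
      exact h1

end IsEntwining

end Cotwistor

/-! ### Modules as comodules over the dual -/

section DualComodule

variable {K : Type u} [Field K]
variable {VA U V : Type u} [AddCommGroup VA] [Module K VA] [AddCommGroup U] [Module K U]
  [AddCommGroup V] [Module K V]

/-- The bilinear map `(u, a) ↦ u₁(a) u₀` attached to a coaction of the dual. -/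
def dualAct (ρ : U →ₗ[K] U ⊗[K] Module.Dual K VA) : U →ₗ[K] VA →ₗ[K] U :=
  dualTensorHom K VA U ∘ₗ (TensorProduct.comm K _ _).toLinearMap ∘ₗ ρ

@[simp]
lemma dualAct_apply (ρ : U →ₗ[K] U ⊗[K] Module.Dual K VA) (u : U) (a : VA) :
    dualAct ρ u a = evalAt a (ρ u) := (evalAt_eq_dualTensorHom a _).symm

variable [Module.Finite K VA]

/-- The coaction `u ↦ ∑ u · eᵢ ⊗ eⁱ` of the dual attached to a bilinear map. -/
def dualCoact (act : U →ₗ[K] VA →ₗ[K] U) : U →ₗ[K] U ⊗[K] Module.Dual K VA :=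
  (TensorProduct.comm K _ _).toLinearMap ∘ₗ (dualTensorHomEquiv K VA U).symm.toLinearMap ∘ₗ act

@[simp]
lemma evalAt_dualCoact (act : U →ₗ[K] VA →ₗ[K] U) (u : U) (a : VA) :
    evalAt a (dualCoact act u) = act u a := by
  rw [evalAt_eq_dualTensorHom]
  simp only [dualCoact, LinearMap.comp_apply, LinearEquiv.coe_coe, TensorProduct.comm_comm]
  exact LinearMap.congr_fun ((dualTensorHomEquiv K VA U).apply_symm_apply (act u)) a

lemma evalAt_evalAt_dualCopComul (A : HomAlgebra K VA) (g : U →ₗ[K] V)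
    (s : U ⊗[K] Module.Dual K VA) (x y : VA) :
    evalAt x (evalAt y ((TensorProduct.assoc K V _ _).symm
      (TensorProduct.map g (dualCopComul A) s))) =
      g (evalAt ((A.α ^ (-2 : ℤ)) (A.mul y x)) s) := by
  induction s using TensorProduct.induction_on with
  | zero => simp
  | add p q hp hq => simp only [map_add, hp, hq]
  | tmul c f =>
    rw [evalAt_tmul, ← dualCopComul_apply, TensorProduct.map_tmul]
    generalize dualCopComul A f = p
    induction p using TensorProduct.induction_on with
    | zero => simp
    | add p q hp hq =>
      simp only [TensorProduct.tmul_add, map_add, LinearMap.add_apply, add_smul, hp, hq]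
    | tmul f g => simp [smul_smul, mul_comm]

variable {A : HomAlgebra K VA} {αU : U ≃ₗ[K] U} {act : U →ₗ[K] VA →ₗ[K] U}
  {ρ : U →ₗ[K] U ⊗[K] Module.Dual K VA} {t : ℤ}

/-- Pairing the coassociativity identity with two points of `A` gives the associativity of the
action. Since α^t is an automorphism of `A`, the twist t may be any integer; this freedom later
absorbs both m and k. -/
lemma isRightComodule_dualCop_iff (hr : ∀ u a, evalAt a (ρ u) = act u ((A.α ^ t) a)) :
    IsRightComodule (dualCopCoalgebra A) αU ρ ↔ IsRightModule A αU act := by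
  have hadd : ∀ (n n' l : ℤ) (x : VA), n + n' = l → (A.α ^ n) ((A.α ^ n') x) = (A.α ^ l) x := by
    rintro n n' l x rfl
    rw [← LinearEquiv.mul_apply, ← zpow_add]
  have hsymm : ∀ x, A.α.symm x = (A.α ^ (-1 : ℤ)) x := fun _ => rfl
  have hcounit : ∀ u, TensorProduct.rid K U ((dualCopCoalgebra A).counit.lTensor U (ρ u)) =
      act u A.one := by
    intro u
    refine (hr u A.one).trans ?_
    rw [A.α_zpow_one]
  have hL : ∀ u x y, evalAt x (evalAt y ((TensorProduct.assoc K U _ _).symm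
      (TensorProduct.map αU.toLinearMap (dualCopCoalgebra A).comul (ρ u)))) =
      αU (act u ((A.α ^ (t - 2)) (A.mul y x))) := by
    intro u x y
    refine (evalAt_evalAt_dualCopComul A αU.toLinearMap (ρ u) x y).trans ?_
    rw [hr, hadd t (-2) (t - 2) _ (by ring)]
    rfl
  have hR : ∀ u x y, evalAt x (evalAt y ((TensorProduct.assoc K U _ _).symm
      (TensorProduct.assoc K U _ _
      (TensorProduct.map ρ (dualCopCoalgebra A).α.toLinearMap (ρ u))))) =
      act (act u ((A.α ^ (t - 1)) y)) ((A.α ^ t) x) := by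
    intro u x y
    rw [LinearEquiv.symm_apply_apply]
    refine (congrArg (evalAt x) (evalAt_map y ρ A.α.symm.toLinearMap (ρ u))).trans ?_
    rw [hr, hr, LinearEquiv.coe_coe, hsymm, hadd t (-1) (t - 1) _ (by ring)]
  constructor
  · intro h
    -- The module axioms are not yet available, so compatibility with α is taken from the comodule
    -- side.
    have hα : ∀ u a, act (αU u) (A.α a) = αU (act u a) := by
      intro u a
      have h1 := (hr (αU u) (A.α ((A.α ^ (-t)) a))).symm
      rw [h.coact_α] at h1
      have h2 := h1.trans (evalAt_map _ αU.toLinearMap A.α.symm.toLinearMap (ρ u))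
      rw [show A.α.symm.toLinearMap (A.α ((A.α ^ (-t)) a)) = (A.α ^ (-t)) a from
        A.α.symm_apply_apply _, hr, zpow_apply_apply, hadd t (-t) 0 _ (by ring)] at h2
      exact h2
    refine ⟨fun u a b => ?_, fun u => ?_⟩
    -- The exponents t-1 and t in `hR` become 0 and 1 after the shift by 1-t, which is the shape of
    -- the associativity axiom.
    · have h1 := congrArg (fun z => evalAt ((A.α ^ (1 - t)) b) (evalAt ((A.α ^ (1 - t)) a)
        ((TensorProduct.assoc K U _ _).symm z))) (h.coact_coact u)
      rw [hL, hR, ← A.α_zpow_mul, hadd _ _ (-1) _ (by ring), hadd _ _ 0 _ (by ring),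
        hadd _ _ 1 _ (by ring)] at h1
      refine Eq.trans h1.symm ?_
      rw [← hα, ← hsymm, LinearEquiv.apply_symm_apply]
    · rw [← hcounit, h.coact_counit]
  · intro h
    refine ⟨fun u => ?_, fun u => by rw [hcounit, h.act_one]⟩
    apply (TensorProduct.assoc K U _ _).symm.injective
    apply tensor_dual_ext
    intro y
    apply tensor_dual_ext
    intro x
    have e1 : (A.α ^ t) x = A.α ((A.α ^ (t - 1)) x) := (hadd 1 (t - 1) t x (by ring)).symm
    have e2 : A.α ((A.α ^ (t - 2)) (A.mul y x)) = (A.α ^ (t - 1)) (A.mul y x) :=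
      hadd 1 (t - 2) (t - 1) _ (by ring)
    rw [hL, hR, e1, h.act_act, ← A.α_zpow_mul, ← e2, h.act_α]

end DualComodule

/-! ### Doi-Hopf modules as comodules over the smash coproduct -/

section DoiHopf

variable {K : Type u} [Field K]
variable {VH VA VC U : Type u} [AddCommGroup VH] [Module K VH] [AddCommGroup VA] [Module K VA]
  [AddCommGroup VC] [Module K VC] [AddCommGroup U] [Module K U] [Module.Finite K VA]
  {H : HomBialgebra K VH} {A : HomAlgebra K VA} {C : HomCoalgebra K VC}

lemma evalAt_lTensor_iterCoact (D : DoiHopfDatum H A C) (m k : ℤ) {act : U →ₗ[K] VA →ₗ[K] U}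
    {ρB : U →ₗ[K] U ⊗[K] Module.Dual K VA}
    (hr : ∀ u a, evalAt a (ρB u) = act u ((A.α ^ (m - k + 1)) a))
    (ρD : U →ₗ[K] U ⊗[K] VC) (u : U) (a : VA) :
    evalAt a ((TensorProduct.assoc K U VC (Module.Dual K VA)).symm
      ((D.φ m).lTensor U (iterCoact ρB ρD C.α u))) =
      TensorProduct.map₂ act (D.act.compl₂ (H.α ^ k).toLinearMap) (ρD u)
        (D.ρ ((A.α ^ (m - k)) a)) := by
  rw [D.isRightComodule.coact_α_zpow, iterCoact_apply]
  generalize ρD u = q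
  induction q using TensorProduct.induction_on with
  | zero => simp
  | add x y hx hy => simp only [map_add, LinearMap.add_apply, hx, hy]
  | tmul w c =>
  have h1 : ∀ s : U ⊗[K] Module.Dual K VA,
      evalAt a ((TensorProduct.assoc K U VC (Module.Dual K VA)).symm
        ((D.φ m).lTensor U (TensorProduct.assoc K U (Module.Dual K VA) VC (s ⊗ₜ C.α c)))) =
      (evalHom s).rTensor VC (D.Φ m (C.α c ⊗ₜ a)) := by
    intro s
    induction s using TensorProduct.induction_on with
    | zero => simp [evalHom]
    | add x y hx hy =>
      have : evalHom (x + y) = evalHom x + evalHom y := by simp [evalHom]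
      simp only [TensorProduct.add_tmul, map_add, hx, hy, this, LinearMap.rTensor_add,
        LinearMap.add_apply]
    | tmul x f =>
    have h2 : ∀ r : VC ⊗[K] Module.Dual K VA,
        evalAt a ((TensorProduct.assoc K U VC (Module.Dual K VA)).symm (x ⊗ₜ r)) =
          x ⊗ₜ evalAt a r := by
      intro r
      induction r using TensorProduct.induction_on with
      | zero => simp
      | add x y hx hy => simp only [TensorProduct.tmul_add, map_add, hx, hy]
      | tmul c g => simp
    rw [TensorProduct.assoc_tmul, LinearMap.lTensor_tmul, h2, DoiHopfDatum.φ, evalAt_cotwistorOf]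
    generalize D.Φ m (C.α c ⊗ₜ a) = r
    induction r using TensorProduct.induction_on with
    | zero => simp
    | add x y hx hy => simp only [TensorProduct.tmul_add, map_add, hx, hy]
    | tmul b d => simp [evalHom, TensorProduct.smul_tmul]
  rw [TensorProduct.map_tmul, LinearEquiv.coe_coe, h1, D.Φ_tmul, LinearEquiv.symm_apply_apply]
  generalize D.ρ a = r
  induction r using TensorProduct.induction_on with
  | zero => simp
  | add x y hx hy => simp only [map_add, hx, hy]
  | tmul b h =>
    have e1 : (A.α ^ (m - k + 1)) (A.α.symm b) = (A.α ^ (m - k)) b := by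
      rw [zpow_add_one, LinearEquiv.mul_apply, LinearEquiv.apply_symm_apply]
    have e2 : (H.α ^ k) ((H.α ^ (m - k)) h) = (H.α ^ m) h := by
      rw [← LinearEquiv.mul_apply, ← zpow_add, add_sub_cancel]
    simp [evalHom_apply, hr, e1, e2]

/-- With ρ(u) = w ⊗ c and action twisted by α^t, the exchange relation evaluated at a compares w ·
α^(t-1)(a₀) ⊗ c · α^m(a₁) with ρ(u · α^(t-1)(a)). In terms of b = α^(t-1)(a) the `H`-leg carries
α^(m-t+1), so the Doi-Hopf condition of index k requires t = m-k+1. -/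
lemma isPairComodule_iff_isDoiHopfModule (D : DoiHopfDatum H A C) (m k : ℤ)
    {X : PreDoiHopf K VA VC} {ρB : X.carrier →ₗ[K] X.carrier ⊗[K] Module.Dual K VA}
    (hr : ∀ u a, evalAt a (ρB u) = X.act u ((A.α ^ (m - k + 1)) a)) :
    IsPairComodule (dualCopCoalgebra A) C (D.φ m) X.α ρB X.coact ↔ D.IsDoiHopfModule k X := by
  have hR : ∀ u a, evalAt a ((TensorProduct.assoc K X.carrier VC (Module.Dual K VA)).symm
      (iterCoact X.coact ρB (dualCopCoalgebra A).α u)) =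
      X.coact (X.act u ((A.α ^ (m - k)) a)) := by
    intro u a
    rw [iterCoact_apply, LinearEquiv.symm_apply_apply]
    refine (evalAt_map a X.coact A.α.symm.toLinearMap (ρB u)).trans ?_
    rw [hr, zpow_add_one, LinearEquiv.mul_apply, LinearEquiv.coe_coe,
      LinearEquiv.apply_symm_apply]
  constructor
  · intro h
    refine ⟨(isRightComodule_dualCop_iff hr).1 h.left, h.right, fun u a => ?_⟩
    have h1 := congrArg (fun z => evalAt ((A.α ^ (-(m - k))) a)
      ((TensorProduct.assoc K X.carrier VC (Module.Dual K VA)).symm z)) (h.compat u)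
    have e : (A.α ^ (m - k)) ((A.α ^ (-(m - k))) a) = a := by
      rw [← LinearEquiv.mul_apply, ← zpow_add, add_neg_cancel]
      rfl
    rw [evalAt_lTensor_iterCoact D m k hr, hR, e] at h1
    exact h1.symm
  · intro h
    refine ⟨(isRightComodule_dualCop_iff hr).2 h.isRightModule, h.isRightComodule, fun u => ?_⟩
    apply (TensorProduct.assoc K X.carrier VC (Module.Dual K VA)).symm.injective
    apply tensor_dual_ext
    intro a
    rw [evalAt_lTensor_iterCoact D m k hr, hR, h.coact_act]

end DoiHopf

/-! ### Tensor products of coactions of the dual and of smash coproducts -/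

section TensorDual

variable {K : Type u} [Field K]
variable {VA VB VD U V : Type u} [AddCommGroup VA] [Module K VA] [AddCommGroup VB] [Module K VB]
  [AddCommGroup VD] [Module K VD] [AddCommGroup U] [Module K U] [AddCommGroup V] [Module K V]

lemma dualAlgebra_α_zpow_apply (A : HomCoalgebra K VA) (n : ℤ) (f : Module.Dual K VA) (x : VA) :
    ((dualAlgebra A).α ^ n) f x = f ((A.α ^ (-n)) x) := by
  -- `LinearMap.id` is read as the evaluation pairing, which is invariant under α on both arguments.
  have h := zpow_intertwine₂ (e := (dualAlgebra A).α) (e' := A.α) (e'' := LinearEquiv.refl K K)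
    (f := LinearMap.id)
    (fun (f : Module.Dual K VA) x => congrArg f (A.α.symm_apply_apply x)) n f ((A.α ^ (-n)) x)
  rw [← LinearEquiv.mul_apply, ← zpow_add, add_neg_cancel] at h
  exact h.trans (by rw [show (LinearEquiv.refl K K) ^ n = 1 from one_zpow n]; rfl)

/-- The source of -i-2 and -j-2 in the tensor product of actions: α^i on A* is transposed to α^(-i)
on `A`, and the convolution product contributes α⁻². -/
lemma evalAt_map₂_twistMul (A : HomCoalgebra K VA) (i j : ℤ) (b : VA)
    (p : U ⊗[K] Module.Dual K VA) (q : V ⊗[K] Module.Dual K VA) :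
    evalAt b (TensorProduct.map₂ (TensorProduct.mk K U V) ((dualAlgebra A).twistMul i j) p q) =
      TensorProduct.map (evalHom p) (evalHom q)
        (TensorProduct.map (A.α ^ (-i - 2)).toLinearMap (A.α ^ (-j - 2)).toLinearMap
          (A.comul b)) := by
  have hadd : ∀ {x y : U ⊗[K] Module.Dual K VA}, evalHom (x + y) = evalHom x + evalHom y :=
    fun {x y} => by simp [evalHom]
  have hadd' : ∀ {x y : V ⊗[K] Module.Dual K VA}, evalHom (x + y) = evalHom x + evalHom y :=
    fun {x y} => by simp [evalHom]
  induction p using TensorProduct.induction_on with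
  | zero => simp [evalHom]
  | add x y hx hy =>
    simp only [map_add, LinearMap.add_apply, hx, hy, hadd, TensorProduct.map_add_left]
  | tmul u f =>
  induction q using TensorProduct.induction_on with
  | zero => simp [evalHom]
  | add x y hx hy =>
    simp only [map_add, LinearMap.add_apply, hx, hy, hadd', TensorProduct.map_add_right]
  | tmul v g =>
  rw [TensorProduct.map₂_apply_tmul, TensorProduct.map_tmul, evalAt_tmul]
  change dualMul A (((dualAlgebra A).α ^ i) f) (((dualAlgebra A).α ^ j) g) b • (u ⊗ₜ[K] v) = _
  rw [dualMul_apply]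
  generalize A.comul b = r
  induction r using TensorProduct.induction_on with
  | zero => simp
  | add x y hx hy => simp only [map_add, add_smul, hx, hy]
  | tmul x y =>
  have e : ∀ (n : ℤ) (x : VA), (A.α ^ (-n)) ((A.α ^ (-2 : ℤ)) x) = (A.α ^ (-n - 2)) x :=
    fun n x => by rw [← LinearEquiv.mul_apply, ← zpow_add]; rfl
  simp only [TensorProduct.map_tmul, TensorProduct.dualDistrib_apply, dualAlgebra_α_zpow_apply,
    LinearEquiv.coe_coe, e, evalHom_apply, evalAt_tmul]
  rw [TensorProduct.smul_tmul_smul]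

/-- The coaction of the dual attached to a tensor product of actions. -/
lemma evalAt_tensorCoact (A : HomCoalgebra K VA) (i j t : ℤ) {actU : U →ₗ[K] VA →ₗ[K] U}
    {actV : V →ₗ[K] VA →ₗ[K] V} {ρU : U →ₗ[K] U ⊗[K] Module.Dual K VA}
    {ρV : V →ₗ[K] V ⊗[K] Module.Dual K VA}
    (hU : ∀ u a, evalAt a (ρU u) = actU u ((A.α ^ t) a))
    (hV : ∀ v a, evalAt a (ρV v) = actV v ((A.α ^ t) a)) (x : U ⊗[K] V) (a : VA) :
    evalAt a (tensorCoact (dualAlgebra A) i j ρU ρV x) =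
      (TensorProduct.map₂ actU actV).compl₂
        (TensorProduct.map (A.α ^ (-i - 2)).toLinearMap (A.α ^ (-j - 2)).toLinearMap ∘ₗ A.comul)
        x ((A.α ^ t) a) := by
  induction x using TensorProduct.induction_on with
  | zero => simp
  | add x y hx hy => simp only [map_add, LinearMap.add_apply, hx, hy]
  | tmul u v =>
  rw [tensorCoact_tmul, evalAt_map₂_twistMul, LinearMap.compl₂_apply, LinearMap.comp_apply,
    A.comul_α_zpow, TensorProduct.map₂_apply_tmul]
  generalize A.comul a = r
  induction r using TensorProduct.induction_on with
  | zero => simp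
  | add x y hx hy => simp only [map_add, hx, hy]
  | tmul x y =>
  have e : ∀ (n : ℤ) (x : VA), (A.α ^ t) ((A.α ^ n) x) = (A.α ^ n) ((A.α ^ t) x) :=
    fun n x => by rw [← LinearEquiv.mul_apply, ← zpow_add, add_comm, zpow_add]; rfl
  simp [evalHom_apply, hU, hV, e]

lemma lTensor_tensorCoact {B : HomAlgebra K VB} {D : HomAlgebra K VD} {g : VB →ₗ[K] VD}
    (hα : ∀ x, g (B.α x) = D.α (g x)) (hmul : ∀ x y, g (B.mul x y) = D.mul (g x) (g y))
    (i j : ℤ) (ρU : U →ₗ[K] U ⊗[K] VB) (ρV : V →ₗ[K] V ⊗[K] VB) :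
    g.lTensor (U ⊗[K] V) ∘ₗ tensorCoact B i j ρU ρV =
      tensorCoact D i j (g.lTensor U ∘ₗ ρU) (g.lTensor V ∘ₗ ρV) := by
  apply TensorProduct.ext'
  intro u v
  rw [LinearMap.comp_apply, tensorCoact_tmul, tensorCoact_tmul]
  exact map_map₂ (f₁ := LinearMap.id) (f₂ := LinearMap.id) (f := LinearMap.id) (g₁ := g) (g₂ := g)
    (fun _ _ => rfl) (fun x y => by simp [hmul, zpow_intertwine hα]) (ρU u) (ρV v)

lemma iterCoact_tensorCoact (B : HomAlgebra K VB) (D : HomAlgebra K VD) (i j : ℤ)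
    (ρB : U →ₗ[K] U ⊗[K] VB) (ρB' : V →ₗ[K] V ⊗[K] VB) (ρD : U →ₗ[K] U ⊗[K] VD)
    (ρD' : V →ₗ[K] V ⊗[K] VD) (u : U) (v : V) :
    iterCoact (tensorCoact B i j ρB ρB') (tensorCoact D i j ρD ρD') D.α (u ⊗ₜ v) =
      TensorProduct.map₂ (TensorProduct.mk K U V)
        (TensorProduct.map₂ (B.twistMul i j) (D.twistMul i j))
        (iterCoact ρB ρD D.α u) (iterCoact ρB' ρD' D.α v) := by
  rw [iterCoact_apply, tensorCoact_tmul, iterCoact_apply, iterCoact_apply, ← assoc_map₂]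
  congr 1
  exact map_map₂ (fun x y => tensorCoact_tmul B i j ρB ρB' x y) (D.α_twistMul i j) _ _

lemma map₂_twistMul (B : HomAlgebra K VB) (D : HomAlgebra K VD) (i j : ℤ) (x y : VB ⊗[K] VD) :
    TensorProduct.map₂ (B.twistMul i j) (D.twistMul i j) x y =
      TensorProduct.map₂ B.mul D.mul ((TensorProduct.congr B.α D.α ^ i) x)
        ((TensorProduct.congr B.α D.α ^ j) y) := by
  rw [congr_zpow_apply, congr_zpow_apply]
  have h := map_map₂ (K := K) (a := B.twistMul i j) (a' := B.mul) (b := D.twistMul i j)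
    (b' := D.mul) (f := LinearMap.id) (g := LinearMap.id) (fun _ _ => rfl) (fun _ _ => rfl) x y
  rw [TensorProduct.map_id] at h
  exact h

end TensorDual

/-! ### Smash comodules give Doi-Hopf modules and conversely -/

section Transfer

variable {K : Type u} [Field K]
variable {VA VC : Type u} [AddCommGroup VA] [Module K VA] [AddCommGroup VC] [Module K VC]

/-- The passage between comodules and Doi-Hopf modules keeps the underlying map, while source and
target are only propositionally equal; this transports linearity and colinearity along such
equalities. -/
lemma PreDoiHopf.IsHom.congr {X Y X' Y' : PreDoiHopf K VA VC} {f : X.carrier →ₗ[K] Y.carrier}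
    {f' : X'.carrier →ₗ[K] Y'.carrier} (h : PreDoiHopf.IsHom X Y f) (hX : X = X') (hY : Y = Y')
    (hf : HEq f f') : PreDoiHopf.IsHom X' Y' f' := by
  subst hX hY
  exact eq_of_heq hf ▸ h

lemma DoiHopfDatum.DoiHopfModule.eq_of_toPreDoiHopf {VH : Type u} [AddCommGroup VH] [Module K VH]
    {H : HomBialgebra K VH} {A : HomAlgebra K VA} {C : HomCoalgebra K VC} {D : DoiHopfDatum H A C}
    {k : ℤ} {X Y : D.DoiHopfModule k}
    (h : X.toPreDoiHopf = Y.toPreDoiHopf) : X = Y := by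
  cases X; cases Y; cases h; rfl

lemma Corep.eq_of_toPreComodule {VB : Type u} [AddCommGroup VB] [Module K VB]
    {B : HomCoalgebra K VB} {P Q : Corep B} (h : P.toPreComodule = Q.toPreComodule) : P = Q := by
  cases P; cases Q; cases h; rfl

variable [Module.Finite K VA]

/-- The action and the coaction attached to a coaction of `A* ⊗ C`. -/
def PreComodule.toPreDoiHopf (A : HomAlgebra K VA) (C : HomCoalgebra K VC) (t : ℤ)
    (P : PreComodule K (Module.Dual K VA ⊗[K] VC)) : PreDoiHopf K VA VC where
  toHomObject := P.toHomObject
  act := (dualAct ((smashFst C).lTensor P.carrier ∘ₗ P.coact)).compl₂ (A.α ^ (-t)).toLinearMap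
  coact := (smashSnd (dualCopCoalgebra A)).lTensor P.carrier ∘ₗ P.coact

/-- The coaction of `A* ⊗ C` attached to an action and a coaction. -/
def PreDoiHopf.toPreComodule (A : HomAlgebra K VA) (C : HomCoalgebra K VC) (t : ℤ)
    (X : PreDoiHopf K VA VC) : PreComodule K (Module.Dual K VA ⊗[K] VC) where
  toHomObject := X.toHomObject
  coact := iterCoact (dualCoact (X.act.compl₂ (A.α ^ t).toLinearMap)) X.coact C.α ∘ₗ
    X.α.symm.toLinearMap

lemma PreComodule.evalAt_fst_coact (A : HomAlgebra K VA) (C : HomCoalgebra K VC) (t : ℤ)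
    (P : PreComodule K (Module.Dual K VA ⊗[K] VC)) (u : P.carrier) (a : VA) :
    evalAt a (((smashFst C).lTensor P.carrier ∘ₗ P.coact) u) =
      (P.toPreDoiHopf A C t).act u ((A.α ^ t) a) := by
  change _ = dualAct ((smashFst C).lTensor P.carrier ∘ₗ P.coact) u ((A.α ^ (-t)) ((A.α ^ t) a))
  rw [← LinearEquiv.mul_apply, ← zpow_add, neg_add_cancel, dualAct_apply]
  rfl

variable {VH : Type u} [AddCommGroup VH] [Module K VH] {H : HomBialgebra K VH}

section

variable {A : HomAlgebra K VA} {C : HomCoalgebra K VC} {D : DoiHopfDatum H A C} {m : ℤ} (k : ℤ)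
  {hφ : IsCotwistor (dualCopCoalgebra A) C (D.φ m)}

lemma Corep.isDoiHopfModule (P : Corep (smashCoalgebra hφ)) :
    D.IsDoiHopfModule k (P.toPreDoiHopf A C (m - k + 1)) :=
  (isPairComodule_iff_isDoiHopfModule (X := P.toPreDoiHopf A C (m - k + 1)) D m k
    (P.evalAt_fst_coact A C (m - k + 1))).1 P.isRightComodule.isPairComodule

/-- The Doi-Hopf module attached to a smash comodule. -/
def Corep.toDoiHopfModule (P : Corep (smashCoalgebra hφ)) : D.DoiHopfModule k :=
  ⟨P.toPreDoiHopf A C (m - k + 1), P.isDoiHopfModule k⟩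

variable {k}

lemma isPairComodule_dualCoact (X : D.DoiHopfModule k) :
    IsPairComodule (dualCopCoalgebra A) C (D.φ m) X.α
      (dualCoact (X.act.compl₂ (A.α ^ (m - k + 1)).toLinearMap)) X.coact :=
  (isPairComodule_iff_isDoiHopfModule (X := X.toPreDoiHopf) D m k
    (fun u a => evalAt_dualCoact _ u a)).2 X.isDoiHopfModule

/-- The smash comodule attached to a Doi-Hopf module. -/
def DoiHopfDatum.DoiHopfModule.toCorep (hφ : IsCotwistor (dualCopCoalgebra A) C (D.φ m))
    (X : D.DoiHopfModule k) : Corep (smashCoalgebra hφ) :=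
  ⟨X.toPreComodule A C (m - k + 1), (isPairComodule_dualCoact X).isRightComodule hφ⟩

lemma dualCoact_dualAct_compl₂ {U : Type u} [AddCommGroup U] [Module K U] (t : ℤ)
    (ρ : U →ₗ[K] U ⊗[K] Module.Dual K VA) :
    dualCoact (((dualAct ρ).compl₂ (A.α ^ (-t)).toLinearMap).compl₂ (A.α ^ t).toLinearMap) = ρ := by
  refine LinearMap.ext fun u => tensor_dual_ext fun a => ?_
  rw [evalAt_dualCoact, LinearMap.compl₂_apply, LinearMap.compl₂_apply, LinearEquiv.coe_coe,
    LinearEquiv.coe_coe, ← LinearEquiv.mul_apply, ← zpow_add, neg_add_cancel, dualAct_apply]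
  rfl

/-- The twists by α^(-t) and α^t cancel, and `iterCoact_fst_snd` recovers the coaction. -/
lemma Corep.toCorep_toDoiHopfModule (P : Corep (smashCoalgebra hφ)) :
    (P.toDoiHopfModule k).toCorep hφ = P := by
  refine Corep.eq_of_toPreComodule (congrArg (PreComodule.mk P.toHomObject) ?_)
  have h := dualCoact_dualAct_compl₂ (A := A) (m - k + 1)
    ((smashFst C).lTensor P.carrier ∘ₗ P.coact)
  refine (congrArg (fun ρ => iterCoact ρ ((smashSnd (dualCopCoalgebra A)).lTensor
    P.carrier ∘ₗ P.coact) C.α ∘ₗ P.α.symm.toLinearMap) h).trans (LinearMap.ext fun u => ?_)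
  refine (iterCoact_fst_snd P.isRightComodule (P.α.symm u)).trans ?_
  rw [LinearEquiv.apply_symm_apply]

lemma DoiHopfDatum.DoiHopfModule.toDoiHopfModule_toCorep (X : D.DoiHopfModule k) :
    (X.toCorep hφ).toDoiHopfModule k = X := by
  have h := isPairComodule_dualCoact (m := m) X
  refine DoiHopfDatum.DoiHopfModule.eq_of_toPreDoiHopf
    (congrArg₂ (PreDoiHopf.mk X.toHomObject) ?_ ?_)
  · refine LinearMap.ext fun (u : X.carrier) => LinearMap.ext fun a => ?_
    refine (dualAct_apply _ u _).trans ?_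
    refine (congrArg (evalAt _) (h.fst_iterCoact (X.α.symm u))).trans ?_
    rw [LinearEquiv.apply_symm_apply, evalAt_dualCoact, LinearMap.compl₂_apply,
      LinearEquiv.coe_coe, LinearEquiv.coe_coe, ← LinearEquiv.mul_apply, ← zpow_add,
      add_neg_cancel]
    rfl
  · refine LinearMap.ext fun (u : X.carrier) => ?_
    exact (h.snd_iterCoact (X.α.symm u)).trans (congrArg X.coact (X.α.apply_symm_apply u))

/-- A map colinear for both restrictions is colinear for the iterated coaction, which is ρ ∘ α, and
α is onto. Conversely restrictions along the projections are natural. -/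
lemma Corep.isHom_toDoiHopfModule_iff {P Q : Corep (smashCoalgebra hφ)}
    {f : P.carrier →ₗ[K] Q.carrier} :
    PreDoiHopf.IsHom (P.toDoiHopfModule k).toPreDoiHopf (Q.toDoiHopfModule k).toPreDoiHopf f ↔
      PreComodule.IsHom P.toPreComodule Q.toPreComodule f := by
  have hP := P.isRightComodule.isPairComodule
  have hQ := Q.isRightComodule.isPairComodule
  constructor
  · intro h
    have hD : ∀ u, ((smashSnd (dualCopCoalgebra A)).lTensor Q.carrier ∘ₗ Q.coact) (f u) =
      f.rTensor VC (((smashSnd (dualCopCoalgebra A)).lTensor P.carrier ∘ₗ P.coact) u) := h.map_coact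
    have hB : ∀ u, ((smashFst C).lTensor Q.carrier ∘ₗ Q.coact) (f u) =
        f.rTensor _ (((smashFst C).lTensor P.carrier ∘ₗ P.coact) u) := by
      intro u
      apply tensor_dual_ext
      intro a
      rw [evalAt_rTensor, P.evalAt_fst_coact A C (m - k + 1),
        Q.evalAt_fst_coact A C (m - k + 1)]
      exact (h.map_act u _).symm
    intro u
    obtain ⟨u, rfl⟩ := P.α.surjective u
    rw [hP.right.map_α hQ.right hD, ← iterCoact_fst_snd P.isRightComodule,
      ← iterCoact_fst_snd Q.isRightComodule, iterCoact_apply, iterCoact_apply, hD]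
    generalize ((smashSnd (dualCopCoalgebra A)).lTensor P.carrier ∘ₗ P.coact) u = s
    induction s using TensorProduct.induction_on with
    | zero => simp
    | add x y hx hy => simp only [map_add, hx, hy]
    | tmul w c =>
    rw [LinearMap.rTensor_tmul, TensorProduct.map_tmul, TensorProduct.map_tmul, hB]
    generalize ((smashFst C).lTensor P.carrier ∘ₗ P.coact) w = r
    induction r using TensorProduct.induction_on with
    | zero => simp
    | add x y hx hy => simp only [map_add, TensorProduct.add_tmul, hx, hy]
    | tmul w c => simp
  · intro h
    have hg : ∀ {V : Type u} [AddCommGroup V] [Module K V]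
        (g : Module.Dual K VA ⊗[K] VC →ₗ[K] V) (u : P.carrier),
        g.lTensor Q.carrier (Q.coact (f u)) = f.rTensor V (g.lTensor P.carrier (P.coact u)) := by
      intro V _ _ g u
      rw [h u]
      exact LinearMap.congr_fun ((LinearMap.lTensor_comp_rTensor _ f g).trans
        (LinearMap.rTensor_comp_lTensor _ f g).symm) (P.coact u)
    refine ⟨fun (u : P.carrier) a => ?_, fun u => hg (smashSnd (dualCopCoalgebra A)) u⟩
    refine (congrArg f (dualAct_apply _ u _)).trans (Eq.trans ?_ (dualAct_apply _ (f u) _).symm)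
    refine (evalAt_rTensor _ f (((smashFst C).lTensor P.carrier ∘ₗ P.coact) u)).symm.trans ?_
    exact congrArg _ (hg (smashFst C) u).symm

end

end Transfer

/-! ### The projections of a smash coproduct commute with the structure maps. -/

section

variable {K : Type u} [Field K] {VB VD : Type u} [AddCommGroup VB] [Module K VB]
  [AddCommGroup VD] [Module K VD] (B : HomCoalgebra K VB) (D : HomCoalgebra K VD) (x : VB ⊗[K] VD)

lemma smashFst_α : smashFst D (TensorProduct.congr B.α D.α x) = B.α (smashFst D x) := by
  induction x using TensorProduct.induction_on with
  | zero => simp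
  | add x y hx hy => simp only [map_add, hx, hy]
  | tmul b d => simp [D.counit_α]

lemma smashSnd_α : smashSnd B (TensorProduct.congr B.α D.α x) = D.α (smashSnd B x) := by
  induction x using TensorProduct.induction_on with
  | zero => simp
  | add x y hx hy => simp only [map_add, hx, hy]
  | tmul b d => simp [B.counit_α]

end

/-! ### Monoidal categories of Doi-Hopf modules -/

section Monoidal

variable {K : Type u} [Field K]
variable {VH VA VC : Type u} [AddCommGroup VH] [Module K VH] [AddCommGroup VA] [Module K VA]
  [AddCommGroup VC] [Module K VC]

section

variable {H : HomBialgebra K VH} {A : HomAlgebra K VA} {C : HomCoalgebra K VC}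
  {D : DoiHopfDatum H A C} {k : ℤ}

lemma DoiHopfDatum.DoiHopfModule.hom_heq {X Y X' Y' : D.DoiHopfModule k} {f : X ⟶ Y}
    {f' : X' ⟶ Y'} (hX : X = X') (hY : Y = Y') (h : HEq f.map f'.map) : HEq f f' := by
  subst hX hY
  exact heq_of_eq (DoiHopfDatum.DoiHopfModule.Hom.ext (eq_of_heq h))

lemma Corep.hom_heq {VB : Type u} [AddCommGroup VB] [Module K VB] {B : HomCoalgebra K VB}
    {X Y X' Y' : Corep B} {f : X ⟶ Y} {f' : X' ⟶ Y'} (hX : X = X') (hY : Y = Y')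
    (h : HEq f.map f'.map) : HEq f f' := by
  subst hX hY
  exact heq_of_eq (Corep.Hom.ext (eq_of_heq h))

variable [Module.Finite K VA] {m : ℤ}

/-- Smash comodules as Doi-Hopf modules. -/
def corepToDoiHopf (hφ : IsCotwistor (dualCopCoalgebra A) C (D.φ m)) (k : ℤ) :
    Corep (smashCoalgebra hφ) ⥤ D.DoiHopfModule k where
  obj P := P.toDoiHopfModule k
  map f := ⟨f.map, Corep.isHom_toDoiHopfModule_iff.2 f.isHom⟩

/-- Doi-Hopf modules as smash comodules. -/
def doiHopfToCorep (hφ : IsCotwistor (dualCopCoalgebra A) C (D.φ m)) (k : ℤ) :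
    D.DoiHopfModule k ⥤ Corep (smashCoalgebra hφ) where
  obj X := X.toCorep hφ
  map {X Y} f := ⟨f.map, Corep.isHom_toDoiHopfModule_iff.1 (f.isHom.congr
    (congrArg _ (X.toDoiHopfModule_toCorep (hφ := hφ)).symm)
    (congrArg _ (Y.toDoiHopfModule_toCorep (hφ := hφ)).symm) HEq.rfl)⟩

lemma doiHopfToCorep_comp (hφ : IsCotwistor (dualCopCoalgebra A) C (D.φ m)) (k : ℤ) :
    doiHopfToCorep hφ k ⋙ corepToDoiHopf hφ k = 𝟭 _ :=
  Functor.hext (fun X => X.toDoiHopfModule_toCorep) fun X Y _ =>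
    DoiHopfDatum.DoiHopfModule.hom_heq X.toDoiHopfModule_toCorep Y.toDoiHopfModule_toCorep HEq.rfl

lemma corepToDoiHopf_comp (hφ : IsCotwistor (dualCopCoalgebra A) C (D.φ m)) (k : ℤ) :
    corepToDoiHopf hφ k ⋙ doiHopfToCorep hφ k = 𝟭 _ :=
  Functor.hext (fun X => X.toCorep_toDoiHopfModule) fun X Y _ =>
    Corep.hom_heq X.toCorep_toDoiHopfModule Y.toCorep_toDoiHopfModule HEq.rfl

end

variable [Module.Finite K VA] {H : HomBialgebra K VH} {A : HomBialgebra K VA}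
  {C : HomBialgebra K VC} {D : DoiHopfDatum H A.toHomAlgebra C.toHomCoalgebra} {m : ℤ}

section

variable {φ : Module.Dual K VA ⊗[K] VC →ₗ[K] VC ⊗[K] Module.Dual K VA}
  (hφ : IsMonoidalCotwistor (dualCopBialgebra A) C φ) (i j t : ℤ)
  (P Q : PreComodule K (Module.Dual K VA ⊗[K] VC))

/-- Restriction along an algebra map commuting with α preserves twisted tensor products of
coactions, and both projections of the codouble are such maps. The result is an equality of objects,
not merely an isomorphism. -/
lemma PreComodule.toPreDoiHopf_tensor :
    (PreComodule.tensor hφ.smashBialgebra i j P Q).toPreDoiHopf A.toHomAlgebra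
      C.toHomCoalgebra t =
    (P.toPreDoiHopf A.toHomAlgebra C.toHomCoalgebra t).tensor A C i j
      (Q.toPreDoiHopf A.toHomAlgebra C.toHomCoalgebra t) := by
  have h1 := P.evalAt_fst_coact A.toHomAlgebra C.toHomCoalgebra t
  have h2 := Q.evalAt_fst_coact A.toHomAlgebra C.toHomCoalgebra t
  have h3 : (smashFst C.toHomCoalgebra).lTensor (P.carrier ⊗[K] Q.carrier) ∘ₗ
      tensorCoact hφ.smashBialgebra.toHomAlgebra i j P.coact Q.coact =
      tensorCoact (dualAlgebra A.toHomCoalgebra) i j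
        ((smashFst C.toHomCoalgebra).lTensor P.carrier ∘ₗ P.coact)
        ((smashFst C.toHomCoalgebra).lTensor Q.carrier ∘ₗ Q.coact) :=
    lTensor_tensorCoact (B := hφ.smashBialgebra.toHomAlgebra)
      (D := (dualCopBialgebra A).toHomAlgebra)
      (smashFst_α (dualCopBialgebra A).toHomCoalgebra C.toHomCoalgebra)
      (smashFst_mul (B := dualCopBialgebra A) (D := C)) i j P.coact Q.coact
  have h4 : (smashSnd (dualCopBialgebra A).toHomCoalgebra).lTensor (P.carrier ⊗[K] Q.carrier) ∘ₗ
      tensorCoact hφ.smashBialgebra.toHomAlgebra i j P.coact Q.coact =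
      tensorCoact C.toHomAlgebra i j
        ((smashSnd (dualCopBialgebra A).toHomCoalgebra).lTensor P.carrier ∘ₗ P.coact)
        ((smashSnd (dualCopBialgebra A).toHomCoalgebra).lTensor Q.carrier ∘ₗ Q.coact) :=
    lTensor_tensorCoact (B := hφ.smashBialgebra.toHomAlgebra) (D := C.toHomAlgebra)
      (smashSnd_α (dualCopBialgebra A).toHomCoalgebra C.toHomCoalgebra)
      (smashSnd_mul (B := dualCopBialgebra A) (D := C)) i j P.coact Q.coact
  refine congrArg₂ (PreDoiHopf.mk (P.toHomObject.tensor Q.toHomObject)) ?_ h4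
  refine LinearMap.ext fun (u : P.carrier ⊗[K] Q.carrier) => LinearMap.ext fun a => ?_
  have h := evalAt_tensorCoact A.toHomCoalgebra i j t h1 h2 u ((A.α ^ (-t)) a)
  rw [← h3, ← LinearEquiv.mul_apply (A.α ^ t), ← zpow_add, add_neg_cancel] at h
  exact (dualAct_apply _ u _).trans h

lemma PreComodule.toPreDoiHopf_unit :
    (PreComodule.unit hφ.smashBialgebra).toPreDoiHopf A.toHomAlgebra C.toHomCoalgebra t =
      PreDoiHopf.unit A C := by
  refine congrArg₂ (PreDoiHopf.mk (HomObject.unit K)) ?_ ?_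
  · refine LinearMap.ext fun (r : K) => LinearMap.ext fun a => ?_
    have h := dualAct_apply ((smashFst C.toHomCoalgebra).lTensor K ∘ₗ
      (TensorProduct.mk K K (Module.Dual K VA ⊗[K] VC)).flip (A.counit ⊗ₜ[K] C.one)) r
      ((A.α ^ (-t)) a)
    refine h.trans ?_
    change evalAt ((A.α ^ (-t)) a) (r ⊗ₜ[K] smashFst C.toHomCoalgebra (A.counit ⊗ₜ[K] C.one)) =
      r * A.counit a
    rw [smashFst_tmul, C.counit_one, one_smul, evalAt_tmul, A.counit_α_zpow, smul_eq_mul, mul_comm]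
  · refine LinearMap.ext fun (r : K) => ?_
    change r ⊗ₜ[K] smashSnd (dualCopBialgebra A).toHomCoalgebra (A.counit ⊗ₜ[K] C.one) =
      r ⊗ₜ[K] C.one
    rw [smashSnd_tmul]
    have h : A.counit A.one • C.one = C.one := by rw [A.counit_one, one_smul]
    exact congrArg (TensorProduct.tmul K r) h

end

/-- Every Doi-Hopf module equals one coming from a comodule over the codouble, and tensor products
and unit correspond by equalities; so each requirement is the one already known for comodules. -/
lemma doiHopfTensorData (hφ : IsMonoidalCotwistor (dualCopBialgebra A) C (D.φ m)) (k i j : ℤ) :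
    D.TensorData k i j := by
  have hφ' : IsCotwistor (dualCopCoalgebra A.toHomAlgebra) C.toHomCoalgebra (D.φ m) :=
    hφ.toIsCotwistor
  have hX := corepTensorData hφ.smashBialgebra i j
  have hs : ∀ X : D.DoiHopfModule k, ∃ P : Corep (smashCoalgebra hφ'), P.toDoiHopfModule k = X :=
    fun X => ⟨_, X.toDoiHopfModule_toCorep⟩
  have ht : ∀ P Q, _ := PreComodule.toPreDoiHopf_tensor hφ i j (m - k + 1)
  have hu := PreComodule.toPreDoiHopf_unit hφ (m - k + 1)
  let T (P Q : Corep (smashCoalgebra hφ')) : Corep (smashCoalgebra hφ') := ⟨_, hX.tensorObj P Q⟩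
  let I : Corep (smashCoalgebra hφ') := ⟨_, hX.tensorUnit⟩
  refine ⟨?_, ?_, ?_, ?_, ?_, ?_⟩
  · intro X Y
    obtain ⟨P, rfl⟩ := hs X
    obtain ⟨Q, rfl⟩ := hs Y
    exact (ht P.toPreComodule Q.toPreComodule) ▸ (T P Q).isDoiHopfModule k
  · exact hu ▸ I.isDoiHopfModule k
  · intro X X' Y Y' f g
    obtain ⟨P, rfl⟩ := hs X
    obtain ⟨Q, rfl⟩ := hs Y
    obtain ⟨P', rfl⟩ := hs X'
    obtain ⟨Q', rfl⟩ := hs Y'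
    exact (Corep.isHom_toDoiHopfModule_iff (k := k) (P := T P Q) (Q := T P' Q')).2
      (hX.tensorHom (X := P) (Y := Q) (X' := P') (Y' := Q')
        ⟨f.map, Corep.isHom_toDoiHopfModule_iff.1 f.isHom⟩
        ⟨g.map, Corep.isHom_toDoiHopfModule_iff.1 g.isHom⟩) |>.congr (ht _ _) (ht _ _) HEq.rfl
  · intro X Y Z
    obtain ⟨P, rfl⟩ := hs X
    obtain ⟨Q, rfl⟩ := hs Y
    obtain ⟨R, rfl⟩ := hs Z
    exact (Corep.isHom_toDoiHopfModule_iff (k := k) (P := T (T P Q) R) (Q := T P (T Q R))).2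
      (hX.associator P Q R) |>.congr
        ((ht _ _).trans (congrArg (PreDoiHopf.tensor A C i j · _) (ht _ _)))
        ((ht _ _).trans (congrArg (PreDoiHopf.tensor A C i j _) (ht _ _))) HEq.rfl
  · intro X
    obtain ⟨P, rfl⟩ := hs X
    exact (Corep.isHom_toDoiHopfModule_iff (k := k) (P := T I P) (Q := P)).2
      (hX.leftUnitor P) |>.congr
        ((ht _ _).trans (congrArg (PreDoiHopf.tensor A C i j · _) hu)) rfl HEq.rfl
  · intro X
    obtain ⟨P, rfl⟩ := hs X
    exact (Corep.isHom_toDoiHopfModule_iff (k := k) (P := T P I) (Q := P)).2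
      (hX.rightUnitor P) |>.congr
        ((ht _ _).trans (congrArg (PreDoiHopf.tensor A C i j _) hu)) rfl HEq.rfl

end Monoidal

/-! ### The monoidal category of Doi-Hopf modules and its comparison with comodules. -/

section Monoidal

variable {K : Type u} [Field K]
variable {VH VA VC : Type u} [AddCommGroup VH] [Module K VH] [AddCommGroup VA] [Module K VA]
  [AddCommGroup VC] [Module K VC] [Module.Finite K VA] {H : HomBialgebra K VH}
  {A : HomBialgebra K VA} {C : HomBialgebra K VC}
  {D : DoiHopfDatum H A.toHomAlgebra C.toHomCoalgebra} {m k i j : ℤ}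

/-- The monoidal category of Doi-Hopf modules. -/
abbrev DoiHopfDatum.DoiHopfModule.monoidalCategory (h : D.TensorData k i j) :
    MonoidalCategory (D.DoiHopfModule k) :=
  { toMonoidalCategoryStruct := h.struct
    tensorHom_def := fun _ _ => Hom.ext (TensorProduct.ext' fun _ _ => rfl)
    id_tensorHom_id := fun _ _ => Hom.ext (TensorProduct.ext' fun _ _ => rfl)
    tensorHom_comp_tensorHom := fun _ _ _ _ => Hom.ext (TensorProduct.ext' fun _ _ => rfl)
    whiskerLeft_id := fun _ _ => Hom.ext (TensorProduct.ext' fun _ _ => rfl)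
    id_whiskerRight := fun _ _ => Hom.ext (TensorProduct.ext' fun _ _ => rfl)
    associator_naturality := fun {X₁ _ X₃ Y₁ _ Y₃} f _ h => Hom.ext
      (HomObject.associator_naturality i j
        (X₁.isDoiHopfModule.isRightComodule.map_α Y₁.isDoiHopfModule.isRightComodule
          f.isHom.map_coact)
        (X₃.isDoiHopfModule.isRightComodule.map_α Y₃.isDoiHopfModule.isRightComodule
          h.isHom.map_coact))
    leftUnitor_naturality := fun {X Y} f => Hom.ext (HomObject.leftUnitor_naturality j
      (X.isDoiHopfModule.isRightComodule.map_α Y.isDoiHopfModule.isRightComodule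
        f.isHom.map_coact))
    rightUnitor_naturality := fun {X Y} f => Hom.ext (HomObject.rightUnitor_naturality i
      (X.isDoiHopfModule.isRightComodule.map_α Y.isDoiHopfModule.isRightComodule
        f.isHom.map_coact))
    pentagon := fun W X Y Z => Hom.ext (HomObject.pentagon i j W.toHomObject X.toHomObject
      Y.toHomObject Z.toHomObject)
    triangle := fun X Y => Hom.ext (HomObject.triangle i j X.toHomObject Y.toHomObject) }

section Functor

variable (hφ : IsMonoidalCotwistor (dualCopBialgebra A) C (D.φ m)) (h : D.TensorData k i j)
  (h' : CorepTensorData hφ.smashBialgebra i j)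

/-- The comparison of the tensor products of `doiHopfToCorep`. -/
def doiHopfToCorepμIso (X Y : D.DoiHopfModule k) :
    (⟨_, h'.tensorObj (X.toCorep hφ.toIsCotwistor) (Y.toCorep hφ.toIsCotwistor)⟩ :
      Corep (smashCoalgebra (B := dualCopCoalgebra A.toHomAlgebra) hφ.toIsCotwistor)) ≅
    (⟨_, h.tensorObj X Y⟩ : D.DoiHopfModule k).toCorep hφ.toIsCotwistor :=
  Corep.isoMk (LinearEquiv.refl K (X.carrier ⊗[K] Y.carrier))
    ((Corep.isHom_toDoiHopfModule_iff (k := k)).1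
      (PreDoiHopf.IsHom.congr (X := X.toPreDoiHopf.tensor A C i j Y.toPreDoiHopf)
        (Y := X.toPreDoiHopf.tensor A C i j Y.toPreDoiHopf) (f := LinearMap.id)
        ⟨fun _ _ => rfl, fun _ => (LinearMap.congr_fun (LinearMap.rTensor_id _ _) _).symm⟩
        (((PreComodule.toPreDoiHopf_tensor hφ i j (m - k + 1) _ _).trans
          (congrArg₂ (PreDoiHopf.tensor A C i j)
            (congrArg (·.toPreDoiHopf) (X.toDoiHopfModule_toCorep (hφ := hφ.toIsCotwistor)))
            (congrArg (·.toPreDoiHopf) (Y.toDoiHopfModule_toCorep (hφ := hφ.toIsCotwistor))))).symm)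
        (congrArg (·.toPreDoiHopf) (DoiHopfDatum.DoiHopfModule.toDoiHopfModule_toCorep
          (hφ := hφ.toIsCotwistor) (⟨_, h.tensorObj X Y⟩ : D.DoiHopfModule k)).symm) HEq.rfl))

/-- The comparison of the unit objects of `doiHopfToCorep`. -/
def doiHopfToCorepεIso :
    (⟨_, h'.tensorUnit⟩ :
      Corep (smashCoalgebra (B := dualCopCoalgebra A.toHomAlgebra) hφ.toIsCotwistor)) ≅
    (⟨_, h.tensorUnit⟩ : D.DoiHopfModule k).toCorep hφ.toIsCotwistor :=
  Corep.isoMk (LinearEquiv.refl K K)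
    ((Corep.isHom_toDoiHopfModule_iff (k := k)).1
      (PreDoiHopf.IsHom.congr (X := PreDoiHopf.unit A C)
        (Y := PreDoiHopf.unit A C) (f := LinearMap.id)
        ⟨fun _ _ => rfl, fun _ => (LinearMap.congr_fun (LinearMap.rTensor_id _ _) _).symm⟩
        (PreComodule.toPreDoiHopf_unit hφ (m - k + 1)).symm
        (congrArg (·.toPreDoiHopf) (DoiHopfDatum.DoiHopfModule.toDoiHopfModule_toCorep
          (hφ := hφ.toIsCotwistor) (⟨_, h.tensorUnit⟩ : D.DoiHopfModule k)).symm) HEq.rfl))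

/-- The comparison morphisms are identities of the underlying spaces and the constraints are given
by the same linear maps, so the coherence identities hold by definition on pure tensors. -/
lemma monoidallyIsomorphic_corep :
    MonoidallyIsomorphic (DoiHopfDatum.DoiHopfModule.monoidalCategory h)
      (Corep.monoidalCategory h') := by
  let M := DoiHopfDatum.DoiHopfModule.monoidalCategory h
  let N : MonoidalCategory (Corep (smashCoalgebra (B := dualCopCoalgebra A.toHomAlgebra)
    hφ.toIsCotwistor)) := Corep.monoidalCategory h'
  let F : (doiHopfToCorep (D := D) hφ.toIsCotwistor k).Monoidal := Functor.CoreMonoidal.toMonoidal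
    { εIso := doiHopfToCorepεIso hφ h h'
      μIso := doiHopfToCorepμIso hφ h h'
      μIso_hom_natural_left := fun _ _ => Corep.Hom.ext (TensorProduct.ext' fun _ _ => rfl)
      μIso_hom_natural_right := fun _ _ => Corep.Hom.ext (TensorProduct.ext' fun _ _ => rfl)
      associativity := fun _ _ _ => Corep.Hom.ext
        (TensorProduct.ext_threefold fun _ _ _ => rfl)
      left_unitality := fun _ => Corep.Hom.ext (TensorProduct.ext' fun _ _ => rfl)
      right_unitality := fun _ => Corep.Hom.ext (TensorProduct.ext' fun _ _ => rfl) }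
  exact ⟨_, _, doiHopfToCorep_comp _ k, corepToDoiHopf_comp _ k, ⟨F⟩⟩

end Functor

end Monoidal

/-! ### From monoidal Doi-Hopf modules and from the codouble back to the cotwistor. -/

section Converse

variable {K : Type u} [Field K]

section

variable {VB VD : Type u} [AddCommGroup VB] [Module K VB] [AddCommGroup VD] [Module K VD]
  {B : HomBialgebra K VB} {D : HomBialgebra K VD} {φ : VB ⊗[K] VD →ₗ[K] VD ⊗[K] VB}

/-- If the tensor square of the regular smash comodule is again intertwined by `φ`, then `φ` is
multiplicative. -/
lemma IsCotwistor.map₂_of_tensorCoact (hφ : IsCotwistor B.toHomCoalgebra D.toHomCoalgebra φ)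
    (i j : ℤ) {ρB : VB ⊗[K] VD →ₗ[K] (VB ⊗[K] VD) ⊗[K] VB}
    {ρD : VB ⊗[K] VD →ₗ[K] (VB ⊗[K] VD) ⊗[K] VD}
    (hBD : ∀ u, iterCoact ρB ρD D.α u =
      smashComul B.toHomCoalgebra D.toHomCoalgebra φ (TensorProduct.congr B.α D.α u))
    (hDB : ∀ u, φ.lTensor (VB ⊗[K] VD) (iterCoact ρB ρD D.α u) = iterCoact ρD ρB B.α u)
    (h : ∀ t, φ.lTensor ((VB ⊗[K] VD) ⊗[K] (VB ⊗[K] VD))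
      (iterCoact (tensorCoact B.toHomAlgebra i j ρB ρB) (tensorCoact D.toHomAlgebra i j ρD ρD)
        D.α t) =
      iterCoact (tensorCoact D.toHomAlgebra i j ρD ρD) (tensorCoact B.toHomAlgebra i j ρB ρB)
        B.α t) (x y : VB ⊗[K] VD) :
    φ (TensorProduct.map₂ B.mul D.mul x y) = TensorProduct.map₂ D.mul B.mul (φ x) (φ y) := by
  let S := smashCoalgebra hφ
  -- The counit of the smash coproduct on both module factors, used to discard them from the
  -- exchange relation.
  let e : (VB ⊗[K] VD) ⊗[K] (VB ⊗[K] VD) →ₗ[K] K :=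
    TensorProduct.lift ((LinearMap.mul K K).compl₁₂ S.counit S.counit)
  have he : ∀ x y, e (TensorProduct.mk K _ _ x y) = S.counit x * S.counit y := fun _ _ => rfl
  have hn : ∀ {M N : Type u} [AddCommGroup M] [Module K M] [AddCommGroup N] [Module K N]
      (c : M →ₗ[K] K) (f : VB ⊗[K] VD →ₗ[K] N) (z : M ⊗[K] (VB ⊗[K] VD)),
      TensorProduct.lid K N (c.rTensor N (f.lTensor M z)) =
        f (TensorProduct.lid K _ (c.rTensor _ z)) := by
    intro M N _ _ _ _ c f z
    induction z using TensorProduct.induction_on with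
    | zero => simp
    | add x y hx hy => simp only [map_add, hx, hy]
    | tmul x y => simp
  have hc : ∀ u, TensorProduct.lid K _ (S.counit.rTensor _ (iterCoact ρB ρD D.α u)) =
      S.α (S.α u) := by
    intro u
    rw [hBD]
    exact S.counit_comul (S.α u)
  -- By `hBD` the iterated coaction is the coproduct after α, so discarding its first factor leaves
  -- α². Both sides of the exchange relation for u ⊗ v then become twisted products, before and
  -- after φ.
  have key : ∀ u v, φ (TensorProduct.map₂ (B.twistMul i j) (D.twistMul i j) (S.α (S.α u))
      (S.α (S.α v))) = TensorProduct.map₂ (D.twistMul i j) (B.twistMul i j)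
        (φ (S.α (S.α u))) (φ (S.α (S.α v))) := by
    intro u v
    have h1 := h (u ⊗ₜ v)
    rw [iterCoact_tensorCoact, iterCoact_tensorCoact] at h1
    have h2 := congrArg (fun z => TensorProduct.lid K _ (e.rTensor _ z)) h1
    simp only [hn, lid_rTensor_map₂ he, ← hDB, hc] at h2
    exact h2
  have hα : ∀ (n : ℤ) (z : VB ⊗[K] VD), φ ((S.α ^ n) z) =
      (TensorProduct.congr D.α B.α ^ n) (φ z) :=
    fun n z => zpow_intertwine (e := S.α) (e' := TensorProduct.congr D.α B.α)
      (fun z => hφ.map_α_apply z) n z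
  -- Bijectivity of the structure map lets arbitrary `x`, `y` absorb the powers of α in `key`.
  have hs : ∀ (n : ℤ) (z : VB ⊗[K] VD), ∃ w, (S.α ^ n) (S.α (S.α w)) = z := fun n z =>
    ((S.α ^ n).surjective.comp (S.α.surjective.comp S.α.surjective)) z
  obtain ⟨u, rfl⟩ := hs i x
  obtain ⟨v, rfl⟩ := hs j y
  rw [hα, hα, ← map₂_twistMul D.toHomAlgebra B.toHomAlgebra, ← key]
  exact congrArg φ (map₂_twistMul B.toHomAlgebra D.toHomAlgebra i j _ _).symm

end

variable {VH VA VC : Type u} [AddCommGroup VH] [Module K VH] [AddCommGroup VA] [Module K VA]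
  [AddCommGroup VC] [Module K VC] [Module.Finite K VA]
  {H : HomBialgebra K VH} {A : HomBialgebra K VA} {C : HomBialgebra K VC}
  {D : DoiHopfDatum H A.toHomAlgebra C.toHomCoalgebra} {k i j : ℤ}

/-- A smash coproduct as a comodule over itself. -/
def regularCorep {V : Type u} [AddCommGroup V] [Module K V] [Module.Finite K V]
    (S : HomCoalgebra K V) : Corep S where
  carrier := V
  α := S.α
  coact := S.comul
  isRightComodule := ⟨S.coassoc, S.comul_counit⟩

/-- Two objects suffice: the tensor square of the regular comodule gives (M5), the unit object gives
(M6). Finiteness of `VC` makes A* ⊗ C an admissible object. The hypothesis does not involve m: any m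
gives a dictionary with the same Doi-Hopf modules. -/
lemma DoiHopfDatum.TensorData.isMonoidalCotwistor [Module.Finite K VC] (h : D.TensorData k i j)
    (m : ℤ) :
    IsMonoidalCotwistor (dualCopBialgebra A) C (D.φ m) := by
  have hφ : IsCotwistor (dualCopBialgebra A).toHomCoalgebra C.toHomCoalgebra (D.φ m) :=
    (D.isEntwining m).isCotwistor
  let S := smashCoalgebra hφ
  let P : Corep S := regularCorep S
  have hP := P.isRightComodule.isPairComodule
  have hPP : ∀ u a, _ := P.evalAt_fst_coact A.toHomAlgebra C.toHomCoalgebra (m - k + 1)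
  have hT := (isPairComodule_iff_isDoiHopfModule
    (X := (P.toDoiHopfModule k).toPreDoiHopf.tensor A C i j (P.toDoiHopfModule k).toPreDoiHopf)
    D m k (evalAt_tensorCoact A.toHomCoalgebra i j (m - k + 1) hPP hPP)).2
    (h.tensorObj (P.toDoiHopfModule k) (P.toDoiHopfModule k))
  have hI := (isPairComodule_iff_isDoiHopfModule (X := PreDoiHopf.unit A C)
    (ρB := (TensorProduct.mk K K (Module.Dual K VA)).flip A.counit) D m k
    (fun (r : K) a => by
      change evalAt a (r ⊗ₜ[K] A.counit) = r * A.counit ((A.α ^ (m - k + 1)) a)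
      rw [evalAt_tmul, A.counit_α_zpow, smul_eq_mul, mul_comm])).2 h.tensorUnit
  refine ⟨hφ, fun a b x y => ?_, ?_⟩
  · exact (hφ.map₂_of_tensorCoact i j (fun u => iterCoact_fst_snd P.isRightComodule u)
      hP.compat hT.compat (a ⊗ₜ x) (b ⊗ₜ y)).symm
  · have h1 := congrArg (TensorProduct.lid K _) (hI.compat (1 : K))
    change TensorProduct.lid K _ ((1 : K) ⊗ₜ[K] (D.φ m) (A.counit ⊗ₜ[K] C.α C.one)) =
      TensorProduct.lid K _ ((1 : K) ⊗ₜ[K] (C.one ⊗ₜ[K] (dualCopBialgebra A).α A.counit)) at h1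
    rw [TensorProduct.lid_tmul, TensorProduct.lid_tmul, one_smul, one_smul, C.α_one] at h1
    exact h1.trans (congrArg _ (dualCopBialgebra A).α_one)

lemma DoiHopfDatum.isCodouble_smashBialgebra {m : ℤ}
    (hφ : IsMonoidalCotwistor (dualCopBialgebra A) C (D.φ m)) :
    D.IsCodouble m hφ.smashBialgebra where
  α_eq f c := rfl
  comul_eq := rfl
  counit_eq f c := by
    refine (congrArg (dualCopBialgebra A).counit (smashFst_tmul C.toHomCoalgebra f c)).trans ?_
    rw [map_smul, smul_eq_mul, mul_comm]
    rfl
  mul_eq f g x y := rfl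
  one_eq := rfl

/-- The product of `X` is prescribed on pure tensors, hence everywhere, so the bialgebra axioms of
`X` become multiplicativity and unitality of the smash coproduct. -/
lemma DoiHopfDatum.IsCodouble.isMonoidalCotwistor {m : ℤ}
    {X : HomBialgebra K (Module.Dual K VA ⊗[K] VC)} (h : D.IsCodouble m X) :
    IsMonoidalCotwistor (dualCopBialgebra A) C (D.φ m) := by
  have hm : X.mul = TensorProduct.map₂ (dualCopBialgebra A).mul C.mul := by
    apply TensorProduct.ext'
    intro f x
    apply TensorProduct.ext'
    intro g y
    exact h.mul_eq f g x y
  have h1 := X.comul_mul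
  have h2 := X.comul_one
  rw [hm, h.comul_eq] at h1
  rw [h.comul_eq, h.one_eq] at h2
  exact IsCotwistor.isMonoidalCotwistor (B := dualCopBialgebra A) (D := C)
    (D.isEntwining m).isCotwistor h1 h2

end Converse

end HomDoiHopf

end

open HomDoiHopf

/-- Equivalence of the monoidality conditions for a Hom-Doi-Hopf datum `(H, A, C)`. -/
theorem mainTheorem10 {K : Type u} [Field K] {VH VA VC : Type u}
    [AddCommGroup VH] [Module K VH]
    [AddCommGroup VA] [Module K VA] [Module.Finite K VA]
    [AddCommGroup VC] [Module K VC] [Module.Finite K VC]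
    (H : HomDoiHopf.HomBialgebra K VH) (A : HomDoiHopf.HomBialgebra K VA)
    (C : HomDoiHopf.HomBialgebra K VC)
    (D : HomDoiHopf.DoiHopfDatum H A.toHomAlgebra C.toHomCoalgebra) (m k i j : ℤ) :
    List.TFAE
      [D.Compatible,
       HomDoiHopf.IsMonoidalEntwining C A (D.Φ m),
       HomDoiHopf.IsMonoidalCotwistor (HomDoiHopf.dualCopBialgebra A) C (D.φ m),
       ∃ X : HomDoiHopf.HomBialgebra K (Module.Dual K VA ⊗[K] VC), D.IsCodouble m X,
       ∃ M : MonoidalCategory (D.DoiHopfModule k), D.IsDoiHopfMonoidal k i j M] ∧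
    (D.Compatible →
      ∃ X : HomDoiHopf.HomBialgebra K (Module.Dual K VA ⊗[K] VC), D.IsCodouble m X ∧
        ∃ M : MonoidalCategory (D.DoiHopfModule k), D.IsDoiHopfMonoidal k i j M ∧
          ∃ N : MonoidalCategory (HomDoiHopf.Corep X.toHomCoalgebra), HomDoiHopf.IsCorepMonoidal X i j N ∧ HomDoiHopf.MonoidallyIsomorphic M N) := by
  have h12 := D.compatible_iff_isMonoidalEntwining m
  have h23 : IsMonoidalEntwining C A (D.Φ m) ↔
      IsMonoidalCotwistor (dualCopBialgebra A) C (D.φ m) :=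
    IsEntwining.isMonoidalEntwining_iff (D.isEntwining m)
  refine ⟨?_, fun h => ?_⟩
  · tfae_have 1 ↔ 2 := h12
    tfae_have 2 ↔ 3 := h23
    tfae_have 3 → 4 := fun h => ⟨_, D.isCodouble_smashBialgebra h⟩
    tfae_have 4 → 3 := fun ⟨_, h⟩ => h.isMonoidalCotwistor
    tfae_have 3 → 5 := fun h =>
      ⟨DoiHopfDatum.DoiHopfModule.monoidalCategory (doiHopfTensorData h k i j), _, rfl⟩
    tfae_have 5 → 3 := fun ⟨_, h, _⟩ => h.isMonoidalCotwistor m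
    tfae_finish
  · have hφ := h23.1 (h12.1 h)
    exact ⟨_, D.isCodouble_smashBialgebra hφ,
      DoiHopfDatum.DoiHopfModule.monoidalCategory (doiHopfTensorData hφ k i j), ⟨_, rfl⟩,
      Corep.monoidalCategory (corepTensorData hφ.smashBialgebra i j), ⟨_, rfl⟩,
      monoidallyIsomorphic_corep hφ _ _⟩
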